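/- Let $d\ge 2$ be an integer, $s>0$, and $\phi_s(r)=\sqrt{s^2+r^2}$. Write $D=\sqrt{-\Delta}$ on $\mathbb R^d$, so that $\phi_s(D)$ and the Klein--Gordon propagator $e^{it\phi_s(D)}$ are the Fourier multiplier operators with symbols $\phi_s(|\xi|)$ and $e^{it\phi_s(|\xi|)}$. For $\beta\in\mathbb R$ let $|\square-(2s)^2|^\beta$ be the space-time Fourier multiplier operator on $\mathbb R\times\mathbb R^d$ with symbol $\big|\tau^2-|\xi|^2-(2s)^2\big|^\beta$ (that is, $\square=D_-D_+$ where $D_\pm$ has symbol $||\tau|\pm|\xi||$; the space-time Fourier transform of $(e^{it\phi_s(D)}f)^2$ is a locally integrable function supported where $\tau^2-|\xi|^2\ge(2s)^2$). For $\alpha\geq 0$ let $H^\alpha$ be the space of all complex-valued $f\in L^2(\mathbb R^d)$ with $\phi_s(D)^\alpha f\in L^2(\mathbb R^d)$. Put $$\mathbf F_{(++)}(\beta,d)=2^{-1+4\beta}\,\pi^{\frac{1-d}{2}}\,\frac{\Gamma(d-2+2\beta)}{\Gamma(\frac{3d-5}{2}+2\beta)} .$$ (i) For $(\alpha,\beta)=(\frac12,\frac{3-d}{4})$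 and for $(\alpha,\beta)=(1,\frac{5-d}{4})$ the estimate $$\big\||\square-(2s)^2|^\beta (e^{it\phi_s(D)}f)^2\big\|_{L^2(\mathbb R^{d+1})}\le C\,\|\phi_s(D)^\alpha f\|_{L^2(\mathbb R^d)}^2\qquad(f\in H^\alpha)\tag{1}$$ holds with $C=\mathbf F_{(++)}(\beta,d)^{1/2}$. Furthermore $$\big\||\square-(2s)^2|^{\frac{5-d}{4}} (e^{it\phi_s(D)}f)^2\big\|_{L^2(\mathbb R^{d+1})}\le \mathbf F_{(++)}(\tfrac{5-d}{4},d)^{\frac12}\Big(\|\phi_s(D)f\|_{L^2(\mathbb R^d)}^4-s^2\|\phi_s(D)^{\frac12}f\|_{L^2(\mathbb R^d)}^4\Big)^{\frac12}\qquad(f\in H^1).$$ (ii) For $(\alpha,\beta)=(\frac12,\frac{2-d}{4})$ the estimate (1) holds with $$C=\Big(2^{1-d}\pi^{\frac{1-d}{2}}\frac{\Gamma(\frac{d-1}{2})}{\Gamma(d-1)}\,s^{-1}\Big)^{\frac12}.$$ Furthermore $$\big\||\square-(2s)^2|^{\frac{4-d}{4}} (e^{it\phi_s(D)}f)^2\big\|_{L^2(\mathbb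 R^{d+1})}\le \Big(2^{2-d}\pi^{\frac{1-d}{2}}\frac{\Gamma(\frac{d-1}{2})}{\Gamma(d-1)}\,s^{-1}\Big)^{\frac12}\Big(\|\phi_s(D)f\|_{L^2(\mathbb R^d)}^4-s^2\|\phi_s(D)^{\frac12}f\|_{L^2(\mathbb R^d)}^4\Big)^{\frac12}\qquad(f\in H^1).$$ In each of these five estimates the constant is optimal (it is the smallest constant for which the estimate holds on the stated class of $f$), and there are no extremisers: no nonzero $f$ in the class attains equality. -/

import Mathlib

open MeasureTheory FourierTransform SchwartzMap
open scoped ENNReal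

namespace KleinGordon

noncomputable section

/-- The space `ℝ^d`. -/
abbrev Space (d : ℕ) : Type := EuclideanSpace ℝ (Fin d)

/-- Space-time `ℝ × ℝ^d` with its Euclidean structure and Lebesgue measure; the first component of
a point is the time (or the temporal frequency `τ`). -/
abbrev SpaceTime (d : ℕ) : Type := WithLp 2 (ℝ × Space d)

/-- Complex-valued `L²` functions on `ℝ^d`. -/
abbrev L2Space (d : ℕ) : Type := Lp ℂ 2 (volume : Measure (Space d))

/-- Complex-valued `L²` functions on space-time. -/
abbrev L2SpaceTime (d : ℕ) : Type := Lp ℂ 2 (volume : Measure (SpaceTime d))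

/-- `φ_s(r) = √(s² + r²)`. -/
def phi (s r : ℝ) : ℝ := Real.sqrt (s ^ 2 + r ^ 2)

/-- The multiplier of `e^{itφ_s(D)}`. As `𝓕 f (ξ) = ∫ e^{-2πi⟨x, ξ⟩} f(x) dx` in Mathlib, the
operator `D = √(-Δ)` has the symbol `2π|ξ|`. -/
def propagatorSymbol {d : ℕ} (s t : ℝ) (ξ : Space d) : ℂ :=
  Complex.exp (Complex.I * ((t * phi s (2 * Real.pi * ‖ξ‖) : ℝ) : ℂ))

theorem continuous_propagatorSymbol {d : ℕ} (s t : ℝ) :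
    Continuous (propagatorSymbol (d := d) s t) := by
  unfold propagatorSymbol phi
  fun_prop

theorem norm_propagatorSymbol {d : ℕ} (s t : ℝ) (ξ : Space d) :
    ‖propagatorSymbol s t ξ‖ = 1 := by
  unfold propagatorSymbol
  rw [mul_comm]
  exact Complex.norm_exp_ofReal_mul_I _

theorem memLp_propagatorSymbol_mul {d : ℕ} (s t : ℝ) (h : L2Space d) :
    MemLp (fun ξ => propagatorSymbol s t ξ * h ξ) 2 (volume : Measure (Space d)) := by
  refine (Lp.memLp h).of_le
    ((continuous_propagatorSymbol s t).aestronglyMeasurable.mul (Lp.aestronglyMeasurable h)) ?_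
  exact Filter.Eventually.of_forall fun ξ => by simp [norm_propagatorSymbol]

/-- The Klein--Gordon propagator `e^{itφ_s(D)} f` for `f ∈ L²(ℝ^d)`. -/
def propagator {d : ℕ} (s t : ℝ) (f : L2Space d) : L2Space d :=
  𝓕⁻ (memLp_propagatorSymbol_mul s t (𝓕 f)).toLp

/-- `‖φ_s(D)^α f‖_{L²(ℝ^d)}` with values in `[0, ∞]`, computed on the Fourier side. -/
def sobolevENorm {d : ℕ} (s α : ℝ) (f : L2Space d) : ℝ≥0∞ :=
  eLpNorm (fun ξ : Space d => ((phi s (2 * Real.pi * ‖ξ‖) ^ α : ℝ) : ℂ) * (𝓕 f : L2Space d) ξ) 2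
    volume

/-- `‖φ_s(D)^α f‖_{L²(ℝ^d)}` as a real number (for `f` in `sobolevSpace d s α`). -/
def sobolevNorm {d : ℕ} (s α : ℝ) (f : L2Space d) : ℝ := (sobolevENorm s α f).toReal

/-- The `f ∈ L²(ℝ^d)` with `φ_s(D)^α f ∈ L²(ℝ^d)`; for `α ≥ 0` this is `H^α(ℝ^d)`. -/
def sobolevSpace (d : ℕ) (s α : ℝ) : Set (L2Space d) := {f | sobolevENorm s α f < ∞}

/-- The space-time Fourier transform, in the sense of tempered distributions, of the function
`(t, x) ↦ (e^{itφ_s(D)} f (x))²` is the function `G`. The square lies in `L^∞_t L^1_x`, and its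
pairing with a Schwartz function is written as an iterated integral, so that it does not depend on
the representatives of the classes `e^{itφ_s(D)} f`. -/
def IsFourierOfSquare {d : ℕ} (s : ℝ) (f : L2Space d) (G : SpaceTime d → ℂ) : Prop :=
  ∀ ψ : 𝓢(SpaceTime d, ℂ),
    Integrable (fun z => G z * ψ z) ∧
      ∫ z, G z * ψ z =
        ∫ t : ℝ, ∫ x : Space d, (propagator s t f) x ^ 2 * (𝓕 ψ) (WithLp.toLp 2 (t, x))

/-- The symbol `|τ² - |ξ|² - (2s)²|` of `|□ - (2s)²|`, where `□ = D₋D₊`, at the frequency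
`2π (τ, ξ)`. -/
def nullSymbol {d : ℕ} (s : ℝ) (z : SpaceTime d) : ℝ :=
  |(2 * Real.pi * z.fst) ^ 2 - (2 * Real.pi * ‖z.snd‖) ^ 2 - (2 * s) ^ 2|

/-- `w = |□ - (2s)²|^β (e^{itφ_s(D)} f)²` as an element of `L²(ℝ × ℝ^d)`. -/
def IsNullForm {d : ℕ} (s β : ℝ) (f : L2Space d) (w : L2SpaceTime d) : Prop :=
  ∃ G : SpaceTime d → ℂ, IsFourierOfSquare s f G ∧
    ((𝓕 w : L2SpaceTime d) : SpaceTime d → ℂ) =ᵐ[volume]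
      fun z => ((nullSymbol s z ^ β : ℝ) : ℂ) * G z

/-- `‖|□ - (2s)²|^β (e^{itφ_s(D)} f)²‖_{L²(ℝ × ℝ^d)}`; it is `∞` if
`|□ - (2s)²|^β (e^{itφ_s(D)} f)²` is not an `L²` function (and there is at most one `w` below). -/
def nullFormENorm {d : ℕ} (s β : ℝ) (f : L2Space d) : ℝ≥0∞ :=
  ⨅ (w : L2SpaceTime d) (_ : IsNullForm s β f w), ‖w‖ₑ

/-- The estimate `N f ≤ C * R f` holds for all `f ∈ X`, the constant `C` is optimal, and no
nonzero `f ∈ X` attains equality. -/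
def SharpWithoutExtremisers {d : ℕ} (X : Set (L2Space d)) (N : L2Space d → ℝ≥0∞)
    (R : L2Space d → ℝ) (C : ℝ) : Prop :=
  IsLeast {A : ℝ | 0 ≤ A ∧ ∀ f ∈ X, N f ≤ ENNReal.ofReal (A * R f)} C ∧
    ∀ f ∈ X, f ≠ 0 → N f ≠ ENNReal.ofReal (C * R f)

/-- The right-hand side `(‖φ_s(D) f‖⁴ - s² ‖φ_s(D)^{1/2} f‖⁴)^{1/2}` of the refined estimates. -/
def refinedNorm {d : ℕ} (s : ℝ) (f : L2Space d) : ℝ :=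
  Real.sqrt (sobolevNorm s 1 f ^ 4 - s ^ 2 * sobolevNorm s (1 / 2) f ^ 4)

/-- The constant `F₍₊₊₎(β, d)` of the wave regime. -/
def waveConst (β : ℝ) (d : ℕ) : ℝ :=
  (2 : ℝ) ^ (-1 + 4 * β) * Real.pi ^ ((1 - (d : ℝ)) / 2) *
    (Real.Gamma ((d : ℝ) - 2 + 2 * β) / Real.Gamma ((3 * (d : ℝ) - 5) / 2 + 2 * β))

end

end KleinGordon

open KleinGordon

/-! Put σ = s/(2π), E(ξ) = √(σ² + |ξ|²) and F = 𝓕 f. With frequencies scaled by 2π, the dispersion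
relation is 2πE(ξ), so the space-time Fourier transform of the squared solution is the image of
F(ξ)F(η) dξ dη under Φ(ξ, η) = (E(ξ) + E(η), ξ + η) (`integral_propagator_sq`). Boosting each pair
of momenta to its centre of mass frame shows that Φ carries the Lorentz invariant measure dξ dη /
(E(ξ)E(η)) to J(z) dz. On the forward region M > 4σ², where M = τ² - |ζ|² is the squared mass, J is
a constant times (M - 4σ²)^{(d-2)/2} / √M (`measurePreserving_pairMap`).

The transform is therefore J g, where g averages the amplitude E(ξ)F(ξ)E(η)F(η) over the fibres of
Φ. Cauchy-Schwarz on the fibres bounds the squared null form norm by ∬ e(ξ) e(η) κ(Φ(ξ, η)) dξ dη,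
where e = E|F|² and κ is J times the symbol to the power 2β (`nullFormENorm_sq_le_lintegral`). For F
= e^{-aE}/E the amplitude is e^{-aτ}, which is constant on fibres, and nothing is lost
(`lintegral_le_nullFormENorm_sq`).

Up to a constant, κ is (M - 4σ²)^γ / √M with γ = (d-2)/2 + 2β, and the listed values of β give γ =
1/2 and 3/2 (wave regime), 0 and 1 (non-wave regime). For γ = 1/2 and γ = 0 the kernel lies strictly
below its supremum, approached as M → ∞ and as M → 4σ² respectively. For γ = 3/2 and γ = 1 there is
one more factor M - 4σ² = 2(E(ξ)E(η) - σ² - ξ·η). Its integral against e ⊗ e is 2((∫Ee)² - σ²(∫e)² -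
|∫eξ|²), and dropping the last square leaves the refined norm (`integrable_massSq_mul`). The kernel
bounds are strict off the null set ξ = η, so equality forces f = 0 (`nullFormENorm_sq_lt`).

Optimality is tested on the same profiles e^{-aE}/E, whose momentum integral vanishes by symmetry.
As a → 0 the pairs have large mass, which saturates the wave constants; as a → ∞ they come to rest,
which saturates the non-wave constants. -/

namespace KleinGordon

open Filter Topology

/-! ### Lorentz boosts to the centre of mass frame -/

section Boost

variable {V : Type*} [NormedAddCommGroup V]

/-- The energy `√(σ² + |x|²)` of a particle of mass `σ` and momentum `x`. -/
noncomputable def energy (σ : ℝ) (x : V) : ℝ := Real.sqrt (σ ^ 2 + ‖x‖ ^ 2)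

theorem energy_sq (σ : ℝ) (x : V) : energy σ x ^ 2 = σ ^ 2 + ‖x‖ ^ 2 :=
  Real.sq_sqrt (by positivity)

theorem energy_pos {σ : ℝ} (hσ : 0 < σ) (x : V) : 0 < energy σ x :=
  Real.sqrt_pos.2 (by positivity)

theorem norm_lt_energy {σ : ℝ} (hσ : 0 < σ) (x : V) : ‖x‖ < energy σ x :=
  Real.lt_sqrt_of_sq_lt (by nlinarith)

theorem le_energy (σ : ℝ) (x : V) : σ ≤ energy σ x :=
  Real.le_sqrt_of_sq_le (by nlinarith [sq_nonneg ‖x‖])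

theorem continuous_energy (σ : ℝ) : Continuous (energy σ : V → ℝ) := by
  unfold energy
  fun_prop

theorem measurable_energy [MeasurableSpace V] [BorelSpace V] (σ : ℝ) :
    Measurable (energy σ : V → ℝ) := (continuous_energy σ).measurable

/-- The dilation factor, along the direction of the total momentum, between the centre of mass
frame and a frame in which the total momentum has length `R`. -/
noncomputable def boostFactor (σ R : ℝ) (k : V) : ℝ :=
  Real.sqrt (1 + R ^ 2 / (4 * (σ ^ 2 + ‖k‖ ^ 2)))

theorem boostFactor_pos (σ R : ℝ) (k : V) : 0 < boostFactor σ R k :=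
  Real.sqrt_pos.2 (by positivity)

theorem boostFactor_sq (σ R : ℝ) (k : V) :
    boostFactor σ R k ^ 2 = 1 + R ^ 2 / (4 * energy σ k ^ 2) := by
  rw [energy_sq]
  exact Real.sq_sqrt (by positivity)

theorem energy_mul_boostFactor_sq {σ : ℝ} (hσ : 0 < σ) (R : ℝ) (k : V) :
    (energy σ k * boostFactor σ R k) ^ 2 = energy σ k ^ 2 + R ^ 2 / 4 := by
  have := energy_pos hσ k
  rw [mul_pow, boostFactor_sq]
  field_simp

variable [InnerProductSpace ℝ V]

/-- The relative momentum in a frame with total momentum `R • e`, as a function of the momentum `k`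
in the centre of mass frame. -/
noncomputable def boostMap (σ R : ℝ) (e k : V) : V :=
  k + ((boostFactor σ R k - 1) * inner ℝ e k) • e

theorem inner_boostMap {e : V} (he : ‖e‖ = 1) (σ R : ℝ) (k : V) :
    inner ℝ e (boostMap σ R e k) = boostFactor σ R k * inner ℝ e k := by
  rw [boostMap, inner_add_right, inner_smul_right, real_inner_self_eq_norm_sq, he]
  ring

theorem abs_inner_le_energy {σ : ℝ} (hσ : 0 < σ) {e : V} (he : ‖e‖ = 1) (k : V) :
    |inner ℝ e k| ≤ energy σ k := by
  have := abs_real_inner_le_norm e k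
  rw [he, one_mul] at this
  exact this.trans (norm_lt_energy hσ k).le

theorem half_mul_inner_div_energy_le {σ : ℝ} (hσ : 0 < σ) {e : V} (he : ‖e‖ = 1) (R : ℝ) (k : V) :
    |R * inner ℝ e k / (2 * energy σ k)| ≤ energy σ k * boostFactor σ R k := by
  have hE := energy_pos hσ k
  refine abs_le_of_sq_le_sq ?_ (mul_pos hE (boostFactor_pos σ R k)).le
  rw [energy_mul_boostFactor_sq hσ, div_pow, mul_pow, mul_pow, div_le_iff₀ (by positivity)]
  have h1 : inner ℝ e k ^ 2 ≤ energy σ k ^ 2 := sq_le_sq' (by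
    linarith [(abs_le.1 (abs_inner_le_energy hσ he k)).1]) (le_of_abs_le (abs_inner_le_energy hσ he k))
  nlinarith [mul_le_mul_of_nonneg_left h1 (sq_nonneg R), sq_nonneg (energy σ k ^ 2)]

/-- This is the Lorentz transformation of energy. The boost has Lorentz factor γ equal to
`boostFactor` and velocity v with γv = R / (2E), so that each momentum ±k gains R/2 along e. The
square root is removed by squaring; the right-hand side is nonnegative because |⟨e, k⟩| ≤ E. -/
theorem energy_boostMap_add {σ : ℝ} (hσ : 0 < σ) {e : V} (he : ‖e‖ = 1) (R : ℝ) (k : V) :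
    energy σ (boostMap σ R e k + (R / 2) • e) =
      energy σ k * boostFactor σ R k + R * inner ℝ e k / (2 * energy σ k) := by
  have hE := energy_pos hσ k
  have h0 := (abs_le.1 (half_mul_inner_div_energy_le hσ he R k)).1
  rw [energy, Real.sqrt_eq_iff_eq_sq (by positivity) (by linarith), add_sq (energy σ k * _),
    energy_mul_boostFactor_sq hσ, boostMap, add_assoc, ← add_smul, norm_add_sq_real, norm_smul,
    inner_smul_right, he, real_inner_comm e k, mul_one, Real.norm_eq_abs, sq_abs]
  have hE2 := energy_sq σ k
  have hb := boostFactor_sq σ R k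
  set x := inner ℝ e k
  set c := boostFactor σ R k
  set E := energy σ k
  have hE' : E ≠ 0 := hE.ne'
  have : (R * x / (2 * E)) ^ 2 = (c ^ 2 - 1) * x ^ 2 := by
    rw [hb]; field_simp; ring
  have h3 : 2 * (E * c) * (R * x / (2 * E)) = c * R * x := by field_simp
  rw [this, h3, hE2]
  ring

theorem energy_sub_boostMap {σ : ℝ} (hσ : 0 < σ) {e : V} (he : ‖e‖ = 1) (R : ℝ) (k : V) :
    energy σ ((R / 2) • e - boostMap σ R e k) =
      energy σ k * boostFactor σ R k - R * inner ℝ e k / (2 * energy σ k) := by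
  have h : boostMap σ R e (-k) = -boostMap σ R e k := by
    simp only [boostMap, boostFactor, norm_neg, inner_neg_right, mul_neg, neg_smul, neg_add]
  have h1 := energy_boostMap_add hσ he R (-k)
  rw [h] at h1
  rw [sub_eq_neg_add, h1]
  simp only [energy, boostFactor, norm_neg, inner_neg_right]
  ring

/-- The total energy of the boosted pair is 2Eγ with (Eγ)² = E² + R²/4. The image thus determines E,
then γ, then the component of k along e, and finally k. -/
theorem boostMap_injective {σ : ℝ} (hσ : 0 < σ) {e : V} (he : ‖e‖ = 1) (R : ℝ) :
    Function.Injective (boostMap σ R e) := by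
  intro k k' h
  have hs : ∀ l, energy σ (boostMap σ R e l + (R / 2) • e) +
      energy σ ((R / 2) • e - boostMap σ R e l) = 2 * (energy σ l * boostFactor σ R l) := by
    intro l
    rw [energy_boostMap_add hσ he, energy_sub_boostMap hσ he]; ring
  have h1 : energy σ k * boostFactor σ R k = energy σ k' * boostFactor σ R k' := by
    have := hs k
    rw [h, hs k'] at this
    linarith
  have h2 : energy σ k ^ 2 = energy σ k' ^ 2 := by
    have a := energy_mul_boostFactor_sq hσ R k
    rw [h1, energy_mul_boostFactor_sq hσ R k'] at a
    linarith
  have h3 : boostFactor σ R k = boostFactor σ R k' := by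
    rw [energy_sq, energy_sq] at h2
    rw [boostFactor, boostFactor, h2]
  have h4 : inner ℝ e k = inner ℝ e k' := by
    have := congrArg (inner ℝ e) h
    rw [inner_boostMap he, inner_boostMap he, h3] at this
    exact mul_left_cancel₀ (boostFactor_pos σ R k').ne' this
  rw [boostMap, boostMap, h3, h4] at h
  exact add_right_cancel h

theorem boostMap_surjective {σ : ℝ} (hσ : 0 < σ) {e : V} (he : ‖e‖ = 1) {R : ℝ} (hR : 0 ≤ R) :
    Function.Surjective (boostMap σ R e) := by
  intro w
  set P := energy σ (w + (R / 2) • e) with hP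
  set Q := energy σ ((R / 2) • e - w) with hQ
  set X := inner ℝ e w with hX
  have hP0 : 0 < P := energy_pos hσ _
  have hQ0 : 0 < Q := energy_pos hσ _
  have hPs : P ^ 2 = σ ^ 2 + (‖w‖ ^ 2 + R * X + R ^ 2 / 4) := by
    rw [hP, energy_sq, norm_add_sq_real, norm_smul, inner_smul_right, he, real_inner_comm,
      Real.norm_eq_abs, mul_one, sq_abs]
    ring
  have hQs : Q ^ 2 = σ ^ 2 + (‖w‖ ^ 2 - R * X + R ^ 2 / 4) := by
    rw [hQ, energy_sq, norm_sub_sq_real, norm_smul, inner_smul_left, he,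
      Real.norm_eq_abs, mul_one, sq_abs]
    simp only [conj_trivial]
    ring
  have hR' : R < P + Q := by
    have h1 := norm_lt_energy hσ (w + (R / 2) • e)
    have h2 := norm_lt_energy hσ ((R / 2) • e - w)
    have h3 := norm_add_le (w + (R / 2) • e) ((R / 2) • e - w)
    have h4 : w + (R / 2) • e + ((R / 2) • e - w) = R • e := by
      module
    rw [h4, norm_smul, he, Real.norm_of_nonneg hR] at h3
    linarith
  -- The candidate preimage undoes the boost: with total energy τ and invariant mass m = √(τ² - R²),
  -- the component of w along e is contracted by m/τ, the reciprocal of the Lorentz factor.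
  set τ := P + Q with hτ
  have hτ0 : 0 < τ := by positivity
  have hm2 : 0 < τ ^ 2 - R ^ 2 := by nlinarith
  set m := Real.sqrt (τ ^ 2 - R ^ 2) with hm
  have hm0 : 0 < m := Real.sqrt_pos.2 hm2
  have hms : m ^ 2 = τ ^ 2 - R ^ 2 := Real.sq_sqrt hm2.le
  set k := w + ((m / τ - 1) * X) • e with hk
  have hek : inner ℝ e k = m / τ * X := by
    rw [hk, inner_add_right, inner_smul_right, real_inner_self_eq_norm_sq, he]
    ring
  have h2RX : 2 * R * X = τ * (P - Q) := by
    rw [hτ]; nlinarith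
  have hkn : 4 * (σ ^ 2 + ‖k‖ ^ 2) = m ^ 2 := by
    have h1 : ‖k‖ ^ 2 = ‖w‖ ^ 2 - (P - Q) ^ 2 / 4 := by
      rw [hk, norm_add_sq_real, norm_smul, inner_smul_right, he, real_inner_comm,
        Real.norm_eq_abs, mul_one, sq_abs, ← hX]
      have h5 : (P - Q) ^ 2 = 4 * R ^ 2 * X ^ 2 / τ ^ 2 := by
        rw [eq_div_iff (by positivity)]; linear_combination -(2 * R * X + τ * (P - Q)) * h2RX
      have h6 : (m / τ) ^ 2 = 1 - R ^ 2 / τ ^ 2 := by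
        rw [div_pow, hms]; field_simp
      rw [h5]
      clear_value τ
      linear_combination X ^ 2 * h6
    rw [h1, hms, hτ]
    linear_combination -2 * hPs - 2 * hQs
  have hc : boostFactor σ R k = τ / m := by
    rw [boostFactor, hkn, Real.sqrt_eq_iff_eq_sq (by positivity) (by positivity), div_pow]
    field_simp
    linarith
  refine ⟨k, ?_⟩
  rw [boostMap, hek, hc, hk, add_assoc, ← add_smul]
  convert add_zero w using 2
  have : (m / τ - 1) * X + (τ / m - 1) * (m / τ * X) = 0 := by
    field_simp; ring
  rw [this, zero_smul]

/-- The derivative of `k ↦ (boostFactor σ R k - 1) * ⟪e, k⟫`. -/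
noncomputable def boostFunctional (σ R : ℝ) (e k : V) : V →L[ℝ] ℝ :=
  (boostFactor σ R k - 1) • innerSL ℝ e +
    (inner ℝ e k * (-(R ^ 2 / (4 * boostFactor σ R k * energy σ k ^ 4)))) • innerSL ℝ k

theorem hasFDerivAt_boostMap {σ : ℝ} (hσ : 0 < σ) (R : ℝ) (e k : V) :
    HasFDerivAt (boostMap σ R e)
      (ContinuousLinearMap.id ℝ V + (boostFunctional σ R e k).smulRight e) k := by
  have hE := energy_pos hσ k
  have hc := boostFactor_pos σ R k
  have hpos : 0 < σ ^ 2 + ‖k‖ ^ 2 := by positivity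
  have h1 : HasFDerivAt (fun k : V => 4 * (σ ^ 2 + ‖k‖ ^ 2)) ((4 : ℝ) • ((2 : ℕ) • innerSL ℝ k)) k := by
    have := ((hasStrictFDerivAt_norm_sq k).hasFDerivAt.const_add (σ ^ 2)).const_mul 4
    simpa using this
  have h2 : HasDerivAt (fun y : ℝ => Real.sqrt (1 + R ^ 2 / y))
      (-(R ^ 2 / (4 * (σ ^ 2 + ‖k‖ ^ 2)) ^ 2) / (2 * boostFactor σ R k))
      (4 * (σ ^ 2 + ‖k‖ ^ 2)) := by
    refine HasDerivAt.sqrt ?_ (by positivity)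
    refine HasDerivAt.const_add 1 ?_
    have := (hasDerivAt_inv (by positivity : (4 * (σ ^ 2 + ‖k‖ ^ 2)) ≠ 0)).const_mul (R ^ 2)
    convert! this using 1
    ring
  have h3 := HasDerivAt.comp_hasFDerivAt (h₂ := fun y : ℝ => Real.sqrt (1 + R ^ 2 / y)) k h2 h1
  have h4 : HasFDerivAt (fun k : V => inner ℝ e k) (innerSL ℝ e) k := (innerSL ℝ e).hasFDerivAt
  have h5 := ((h3.sub_const 1).mul h4).smul_const e
  refine ((hasFDerivAt_id k).add h5).congr_fderiv ?_
  ext v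
  simp only [boostFunctional, _root_.add_apply, ContinuousLinearMap.smulRight_apply,
    _root_.smul_apply, smul_eq_mul, innerSL_apply_apply, ContinuousLinearMap.id_apply]
  congr 2
  have h6 : energy σ k ^ 4 = (σ ^ 2 + ‖k‖ ^ 2) ^ 2 := by rw [← energy_sq]; ring
  have h7 : ((fun y : ℝ => Real.sqrt (1 + R ^ 2 / y)) ∘ fun k : V => 4 * (σ ^ 2 + ‖k‖ ^ 2)) k =
      boostFactor σ R k := rfl
  rw [h6, h7]
  field_simp
  ring

theorem det_id_add_smulRight [FiniteDimensional ℝ V] (ℓ : V →L[ℝ] ℝ) (e : V) :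
    (ContinuousLinearMap.id ℝ V + ℓ.smulRight e).det = 1 + ℓ e := by
  exact LinearMap.transvection.det (ℓ : V →ₗ[ℝ] ℝ) e

/-- The derivative is the identity plus a rank one map, so its determinant is explicit. In measure
form the identity reads dw / (E₁E₂) = dk / (E²γ), where E₁ and E₂ are the energies of the boosted
pair. Since R rather than the velocity is held fixed, γ varies with k and contributes to the
Jacobian. -/
theorem det_boostMap {σ : ℝ} (hσ : 0 < σ) {e : V} (he : ‖e‖ = 1) (R : ℝ) (k : V) :
    energy σ k ^ 2 * boostFactor σ R k * (1 + boostFunctional σ R e k e) =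
      energy σ (boostMap σ R e k + (R / 2) • e) * energy σ ((R / 2) • e - boostMap σ R e k) := by
  rw [energy_boostMap_add hσ he, energy_sub_boostMap hσ he, boostFunctional]
  have hE := (energy_pos hσ k).ne'
  have hc := (boostFactor_pos σ R k).ne'
  simp only [_root_.add_apply, _root_.smul_apply, smul_eq_mul,
    innerSL_apply_apply, real_inner_self_eq_norm_sq, he, real_inner_comm e k]
  field_simp
  ring

variable [FiniteDimensional ℝ V] [MeasurableSpace V] [BorelSpace V]

theorem lintegral_comp_boostMap {σ : ℝ} (hσ : 0 < σ) {e : V} (he : ‖e‖ = 1) {R : ℝ} (hR : 0 ≤ R)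
    (h : ℝ → ℝ≥0∞) :
    ∫⁻ w : V, h (energy σ (w + (R / 2) • e) + energy σ ((R / 2) • e - w)) *
        ENNReal.ofReal (1 / (energy σ (w + (R / 2) • e) * energy σ ((R / 2) • e - w))) =
      ∫⁻ k : V, h (2 * (energy σ k * boostFactor σ R k)) *
        ENNReal.ofReal (1 / (energy σ k ^ 2 * boostFactor σ R k)) := by
  have key := lintegral_image_eq_lintegral_abs_det_fderiv_mul (volume : Measure V)
    MeasurableSet.univ
    (fun k _ => (hasFDerivAt_boostMap hσ R e k).hasFDerivWithinAt)
    (boostMap_injective hσ he R).injOn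
    (fun w => h (energy σ (w + (R / 2) • e) + energy σ ((R / 2) • e - w)) *
        ENNReal.ofReal (1 / (energy σ (w + (R / 2) • e) * energy σ ((R / 2) • e - w))))
  rw [Set.image_univ, (boostMap_surjective hσ he hR).range_eq, setLIntegral_univ,
    setLIntegral_univ] at key
  rw [key]
  refine lintegral_congr fun k => ?_
  rw [det_id_add_smulRight, mul_left_comm, ← ENNReal.ofReal_mul (abs_nonneg _)]
  have hE := energy_pos hσ k
  have hc := boostFactor_pos σ R k
  have hp := energy_pos hσ (boostMap σ R e k + (R / 2) • e)
  have hq := energy_pos hσ ((R / 2) • e - boostMap σ R e k)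
  have hdet := det_boostMap hσ he R k
  have hd : 0 < 1 + boostFunctional σ R e k e := by
    refine pos_of_mul_pos_right (b := 1 + boostFunctional σ R e k e) (hdet ▸ mul_pos hp hq)
      (by positivity)
  rw [abs_of_pos hd]
  congr 2
  · rw [energy_boostMap_add hσ he, energy_sub_boostMap hσ he]; ring
  · rw [← hdet]
    field_simp

end Boost

/-! ### Polar coordinates for nonnegative radial functions -/

section Polar

variable {V : Type*} [NormedAddCommGroup V] [NormedSpace ℝ V] [FiniteDimensional ℝ V]
  [Nontrivial V] [MeasurableSpace V] [BorelSpace V]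

theorem lintegral_fun_norm_addHaar (μ : Measure V) [μ.IsAddHaarMeasure] {f : ℝ → ℝ≥0∞}
    (hf : Measurable f) :
    ∫⁻ x, f ‖x‖ ∂μ = μ.toSphere Set.univ *
      ∫⁻ r in Set.Ioi (0 : ℝ), ENNReal.ofReal (r ^ (Module.finrank ℝ V - 1)) * f r := by
  have h1 : ∫⁻ x, f ‖x‖ ∂μ = ∫⁻ x : ({(0)}ᶜ : Set V), f ‖x.1‖ ∂(μ.comap (↑)) := by
    rw [lintegral_subtype_comap (measurableSet_singleton _).compl fun x => f ‖x‖,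
      restrict_compl_singleton]
  have h2 : ∫⁻ x : ({(0)}ᶜ : Set V), f ‖x.1‖ ∂(μ.comap (↑)) =
      ∫⁻ x, f x.2.1 ∂μ.toSphere.prod (.volumeIoiPow (Module.finrank ℝ V - 1)) := by
    have := μ.measurePreserving_homeomorphUnitSphereProd.lintegral_comp_emb
      (Homeomorph.measurableEmbedding _) (fun x => f x.2.1)
    simpa using this
  have hf' : Measurable fun r : Set.Ioi (0 : ℝ) => f r.1 := hf.comp measurable_subtype_coe
  have hm : AEMeasurable (fun x : Metric.sphere (0 : V) 1 × Set.Ioi (0 : ℝ) => f x.2.1)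
      (μ.toSphere.prod (.volumeIoiPow (Module.finrank ℝ V - 1))) :=
    (hf'.comp measurable_snd).aemeasurable
  rw [h1, h2, lintegral_prod _ hm]
  simp only
  rw [lintegral_const, mul_comm]
  congr 1
  rw [Measure.volumeIoiPow, lintegral_withDensity_eq_lintegral_mul _ (by fun_prop) hf']
  exact lintegral_subtype_comap measurableSet_Ioi
    fun r : ℝ => ENNReal.ofReal (r ^ (Module.finrank ℝ V - 1)) * f r

end Polar

/-! ### Two-body phase space -/

/-- The area of the unit sphere of `ℝ^d`. -/
noncomputable def sphereArea (d : ℕ) : ℝ := (volume : Measure (Space d)).toSphere.real Set.univ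

/-- The square of the invariant mass of a space-time momentum. -/
noncomputable def massSq {d : ℕ} (z : SpaceTime d) : ℝ := z.fst ^ 2 - ‖z.snd‖ ^ 2

/-- The two-body phase space density: the density of the image of `dξ dη / (E(ξ) E(η))` under
`(ξ, η) ↦ (E(ξ) + E(η), ξ + η)`. -/
noncomputable def phaseDensity {d : ℕ} (σ : ℝ) (z : SpaceTime d) : ℝ :=
  open Classical in
  if 0 < z.fst ∧ 4 * σ ^ 2 < massSq z then
    sphereArea d * (Real.sqrt (massSq z - 4 * σ ^ 2) / 2) ^ (d - 2) / Real.sqrt (massSq z)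
  else 0

/-- The space-time momentum of a pair of particles of mass `σ`. -/
noncomputable def pairMap {d : ℕ} (σ : ℝ) (p : Space d × Space d) : SpaceTime d :=
  WithLp.toLp 2 (energy σ p.1 + energy σ p.2, p.1 + p.2)

/-- The Lorentz invariant measure `dξ dη / (E(ξ) E(η))` on pairs of momenta. -/
noncomputable def pairMeasure (d : ℕ) (σ : ℝ) : Measure (Space d × Space d) :=
  volume.withDensity fun p => ENNReal.ofReal (1 / (energy σ p.1 * energy σ p.2))

/-- Lebesgue measure on space-time weighted by the two-body phase space density. -/
noncomputable def phaseMeasure (d : ℕ) (σ : ℝ) : Measure (SpaceTime d) :=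
  volume.withDensity fun z => ENNReal.ofReal (phaseDensity σ z)

theorem sphereArea_pos {d : ℕ} (hd : 2 ≤ d) : 0 < sphereArea d := by
  have : Nontrivial (Space d) := by
    have : Nonempty (Fin d) := ⟨⟨0, by omega⟩⟩
    infer_instance
  exact ENNReal.toReal_pos (by
    rw [Ne, Measure.measure_univ_eq_zero]; exact Measure.toSphere_ne_zero _) (measure_ne_top _ _)

theorem continuous_massSq (d : ℕ) : Continuous (massSq : SpaceTime d → ℝ) := by
  unfold massSq
  fun_prop

theorem measurable_massSq (d : ℕ) : Measurable (massSq : SpaceTime d → ℝ) :=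
  (continuous_massSq d).measurable

theorem continuous_pairMap {d : ℕ} (σ : ℝ) : Continuous (pairMap (d := d) σ) := by
  unfold pairMap
  refine (WithLp.prod_continuous_toLp 2 _ _).comp ?_
  have := continuous_energy (V := Space d) σ
  fun_prop

theorem measurableSet_massShell (d : ℕ) (σ : ℝ) :
    MeasurableSet {z : SpaceTime d | 0 < z.fst ∧ 4 * σ ^ 2 < massSq z} := by
  have h1 : IsOpen {z : SpaceTime d | 0 < z.fst} := isOpen_lt continuous_const (by fun_prop)
  exact (h1.inter (isOpen_lt continuous_const (continuous_massSq d))).measurableSet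

theorem measurable_phaseDensity (d : ℕ) (σ : ℝ) :
    Measurable (phaseDensity σ : SpaceTime d → ℝ) := by
  unfold phaseDensity
  refine Measurable.ite (measurableSet_massShell d σ) ?_ measurable_const
  have := measurable_massSq d
  fun_prop

theorem phaseDensity_nonneg {d : ℕ} (σ : ℝ) (z : SpaceTime d) : 0 ≤ phaseDensity σ z := by
  unfold phaseDensity
  split_ifs
  · have : 0 ≤ sphereArea d := measureReal_nonneg
    positivity
  · rfl

/-- Here r is the length of the momentum in the centre of mass frame: the squared mass is 4(σ² +
r²), and the total energy at total momentum ζ is the square root in the statement. -/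
theorem phaseDensity_radial {d : ℕ} {σ : ℝ} (hσ : 0 < σ) {r : ℝ} (hr : 0 < r) (ζ : Space d) :
    phaseDensity σ (WithLp.toLp 2 (Real.sqrt (4 * (σ ^ 2 + r ^ 2) + ‖ζ‖ ^ 2), ζ)) =
      sphereArea d * r ^ (d - 2) / (2 * Real.sqrt (σ ^ 2 + r ^ 2)) := by
  have hM : massSq (WithLp.toLp 2 (Real.sqrt (4 * (σ ^ 2 + r ^ 2) + ‖ζ‖ ^ 2), ζ)) =
      4 * (σ ^ 2 + r ^ 2) := by
    change Real.sqrt (4 * (σ ^ 2 + r ^ 2) + ‖ζ‖ ^ 2) ^ 2 - ‖ζ‖ ^ 2 = _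
    rw [Real.sq_sqrt (by positivity)]; ring
  have h1 : Real.sqrt (4 * (σ ^ 2 + r ^ 2) - 4 * σ ^ 2) = 2 * r := by
    rw [Real.sqrt_eq_iff_eq_sq (by nlinarith) (by positivity)]; ring
  have h2 : Real.sqrt (4 * (σ ^ 2 + r ^ 2)) = 2 * Real.sqrt (σ ^ 2 + r ^ 2) := by
    rw [Real.sqrt_eq_iff_eq_sq (by positivity) (by positivity), mul_pow,
      Real.sq_sqrt (by positivity)]; ring
  have h0 : 0 < Real.sqrt (4 * (σ ^ 2 + r ^ 2) + ‖ζ‖ ^ 2) := Real.sqrt_pos.2 (by positivity)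
  rw [phaseDensity, if_pos ⟨h0, by rw [hM]; nlinarith⟩, hM, h1, h2, mul_div_cancel_left₀ _ two_ne_zero]

/-- Substitution of the total energy τ by the radius r in the centre of mass frame, with dτ = (4r/τ)
dr. The density vanishes outside the range of this substitution. -/
theorem lintegral_phaseDensity_fiber {d : ℕ} {σ : ℝ} (hσ : 0 < σ)
    (ζ : Space d) (h : ℝ → ℝ≥0∞) :
    ∫⁻ τ : ℝ, h τ * ENNReal.ofReal (phaseDensity σ (WithLp.toLp 2 (τ, ζ))) =
      ∫⁻ r in Set.Ioi (0 : ℝ), ENNReal.ofReal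
        (4 * r / Real.sqrt (4 * (σ ^ 2 + r ^ 2) + ‖ζ‖ ^ 2)) *
        (h (Real.sqrt (4 * (σ ^ 2 + r ^ 2) + ‖ζ‖ ^ 2)) *
          ENNReal.ofReal (sphereArea d * r ^ (d - 2) / (2 * Real.sqrt (σ ^ 2 + r ^ 2)))) := by
  have hder : ∀ r : ℝ, HasDerivAt (fun r : ℝ => Real.sqrt (4 * (σ ^ 2 + r ^ 2) + ‖ζ‖ ^ 2))
      (4 * r / Real.sqrt (4 * (σ ^ 2 + r ^ 2) + ‖ζ‖ ^ 2)) r := by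
    intro r
    have h1 : HasDerivAt (fun r : ℝ => 4 * (σ ^ 2 + r ^ 2) + ‖ζ‖ ^ 2) (4 * (2 * r)) r := by
      have := (((hasDerivAt_pow 2 r).const_add (σ ^ 2)).const_mul 4).add_const (‖ζ‖ ^ 2)
      simpa using this
    convert! h1.sqrt (by positivity) using 1
    ring
  have himg : (fun r : ℝ => Real.sqrt (4 * (σ ^ 2 + r ^ 2) + ‖ζ‖ ^ 2)) '' Set.Ioi 0 =
      Set.Ioi (Real.sqrt (4 * σ ^ 2 + ‖ζ‖ ^ 2)) := by
    ext τ
    constructor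
    · rintro ⟨r, hr, rfl⟩
      have hr' : 0 < r := hr
      exact Real.sqrt_lt_sqrt (by positivity) (by nlinarith)
    · intro hτ
      have hτ0 : 0 < τ := (Real.sqrt_nonneg _).trans_lt hτ
      have h2 := (Real.sqrt_lt' hτ0).1 hτ
      refine ⟨Real.sqrt ((τ ^ 2 - ‖ζ‖ ^ 2) / 4 - σ ^ 2), Real.sqrt_pos.2 (by linarith), ?_⟩
      change Real.sqrt _ = τ
      rw [Real.sq_sqrt (by linarith), Real.sqrt_eq_iff_eq_sq (by nlinarith [sq_nonneg τ]) hτ0.le]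
      ring
  have hinj : Set.InjOn (fun r : ℝ => Real.sqrt (4 * (σ ^ 2 + r ^ 2) + ‖ζ‖ ^ 2)) (Set.Ioi 0) := by
    intro r hr r' hr' he
    have hr0 : 0 < r := hr
    have hr0' : 0 < r' := hr'
    have : Real.sqrt (4 * (σ ^ 2 + r ^ 2) + ‖ζ‖ ^ 2) ^ 2 =
        Real.sqrt (4 * (σ ^ 2 + r' ^ 2) + ‖ζ‖ ^ 2) ^ 2 := congrArg (· ^ 2) he
    rw [Real.sq_sqrt (by positivity), Real.sq_sqrt (by positivity)] at this
    exact (pow_left_inj₀ hr0.le hr0'.le two_ne_zero).1 (by linarith)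
  have key := lintegral_image_eq_lintegral_abs_deriv_mul measurableSet_Ioi
    (fun r _ => (hder r).hasDerivWithinAt) hinj
    (fun τ => h τ * ENNReal.ofReal (phaseDensity σ (WithLp.toLp 2 (τ, ζ))))
  rw [himg] at key
  rw [← lintegral_indicator measurableSet_Ioi] at key
  have hind : (fun τ => h τ * ENNReal.ofReal (phaseDensity σ (WithLp.toLp 2 (τ, ζ)))) =
      (Set.Ioi (Real.sqrt (4 * σ ^ 2 + ‖ζ‖ ^ 2))).indicator
        (fun τ => h τ * ENNReal.ofReal (phaseDensity σ (WithLp.toLp 2 (τ, ζ)))) := by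
    ext τ
    by_cases hτ : τ ∈ Set.Ioi (Real.sqrt (4 * σ ^ 2 + ‖ζ‖ ^ 2))
    · rw [Set.indicator_of_mem hτ]
    · rw [Set.indicator_of_notMem hτ, phaseDensity, if_neg, ENNReal.ofReal_zero, mul_zero]
      rintro ⟨h1, h2⟩
      have h1' : 0 < τ := h1
      have h2' : 4 * σ ^ 2 < τ ^ 2 - ‖ζ‖ ^ 2 := h2
      exact hτ ((Real.sqrt_lt' h1').2 (by linarith))
  rw [hind, key]
  refine setLIntegral_congr_fun measurableSet_Ioi fun r hr => ?_
  have hr0 : 0 < r := hr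
  rw [phaseDensity_radial hσ hr0, abs_of_nonneg (by positivity)]

theorem lintegral_pair_fiber {d : ℕ} (hd : 2 ≤ d) {σ : ℝ} (hσ : 0 < σ) (ζ : Space d) {h : ℝ → ℝ≥0∞}
    (hh : Measurable h) :
    ∫⁻ ξ : Space d, h (energy σ ξ + energy σ (ζ - ξ)) *
        ENNReal.ofReal (1 / (energy σ ξ * energy σ (ζ - ξ))) =
      ∫⁻ τ : ℝ, h τ * ENNReal.ofReal (phaseDensity σ (WithLp.toLp 2 (τ, ζ))) := by
  have : Nontrivial (Space d) := by
    have : Nonempty (Fin d) := ⟨⟨0, by omega⟩⟩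
    infer_instance
  obtain ⟨e, he, hζ⟩ : ∃ e : Space d, ‖e‖ = 1 ∧ ζ = ‖ζ‖ • e := by
    by_cases h0 : ζ = 0
    · obtain ⟨e, he⟩ := exists_norm_eq (Space d) zero_le_one
      exact ⟨e, he, by simp [h0]⟩
    · exact ⟨‖ζ‖⁻¹ • ζ, norm_smul_inv_norm h0, by
        rw [smul_smul, mul_inv_cancel₀ (norm_ne_zero_iff.2 h0), one_smul]⟩
  set R := ‖ζ‖ with hR
  have h1 : ∀ w : Space d, ζ - (w + (R / 2) • e) = (R / 2) • e - w := by
    intro w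
    rw [hζ]; module
  -- Centring at half the total momentum writes the pair as (R/2)e ± w, the form to which the boost
  -- applies.
  rw [← lintegral_add_right_eq_self _ ((R / 2) • e)]
  simp only [h1]
  rw [lintegral_comp_boostMap hσ he (norm_nonneg ζ) h, lintegral_phaseDensity_fiber hσ]
  have h2 : ∀ k : Space d, h (2 * (energy σ k * boostFactor σ ‖ζ‖ k)) *
        ENNReal.ofReal (1 / (energy σ k ^ 2 * boostFactor σ ‖ζ‖ k)) =
      (fun r : ℝ => h (Real.sqrt (4 * (σ ^ 2 + r ^ 2) + ‖ζ‖ ^ 2)) *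
        ENNReal.ofReal (2 / (Real.sqrt (σ ^ 2 + r ^ 2) *
          Real.sqrt (4 * (σ ^ 2 + r ^ 2) + ‖ζ‖ ^ 2)))) ‖k‖ := by
    intro k
    have hE := energy_pos hσ k
    have hc := boostFactor_pos σ ‖ζ‖ k
    have h3 : Real.sqrt (4 * (σ ^ 2 + ‖k‖ ^ 2) + ‖ζ‖ ^ 2) = 2 * (energy σ k * boostFactor σ ‖ζ‖ k) := by
      rw [Real.sqrt_eq_iff_eq_sq (by positivity) (by positivity), mul_pow,
        energy_mul_boostFactor_sq hσ, energy_sq]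
      ring
    have h4 : Real.sqrt (σ ^ 2 + ‖k‖ ^ 2) = energy σ k := rfl
    simp only [h3, h4]
    congr 2
    field_simp
  simp only [h2]
  rw [lintegral_fun_norm_addHaar (volume : Measure (Space d)) (f := fun r : ℝ =>
      h (Real.sqrt (4 * (σ ^ 2 + r ^ 2) + ‖ζ‖ ^ 2)) *
        ENNReal.ofReal (2 / (Real.sqrt (σ ^ 2 + r ^ 2) *
          Real.sqrt (4 * (σ ^ 2 + r ^ 2) + ‖ζ‖ ^ 2)))) (by fun_prop),
    ← lintegral_const_mul _ (by fun_prop)]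
  refine setLIntegral_congr_fun measurableSet_Ioi fun r hr => ?_
  have hr0 : 0 < r := hr
  simp only [finrank_euclideanSpace, Fintype.card_fin]
  have h5 : (volume : Measure (Space d)).toSphere Set.univ = ENNReal.ofReal (sphereArea d) :=
    (ENNReal.ofReal_toReal (measure_ne_top _ _)).symm
  have hA := sphereArea_pos hd
  have h6 : ∀ a b c x : ℝ≥0∞, a * (b * (x * c)) = x * (a * (b * c)) := by intros; ring
  rw [h5, h6, mul_left_comm (ENNReal.ofReal (4 * r / _))]
  congr 1
  rw [← ENNReal.ofReal_mul (by positivity), ← ENNReal.ofReal_mul (by positivity),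
    ← ENNReal.ofReal_mul (by positivity)]
  congr 1
  obtain ⟨n, rfl⟩ : ∃ n, d = n + 2 := ⟨d - 2, by omega⟩
  have ha : 0 < Real.sqrt (σ ^ 2 + r ^ 2) := Real.sqrt_pos.2 (by positivity)
  have hb : 0 < Real.sqrt (4 * (σ ^ 2 + r ^ 2) + ‖ζ‖ ^ 2) := Real.sqrt_pos.2 (by positivity)
  simp only [Nat.add_sub_cancel, show n + 2 - 1 = n + 1 from rfl, pow_succ]
  field_simp
  ring

theorem lintegral_spaceTime {d : ℕ} {H : SpaceTime d → ℝ≥0∞} (hH : Measurable H) :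
    ∫⁻ z, H z = ∫⁻ ζ : Space d, ∫⁻ τ : ℝ, H (WithLp.toLp 2 (τ, ζ)) := by
  have hm : Measurable (fun p : ℝ × Space d => H (WithLp.toLp 2 p)) :=
    hH.comp (WithLp.measurable_toLp 2 _)
  rw [← (WithLp.volume_preserving_toLp (U := ℝ) (V := Space d)).lintegral_comp hH,
    Measure.volume_eq_prod, lintegral_prod_symm _ hm.aemeasurable]

/-- The volume preserving shear (ξ, η) ↦ (ξ, ξ + η) makes the total momentum a coordinate. Tonelli
then reduces the claim to one fibre of fixed total momentum, which is `lintegral_pair_fiber`. -/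
theorem lintegral_pairMap {d : ℕ} (hd : 2 ≤ d) {σ : ℝ} (hσ : 0 < σ) {H : SpaceTime d → ℝ≥0∞}
    (hH : Measurable H) :
    ∫⁻ p : Space d × Space d, H (pairMap σ p) *
        ENNReal.ofReal (1 / (energy σ p.1 * energy σ p.2)) =
      ∫⁻ z, H z * ENNReal.ofReal (phaseDensity σ z) := by
  have hE := measurable_energy (V := Space d) σ
  have hΦ := (continuous_pairMap (d := d) σ).measurable
  have hm1 : Measurable (fun p : Space d × Space d => H (pairMap σ p) *
        ENNReal.ofReal (1 / (energy σ p.1 * energy σ p.2))) := by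
    refine (hH.comp hΦ).mul ?_
    fun_prop
  have hsub : MeasurePreserving (fun p : Space d × Space d => (p.1, p.2 - p.1)) volume volume := by
    have := measurePreserving_prod_neg_add (volume : Measure (Space d)) (volume : Measure (Space d))
    simpa [sub_eq_neg_add, Measure.volume_eq_prod] using this
  have hm2 : Measurable fun z : SpaceTime d => H z * ENNReal.ofReal (phaseDensity σ z) :=
    hH.mul (measurable_phaseDensity d σ).ennreal_ofReal
  have hmt : ∀ ζ : Space d, Measurable fun τ : ℝ => (WithLp.toLp 2 (τ, ζ) : SpaceTime d) := fun ζ =>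
    (WithLp.measurable_toLp 2 _).comp (by fun_prop)
  have hm3 : Measurable fun a : Space d × Space d => H (pairMap σ (a.1, a.2 - a.1)) *
        ENNReal.ofReal (1 / (energy σ (a.1, a.2 - a.1).1 * energy σ (a.1, a.2 - a.1).2)) :=
    hm1.comp hsub.measurable
  rw [← hsub.lintegral_comp hm1, lintegral_spaceTime hm2, Measure.volume_eq_prod,
    lintegral_prod_symm _ hm3.aemeasurable]
  refine lintegral_congr fun ζ => ?_
  rw [← lintegral_pair_fiber hd hσ ζ (h := fun τ => H (WithLp.toLp 2 (τ, ζ))) (hH.comp (hmt ζ))]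
  refine lintegral_congr fun ξ => ?_
  simp [pairMap]

theorem measurePreserving_pairMap {d : ℕ} (hd : 2 ≤ d) {σ : ℝ} (hσ : 0 < σ) :
    MeasurePreserving (pairMap σ) (pairMeasure d σ) (phaseMeasure d σ) := by
  have hΦ := (continuous_pairMap (d := d) σ).measurable
  have hE := measurable_energy (V := Space d) σ
  have hw : Measurable fun p : Space d × Space d =>
      ENNReal.ofReal (1 / (energy σ p.1 * energy σ p.2)) := by fun_prop
  refine ⟨hΦ, Measure.ext_of_lintegral _ fun H hH => ?_⟩
  rw [lintegral_map hH hΦ, pairMeasure, phaseMeasure,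
    lintegral_withDensity_eq_lintegral_mul _ hw (g := fun p => H (pairMap σ p)) (hH.comp hΦ),
    lintegral_withDensity_eq_lintegral_mul _ (measurable_phaseDensity d σ).ennreal_ofReal hH]
  simp only [Pi.mul_apply, mul_comm _ (H _)]
  exact lintegral_pairMap hd hσ hH

/-! ### The Fourier transform on L² and quadratic pairings -/

section FourierL2

variable {V : Type*} [NormedAddCommGroup V] [InnerProductSpace ℝ V] [FiniteDimensional ℝ V]
  [MeasurableSpace V] [BorelSpace V]

theorem integral_smul_fourierInv_eq {U : V → ℂ} (hU : Integrable U) (ψ : 𝓢(V, ℂ)) :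
    ∫ x, ψ x • 𝓕⁻ U x = ∫ ξ, (𝓕⁻ ψ) ξ • U ξ := by
  have := VectorFourier.integral_fourierIntegral_smul_eq_flip (μ := (volume : Measure V))
    (ν := (volume : Measure V)) (L := -innerₗ V) (f := fun x => ψ x) (g := U)
    Real.continuous_fourierChar (by
      simp only [LinearMap.neg_apply, innerₗ_apply_apply]; fun_prop) ψ.integrable hU
  have hflip : (-innerₗ V).flip = -innerₗ V := by
    ext v w; simp [real_inner_comm]
  rw [hflip] at this
  rw [fourierInv_coe]
  exact this.symm

/-- The L² transform is compatible with that of tempered distributions, and the integral transform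
satisfies the same duality formula. Both sides therefore agree against every test function. -/
theorem coeFn_fourierInv_toLp {U : V → ℂ} (h1 : Integrable U) (h2 : MemLp U 2) :
    ((𝓕⁻ (h2.toLp U) : Lp ℂ 2 (volume : Measure V)) : V → ℂ) =ᵐ[volume] 𝓕⁻ U := by
  have hb : LocallyIntegrable (𝓕⁻ U) (volume : Measure V) := by
    have := (Real.Lp.fourierTransformInv ((memLp_one_iff_integrable.2 h1).toLp U)).continuous
    rw [Real.Lp.fourierTransformInv_toLp] at this
    exact this.locallyIntegrable
  refine ae_eq_of_integral_contDiff_smul_eq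
    ((Lp.memLp _).locallyIntegrable (by norm_num)) hb ?_
  intro g g_smooth g_cpt
  have hg₁ : HasCompactSupport (Complex.ofRealCLM ∘ g) := g_cpt.comp_left rfl
  have hg₂ : ContDiff ℝ (⊤ : ℕ∞) (Complex.ofRealCLM ∘ g) := by fun_prop
  set ψ := hg₁.toSchwartzMap hg₂ with hψ
  have hψg : ∀ x (c : ℂ), g x • c = ψ x • c := by
    intro x c
    simp [hψ]
  simp only [hψg]
  rw [integral_smul_fourierInv_eq h1, ← Lp.toTemperedDistribution_apply,
    ← Lp.fourierInv_toTemperedDistribution_eq, TemperedDistribution.fourierInv_apply,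
    Lp.toTemperedDistribution_apply]
  refine integral_congr_ae ?_
  filter_upwards [h2.coeFn_toLp] with x hx
  rw [hx]

/-- The bounded quadratic form `u ↦ ∫ u² Θ` on `L²`. -/
theorem tendsto_integral_sq_mul {ι : Type*} {l : Filter ι} {u : ι → Lp ℂ 2 (volume : Measure V)}
    {v : Lp ℂ 2 (volume : Measure V)} (hu : Tendsto u l (𝓝 v)) {Θ : V → ℂ} (hΘ : MemLp Θ ∞) :
    Tendsto (fun i => ∫ x, (u i) x ^ 2 * Θ x) l (𝓝 (∫ x, v x ^ 2 * Θ x)) := by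
  let B := ContinuousLinearMap.mul ℂ ℂ
  let T : Lp ℂ 2 (volume : Measure V) →L[ℂ] Lp ℂ 2 (volume : Measure V) :=
    B.holderL volume ∞ 2 2 (hΘ.toLp Θ)
  have hT : ∀ w : Lp ℂ 2 (volume : Measure V),
      ∫ x, w x ^ 2 * Θ x = B.lpPairing volume 2 2 w (T w) := by
    intro w
    rw [ContinuousLinearMap.lpPairing_eq_integral]
    refine integral_congr_ae ?_
    filter_upwards [B.coeFn_holder (r := 2) (hΘ.toLp Θ) w, hΘ.coeFn_toLp] with x h1 h2
    have h3 : T w x = Θ x * w x := by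
      rw [← h2]; exact h1
    simp only [h3, B, ContinuousLinearMap.mul_apply']
    ring
  simp only [hT]
  have hc : Continuous fun w => B.lpPairing volume 2 2 w (T w) := by fun_prop
  exact (hc.tendsto v).comp hu

theorem norm_integral_sq_mul_le (v : Lp ℂ 2 (volume : Measure V)) {Θ : V → ℂ} {C : ℝ}
    (hC : ∀ x, ‖Θ x‖ ≤ C) : ‖∫ x, v x ^ 2 * Θ x‖ ≤ C * ‖v‖ ^ 2 := by
  have hv : Integrable (fun x => ‖v x‖ ^ 2) :=
    (memLp_two_iff_integrable_sq_norm (Lp.aestronglyMeasurable v)).1 (Lp.memLp v)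
  have h2 : ∫ x, ‖v x‖ ^ 2 = ‖v‖ ^ 2 := by
    have := L2.inner_def (𝕜 := ℂ) v v
    simp only [inner_self_eq_norm_sq_to_K] at this
    rw [← Complex.ofReal_inj, ← integral_complex_ofReal]
    simpa using this.symm
  rw [← h2, ← integral_const_mul]
  refine norm_integral_le_of_norm_le (hv.const_mul C) (Eventually.of_forall fun x => ?_)
  rw [norm_mul, norm_pow, mul_comm]
  exact mul_le_mul_of_nonneg_right (hC x) (by positivity)

/-- These truncations make the Fourier transform integrable, so that pointwise formulas for the
solution become available before passing to the limit. -/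
theorem tendsto_toLp_indicator_ball (F : Lp ℂ 2 (volume : Measure V)) :
    Tendsto (fun n : ℕ => ((Lp.memLp F).indicator
      (measurableSet_ball (x := (0 : V)) (ε := n))).toLp _) atTop (𝓝 F) := by
  rw [Lp.tendsto_Lp_iff_tendsto_eLpNorm']
  have h0 : ∫⁻ x, ‖F x‖ₑ ^ 2 ≠ ∞ := by
    have := (Lp.memLp F).2
    rw [eLpNorm_lt_top_iff_lintegral_rpow_enorm_lt_top two_ne_zero ENNReal.ofNat_ne_top] at this
    simpa using this.ne
  have h1 : Tendsto (fun n : ℕ => ∫⁻ x, ((Metric.ball (0 : V) n)ᶜ).indicator (fun x => ‖F x‖ₑ ^ 2) x)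
      atTop (𝓝 (∫⁻ _ : V, 0)) := by
    refine tendsto_lintegral_of_dominated_convergence' (fun x => ‖F x‖ₑ ^ 2) (fun n => ?_)
      (fun n => Eventually.of_forall fun x => Set.indicator_le_self _ _ x) h0
      (Eventually.of_forall fun x => ?_)
    · exact ((Lp.aestronglyMeasurable F).enorm.pow_const 2).indicator measurableSet_ball.compl
    · obtain ⟨N, hN⟩ := exists_nat_gt ‖x‖
      refine tendsto_const_nhds.congr' ?_
      filter_upwards [eventually_ge_atTop N] with n hn
      rw [Set.indicator_of_notMem]
      simp only [Set.mem_compl_iff, not_not, Metric.mem_ball, dist_zero_right]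
      exact hN.trans_le (by exact_mod_cast hn)
  rw [lintegral_zero] at h1
  have h2 := (ENNReal.continuous_rpow_const (y := 1 / 2)).tendsto 0 |>.comp h1
  simp only [Function.comp_def] at h2
  rw [ENNReal.zero_rpow_of_pos (by norm_num)] at h2
  refine h2.congr fun n => ?_
  rw [eLpNorm_eq_lintegral_rpow_enorm_toReal two_ne_zero ENNReal.ofNat_ne_top]
  simp only [ENNReal.toReal_ofNat]
  congr 1
  refine lintegral_congr_ae ?_
  filter_upwards [((Lp.memLp F).indicator (measurableSet_ball (x := (0 : V)) (ε := n))).coeFn_toLp]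
    with x hx
  rw [Pi.sub_apply, hx]
  by_cases hxm : x ∈ Metric.ball (0 : V) n
  · rw [Set.indicator_of_notMem (by simpa using hxm), Set.indicator_of_mem hxm]; simp
  · rw [Set.indicator_of_mem (by simpa using hxm), Set.indicator_of_notMem hxm]; simp

end FourierL2

/-! ### Decay of Schwartz functions -/

section SchwartzDecay

variable {V : Type*} [NormedAddCommGroup V] [NormedSpace ℝ V]

theorem exists_schwartz_decay (ψ : 𝓢(V, ℂ)) (k : ℕ) :
    ∃ C, 0 < C ∧ ∀ x, ‖ψ x‖ ≤ C * ((1 + ‖x‖) ^ k)⁻¹ := by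
  refine ⟨2 ^ k * (Finset.Iic (k, 0)).sup (fun m => SchwartzMap.seminorm ℝ m.1 m.2) ψ + 1,
    by positivity, fun x => ?_⟩
  have := one_add_le_sup_seminorm_apply (𝕜 := ℝ) (m := (k, 0)) le_rfl le_rfl ψ x
  rw [norm_iteratedFDeriv_zero] at this
  rw [← div_eq_mul_inv, le_div_iff₀ (by positivity), mul_comm]
  linarith

end SchwartzDecay

/-! ### The space-time Fourier transform of the squared solution -/

section Pairing

variable {d : ℕ}

theorem phi_eq_energy (s : ℝ) (ξ : Space d) :
    phi s (2 * Real.pi * ‖ξ‖) = 2 * Real.pi * energy (s / (2 * Real.pi)) ξ := by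
  have hpi := Real.pi_pos
  rw [phi, Real.sqrt_eq_iff_eq_sq (by positivity) (by unfold energy; positivity),
    mul_pow, mul_pow _ (energy _ _), energy_sq]
  field_simp

theorem propagatorSymbol_eq (s t : ℝ) (ξ : Space d) :
    propagatorSymbol s t ξ =
      Complex.exp (((2 * Real.pi * (t * energy (s / (2 * Real.pi)) ξ) : ℝ) : ℂ) * Complex.I) := by
  rw [propagatorSymbol, phi_eq_energy, mul_comm]
  congr 3
  ring

/-- The plane wave with space-time frequency `(E(ξ), ξ)`. -/
noncomputable def shellWave (σ : ℝ) (z : SpaceTime d) (ξ : Space d) : ℂ :=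
  Complex.exp (((2 * Real.pi * (z.fst * energy σ ξ + inner ℝ ξ z.snd) : ℝ) : ℂ) * Complex.I)

theorem norm_shellWave (σ : ℝ) (z : SpaceTime d) (ξ : Space d) : ‖shellWave σ z ξ‖ = 1 :=
  Complex.norm_exp_ofReal_mul_I _

theorem continuous_shellWave (σ : ℝ) :
    Continuous fun q : SpaceTime d × Space d => shellWave σ q.1 q.2 := by
  have := continuous_energy (V := Space d) σ
  unfold shellWave
  fun_prop

theorem shellWave_mul (σ : ℝ) (z : SpaceTime d) (p : Space d × Space d) :
    shellWave σ z p.1 * shellWave σ z p.2 =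
      Complex.exp (((2 * Real.pi * inner ℝ z (pairMap σ p) : ℝ) : ℂ) * Complex.I) := by
  rw [shellWave, shellWave, ← Complex.exp_add, ← add_mul, ← Complex.ofReal_add]
  congr 3
  rw [WithLp.prod_inner_apply]
  simp only [pairMap, inner_add_right, real_inner_comm z.snd, RCLike.inner_apply, conj_trivial]
  change _ = 2 * Real.pi * ((energy σ p.1 + energy σ p.2) * z.fst +
    (inner ℝ z.snd p.1 + inner ℝ z.snd p.2))
  ring

theorem coeFn_propagator (s t : ℝ) (f : L2Space d)
    (hF : Integrable (𝓕 f : L2Space d)) :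
    (propagator s t f : Space d → ℂ) =ᵐ[volume] fun x =>
      ∫ ξ, shellWave (s / (2 * Real.pi)) (WithLp.toLp 2 (t, x)) ξ * (𝓕 f : L2Space d) ξ := by
  have h1 : Integrable (fun ξ => propagatorSymbol s t ξ * (𝓕 f : L2Space d) ξ) := by
    refine hF.mono ((continuous_propagatorSymbol s t).aestronglyMeasurable.mul hF.1)
      (Eventually.of_forall fun ξ => ?_)
    rw [norm_mul, norm_propagatorSymbol, one_mul]
  refine (coeFn_fourierInv_toLp h1 (memLp_propagatorSymbol_mul s t (𝓕 f))).trans ?_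
  refine Eventually.of_forall fun x => ?_
  simp only
  rw [Real.fourierInv_eq']
  refine integral_congr_ae (Eventually.of_forall fun ξ => ?_)
  simp only [propagatorSymbol_eq, smul_eq_mul, shellWave]
  rw [← mul_assoc, ← Complex.exp_add]
  congr 2
  change _ = ((2 * Real.pi * (t * energy (s / (2 * Real.pi)) ξ + inner ℝ ξ x) : ℝ) : ℂ) * Complex.I
  push_cast
  ring

/-- The integrand of the space-time Fourier representation of `(e^{itφ_s(D)} f)²` paired with the
Fourier transform of a test function. -/
noncomputable def pairKernel (σ : ℝ) (F : Space d → ℂ) (ψ : 𝓢(SpaceTime d, ℂ))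
    (z : SpaceTime d) (p : Space d × Space d) : ℂ :=
  (shellWave σ z p.1 * F p.1) * (shellWave σ z p.2 * F p.2) * (𝓕 ψ) z

theorem integrable_pairKernel (σ : ℝ) {F : Space d → ℂ} (hF : Integrable F)
    (ψ : 𝓢(SpaceTime d, ℂ)) :
    Integrable (fun q : SpaceTime d × (Space d × Space d) => pairKernel σ F ψ q.1 q.2) := by
  have h1 : Integrable (fun q : SpaceTime d × (Space d × Space d) =>
      (𝓕 ψ) q.1 * (F q.2.1 * F q.2.2)) :=
    (𝓕 ψ).integrable.mul_prod (hF.mul_prod hF)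
  have hw := continuous_shellWave (d := d) σ
  have h2 : Continuous fun q : SpaceTime d × (Space d × Space d) =>
      shellWave σ q.1 q.2.1 * shellWave σ q.1 q.2.2 := by
    have a : Continuous fun q : SpaceTime d × (Space d × Space d) => shellWave σ q.1 q.2.1 :=
      hw.comp (f := fun q : SpaceTime d × (Space d × Space d) => (q.1, q.2.1)) (by fun_prop)
    have b : Continuous fun q : SpaceTime d × (Space d × Space d) => shellWave σ q.1 q.2.2 :=
      hw.comp (f := fun q : SpaceTime d × (Space d × Space d) => (q.1, q.2.2)) (by fun_prop)
    exact a.mul b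
  have h3 : (fun q : SpaceTime d × (Space d × Space d) => pairKernel σ F ψ q.1 q.2) =
      fun q => (shellWave σ q.1 q.2.1 * shellWave σ q.1 q.2.2) *
        ((𝓕 ψ) q.1 * (F q.2.1 * F q.2.2)) := by
    ext q
    simp only [pairKernel]
    ring
  rw [h3]
  refine h1.mono (h2.aestronglyMeasurable.mul h1.1) (Eventually.of_forall fun q => ?_)
  rw [norm_mul, norm_mul (shellWave _ _ _), norm_shellWave, norm_shellWave, one_mul, one_mul]

theorem integral_pairKernel_right (σ : ℝ) (F : Space d → ℂ) (ψ : 𝓢(SpaceTime d, ℂ))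
    (z : SpaceTime d) :
    ∫ p, pairKernel σ F ψ z p = (∫ ξ, shellWave σ z ξ * F ξ) ^ 2 * (𝓕 ψ) z := by
  simp only [pairKernel]
  rw [integral_mul_const, Measure.volume_eq_prod, integral_prod_mul (fun ξ => shellWave σ z ξ * F ξ)
    (fun ξ => shellWave σ z ξ * F ξ), sq]

theorem integral_pairKernel_left (σ : ℝ) (F : Space d → ℂ) (ψ : 𝓢(SpaceTime d, ℂ))
    (p : Space d × Space d) :
    ∫ z, pairKernel σ F ψ z p = F p.1 * F p.2 * ψ (pairMap σ p) := by
  have h1 : ψ (pairMap σ p) = ∫ z, Complex.exp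
      (((2 * Real.pi * inner ℝ z (pairMap σ p) : ℝ) : ℂ) * Complex.I) • (𝓕 ψ) z := by
    rw [← Real.fourierInv_eq', ← fourierInv_coe, fourierInv_fourier_eq]
  rw [h1, ← integral_const_mul]
  refine integral_congr_ae (Eventually.of_forall fun z => ?_)
  simp only [pairKernel, smul_eq_mul, ← shellWave_mul]
  ring

/-- When 𝓕 f is integrable, the square is a double superposition of plane waves of frequency Φ(ξ,
η). Fubini moves the space-time integral inside, and Fourier inversion evaluates it to ψ at that
frequency. -/
theorem integrable_integral_propagator_sq (s : ℝ) (f : L2Space d)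
    (hF : Integrable (𝓕 f : L2Space d)) (ψ : 𝓢(SpaceTime d, ℂ)) :
    Integrable (fun t : ℝ => ∫ x : Space d,
        (propagator s t f) x ^ 2 * (𝓕 ψ) (WithLp.toLp 2 (t, x))) ∧
      ∫ t : ℝ, ∫ x : Space d, (propagator s t f) x ^ 2 * (𝓕 ψ) (WithLp.toLp 2 (t, x)) =
        ∫ p : Space d × Space d, (𝓕 f : L2Space d) p.1 * (𝓕 f : L2Space d) p.2 *
          ψ (pairMap (s / (2 * Real.pi)) p) := by
  set σ := s / (2 * Real.pi)
  set F : Space d → ℂ := ((𝓕 f : L2Space d) : Space d → ℂ)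
  have hK := integrable_pairKernel σ hF ψ
  have hW : Integrable fun z => ∫ p, pairKernel σ F ψ z p := hK.integral_prod_left
  have hmp := WithLp.volume_preserving_toLp (U := ℝ) (V := Space d)
  have hemb : MeasurableEmbedding (WithLp.toLp 2 : ℝ × Space d → SpaceTime d) :=
    (MeasurableEquiv.toLp 2 (ℝ × Space d)).measurableEmbedding
  have hW' : Integrable fun q : ℝ × Space d => ∫ p, pairKernel σ F ψ (WithLp.toLp 2 q) p :=
    (hmp.integrable_comp_emb hemb).2 hW
  have hinner : ∀ t : ℝ, ∫ x : Space d, (propagator s t f) x ^ 2 * (𝓕 ψ) (WithLp.toLp 2 (t, x)) =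
      ∫ x : Space d, ∫ p, pairKernel σ F ψ (WithLp.toLp 2 (t, x)) p := by
    intro t
    refine integral_congr_ae ?_
    filter_upwards [coeFn_propagator s t f hF] with x hx
    rw [hx, integral_pairKernel_right]
  simp only [hinner]
  rw [Measure.volume_eq_prod] at hW'
  refine ⟨hW'.integral_prod_left, ?_⟩
  rw [← integral_prod (fun q : ℝ × Space d => ∫ p, pairKernel σ F ψ (WithLp.toLp 2 q) p) hW',
    ← Measure.volume_eq_prod, hmp.integral_comp hemb (fun z => ∫ p, pairKernel σ F ψ z p),
    integral_integral_swap hK]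
  exact integral_congr_ae (Eventually.of_forall fun p => integral_pairKernel_left σ F ψ p)

theorem norm_snd_le (z : SpaceTime d) : ‖z.snd‖ ≤ ‖z‖ := WithLp.norm_snd_le _ z

theorem norm_fst_le (z : SpaceTime d) : ‖z.fst‖ ≤ ‖z‖ := WithLp.norm_fst_le _ z

/-- The product |F(ξ)F(η)| is at most the mean of the two squares. The test function decays in ξ +
η, so for each square the other variable can be integrated out. -/
theorem integrable_mul_schwartz_pairMap (σ : ℝ) {F : Space d → ℂ} (hF : MemLp F 2)
    (ψ : 𝓢(SpaceTime d, ℂ)) :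
    Integrable fun p : Space d × Space d => F p.1 * F p.2 * ψ (pairMap σ p) := by
  obtain ⟨C, hC, hψ⟩ := exists_schwartz_decay ψ (d + 1)
  have hF2 : Integrable fun ξ => ‖F ξ‖ ^ 2 := (memLp_two_iff_integrable_sq_norm hF.1).1 hF
  have hρ : Integrable fun ξ : Space d => ((1 + ‖ξ‖) ^ (d + 1))⁻¹ := by
    have := integrable_one_add_norm (E := Space d) (μ := volume) (r := ((d + 1 : ℕ) : ℝ))
      (by simp)
    refine this.congr (Eventually.of_forall fun ξ => ?_)
    simp only
    rw [Real.rpow_neg (by positivity), Real.rpow_natCast]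
  have hprod : Integrable fun p : Space d × Space d => ‖F p.1‖ ^ 2 * ((1 + ‖p.2‖) ^ (d + 1))⁻¹ :=
    hF2.mul_prod hρ
  have h1 : Integrable fun p : Space d × Space d =>
      ‖F p.1‖ ^ 2 * ((1 + ‖p.1 + p.2‖) ^ (d + 1))⁻¹ :=
    (measurePreserving_prod_add (volume : Measure (Space d)) (volume : Measure (Space d))
      |>.integrable_comp_of_integrable hprod)
  have h2 : Integrable fun p : Space d × Space d =>
      ‖F p.2‖ ^ 2 * ((1 + ‖p.1 + p.2‖) ^ (d + 1))⁻¹ := by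
    have := h1.swap
    refine this.congr (Eventually.of_forall fun p => ?_)
    simp [add_comm]
  have hm : AEStronglyMeasurable (fun p : Space d × Space d => F p.1 * F p.2 * ψ (pairMap σ p)) := by
    refine (hF.1.comp_fst.mul hF.1.comp_snd).mul ?_
    exact (ψ.continuous.comp (continuous_pairMap σ)).aestronglyMeasurable
  refine ((h1.add h2).const_mul (C / 2)).mono' hm (Eventually.of_forall fun p => ?_)
  have h3 : ‖ψ (pairMap σ p)‖ ≤ C * ((1 + ‖p.1 + p.2‖) ^ (d + 1))⁻¹ := by
    refine (hψ _).trans ?_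
    have : ‖p.1 + p.2‖ ≤ ‖pairMap σ p‖ := norm_snd_le (pairMap σ p)
    gcongr
  rw [norm_mul, norm_mul]
  have h4 : ‖F p.1‖ * ‖F p.2‖ ≤ (‖F p.1‖ ^ 2 + ‖F p.2‖ ^ 2) / 2 := by
    nlinarith [sq_nonneg (‖F p.1‖ - ‖F p.2‖)]
  calc _ ≤ (‖F p.1‖ ^ 2 + ‖F p.2‖ ^ 2) / 2 * (C * ((1 + ‖p.1 + p.2‖) ^ (d + 1))⁻¹) :=
        mul_le_mul h4 h3 (norm_nonneg _) (by positivity)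
    _ = _ := by simp only [Pi.add_apply]; ring

theorem norm_propagator_sub (s t : ℝ) (f g : L2Space d) :
    ‖propagator s t f - propagator s t g‖ = ‖𝓕 f - 𝓕 g‖ := by
  have h : ∀ u v : L2Space d, ‖𝓕⁻ u - 𝓕⁻ v‖ = ‖u - v‖ := by
    intro u v
    exact ((Lp.fourierTransformₗᵢ (Space d) ℂ).symm.map_sub u v ▸
      (Lp.fourierTransformₗᵢ (Space d) ℂ).symm.norm_map (u - v))
  rw [propagator, propagator, h, ← MemLp.toLp_sub, Lp.norm_toLp, Lp.norm_def]
  congr 1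
  refine eLpNorm_congr_norm_ae ?_
  filter_upwards [Lp.coeFn_sub (𝓕 f) (𝓕 g)] with ξ hξ
  rw [hξ, Pi.sub_apply, Pi.sub_apply, ← mul_sub, norm_mul, norm_propagatorSymbol, one_mul]

theorem norm_propagator (s t : ℝ) (f : L2Space d) : ‖propagator s t f‖ = ‖𝓕 f‖ := by
  have h : ∀ u : L2Space d, ‖𝓕⁻ u‖ = ‖u‖ := by
    intro u
    rw [← Lp.norm_fourier_eq (𝓕⁻ u), fourier_fourierInv_eq]
  rw [propagator, h, Lp.norm_toLp, Lp.norm_def]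
  congr 1
  refine eLpNorm_congr_norm_ae (Eventually.of_forall fun ξ => ?_)
  rw [norm_mul, norm_propagatorSymbol, one_mul]

/-- Extends the formula from integrable 𝓕 f to all of L² by truncating frequencies. Both limits are
dominated: on the frequency side by the integrand for F itself, on the physical side by the
conserved L² norm times a bound of order (1 + t²)⁻¹ for the test function, uniform in x. -/
theorem integral_propagator_sq (s : ℝ) (f : L2Space d) (ψ : 𝓢(SpaceTime d, ℂ)) :
    ∫ t : ℝ, ∫ x : Space d, (propagator s t f) x ^ 2 * (𝓕 ψ) (WithLp.toLp 2 (t, x)) =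
      ∫ p : Space d × Space d, (𝓕 f : L2Space d) p.1 * (𝓕 f : L2Space d) p.2 *
        ψ (pairMap (s / (2 * Real.pi)) p) := by
  set σ := s / (2 * Real.pi)
  set F : L2Space d := 𝓕 f with hFdef
  have hmem : ∀ n : ℕ, MemLp ((Metric.ball (0 : Space d) n).indicator F) 2 := fun n =>
    (Lp.memLp F).indicator measurableSet_ball
  let Fn : ℕ → L2Space d := fun n => (hmem n).toLp _
  have hFn : Tendsto Fn atTop (𝓝 F) := tendsto_toLp_indicator_ball F
  let fn : ℕ → L2Space d := fun n => 𝓕⁻ (Fn n)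
  have hfn : ∀ n, 𝓕 (fn n) = Fn n := fun n => fourier_fourierInv_eq _
  have hFnae : ∀ n, (Fn n : Space d → ℂ) =ᵐ[volume] (Metric.ball (0 : Space d) n).indicator F :=
    fun n => (hmem n).coeFn_toLp
  have hFi : ∀ n, Integrable (𝓕 (fn n) : L2Space d) := by
    intro n
    rw [hfn, integrable_congr (hFnae n), integrable_indicator_iff measurableSet_ball]
    have : IsFiniteMeasure ((volume : Measure (Space d)).restrict (Metric.ball (0 : Space d) n)) :=
      ⟨by simpa using measure_ball_lt_top⟩
    exact ((Lp.memLp F).restrict _).integrable (by norm_num)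
  have hstep := fun n => integrable_integral_propagator_sq s (fn n) (hFi n) ψ
  -- the frequency side
  have hR : Tendsto (fun n => ∫ p : Space d × Space d, (𝓕 (fn n) : L2Space d) p.1 *
      (𝓕 (fn n) : L2Space d) p.2 * ψ (pairMap σ p)) atTop
      (𝓝 (∫ p : Space d × Space d, F p.1 * F p.2 * ψ (pairMap σ p))) := by
    have hcongr : ∀ n, ∫ p : Space d × Space d, (𝓕 (fn n) : L2Space d) p.1 *
        (𝓕 (fn n) : L2Space d) p.2 * ψ (pairMap σ p) =
        ∫ p : Space d × Space d, (Metric.ball (0 : Space d) n).indicator F p.1 *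
          (Metric.ball (0 : Space d) n).indicator F p.2 * ψ (pairMap σ p) := by
      intro n
      refine integral_congr_ae ?_
      have h1 := Measure.quasiMeasurePreserving_fst (μ := (volume : Measure (Space d)))
        (ν := (volume : Measure (Space d))) |>.ae_eq_comp (hFnae n)
      have h2 := Measure.quasiMeasurePreserving_snd (μ := (volume : Measure (Space d)))
        (ν := (volume : Measure (Space d))) |>.ae_eq_comp (hFnae n)
      filter_upwards [h1, h2] with p hp1 hp2
      simp only [Function.comp_apply] at hp1 hp2
      rw [hfn, hp1, hp2]
    simp only [hcongr]
    have hint := integrable_mul_schwartz_pairMap σ (Lp.memLp F) ψ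
    refine tendsto_integral_of_dominated_convergence _ (fun n => ?_) hint.norm
      (fun n => Eventually.of_forall fun p => ?_) (Eventually.of_forall fun p => ?_)
    · exact (integrable_mul_schwartz_pairMap σ (hmem n) ψ).1
    · rw [norm_mul, norm_mul, norm_mul, norm_mul]
      gcongr <;> exact norm_indicator_le_norm_self _ _
    · obtain ⟨N, hN⟩ := exists_nat_gt (max ‖p.1‖ ‖p.2‖)
      refine tendsto_const_nhds.congr' ?_
      filter_upwards [eventually_ge_atTop N] with n hn
      have hn' : (N : ℝ) ≤ n := by exact_mod_cast hn
      rw [Set.indicator_of_mem, Set.indicator_of_mem] <;>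
        simp only [Metric.mem_ball, dist_zero_right]
      · exact (le_max_right _ _).trans_lt (hN.trans_le hn')
      · exact (le_max_left _ _).trans_lt (hN.trans_le hn')
  -- the physical side
  obtain ⟨C, hC, hdecay⟩ := exists_schwartz_decay (𝓕 ψ) 2
  have hbt : ∀ (t : ℝ) (x : Space d), ‖(𝓕 ψ) (WithLp.toLp 2 (t, x))‖ ≤ C * (1 + t ^ 2)⁻¹ := by
    intro t x
    refine (hdecay _).trans ?_
    have h1 : ‖t‖ ≤ ‖(WithLp.toLp 2 (t, x) : SpaceTime d)‖ := norm_fst_le (WithLp.toLp 2 (t, x))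
    have h2 : 1 + t ^ 2 ≤ (1 + ‖(WithLp.toLp 2 (t, x) : SpaceTime d)‖) ^ 2 := by
      have : t ^ 2 = ‖t‖ ^ 2 := by rw [Real.norm_eq_abs, sq_abs]
      rw [this]
      nlinarith [norm_nonneg t]
    gcongr
  obtain ⟨M, hM⟩ : ∃ M, ∀ n, ‖Fn n‖ ^ 2 ≤ M := by
    obtain ⟨M, hM⟩ := (hFn.norm.pow 2).bddAbove_range
    exact ⟨M, fun n => hM ⟨n, rfl⟩⟩
  have hL : Tendsto (fun n => ∫ t : ℝ, ∫ x : Space d,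
      (propagator s t (fn n)) x ^ 2 * (𝓕 ψ) (WithLp.toLp 2 (t, x))) atTop
      (𝓝 (∫ t : ℝ, ∫ x : Space d,
        (propagator s t f) x ^ 2 * (𝓕 ψ) (WithLp.toLp 2 (t, x)))) := by
    refine tendsto_integral_of_dominated_convergence (fun t => C * (1 + t ^ 2)⁻¹ * M)
      (fun n => (hstep n).1.1) ?_ (fun n => Eventually.of_forall fun t => ?_)
      (Eventually.of_forall fun t => ?_)
    · exact (integrable_inv_one_add_sq.const_mul C).mul_const M
    · refine (norm_integral_sq_mul_le _ (hbt t)).trans ?_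
      rw [norm_propagator, hfn]
      gcongr
      exact hM n
    · refine tendsto_integral_sq_mul ?_ ?_
      · rw [tendsto_iff_norm_sub_tendsto_zero]
        simp only [norm_propagator_sub, hfn]
        exact tendsto_iff_norm_sub_tendsto_zero.1 hFn
      · refine memLp_top_of_bound ?_ (C * (1 + t ^ 2)⁻¹) (Eventually.of_forall fun x => hbt t x)
        refine Continuous.aestronglyMeasurable ?_
        exact (𝓕 ψ).continuous.comp ((WithLp.prod_continuous_toLp 2 _ _).comp (by fun_prop))
  exact tendsto_nhds_unique hL (by simpa only [(hstep _).2] using hR)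

end Pairing

theorem eLpNorm_two_sq {X : Type*} [MeasurableSpace X] (μ : Measure X) (f : X → ℂ) :
    eLpNorm f 2 μ ^ 2 = ∫⁻ x, ‖f x‖ₑ ^ 2 ∂μ := by
  rw [eLpNorm_eq_lintegral_rpow_enorm_toReal two_ne_zero ENNReal.ofNat_ne_top, ← ENNReal.rpow_natCast,
    ← ENNReal.rpow_mul]
  simp

/-! ### Conditional expectation along a measure preserving map -/

section Pushforward

variable {X Y : Type*} [MeasurableSpace X] [MeasurableSpace Y] {ν : Measure X} {μ : Measure Y}
  {Φ : X → Y}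

/-- An `L²` function has a conditional expectation along a measure preserving map. -/
theorem exists_integral_mul_eq_integral_mul_comp (hΦ : MeasurePreserving Φ ν μ) {h : X → ℂ}
    (hh : MemLp h 2 ν) :
    ∃ g : Lp ℂ 2 μ, ∀ ψ : Y → ℂ, MemLp ψ 2 μ →
      ∫ y, g y * ψ y ∂μ = ∫ x, h x * ψ (Φ x) ∂ν := by
  let T := (Lp.compMeasurePreservingₗᵢ (E := ℂ) (p := 2) ℂ Φ hΦ).toContinuousLinearMap
  refine ⟨ContinuousLinearMap.adjoint T (hh.toLp h), fun ψ hψ => ?_⟩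
  -- The conditional expectation is the adjoint of composition with Φ. The inner product conjugates
  -- its first entry while the pairing is bilinear, hence the test function `star ψ`.
  have h1 := ContinuousLinearMap.adjoint_inner_right T (hψ.star.toLp _) (hh.toLp h)
  rw [L2.inner_def, L2.inner_def] at h1
  have hT : (T (hψ.star.toLp _) : X → ℂ) =ᵐ[ν] fun x => star (ψ (Φ x)) := by
    have a := Lp.coeFn_compMeasurePreserving (hψ.star.toLp _) hΦ
    have b := hΦ.quasiMeasurePreserving.ae_eq_comp hψ.star.coeFn_toLp
    exact a.trans b
  calc _ = ∫ y, inner ℂ ((hψ.star.toLp _ : Lp ℂ 2 μ) y)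
        ((ContinuousLinearMap.adjoint T (hh.toLp h) : Lp ℂ 2 μ) y) ∂μ := by
        refine integral_congr_ae ?_
        filter_upwards [hψ.star.coeFn_toLp] with y hy
        rw [hy]
        simp
    _ = _ := h1
    _ = _ := by
        refine integral_congr_ae ?_
        filter_upwards [hT, hh.coeFn_toLp] with x hx hx'
        rw [hx, hx']
        simp

/-- Conditional Jensen, or Cauchy-Schwarz on fibres, localised to S. Testing with the conjugate of g
cut off to S gives ∫_S |g|² ≤ ½∫|h|² + ½∫|g∘Φ|² over the preimage of S, and the last integral is
again ∫_S |g|². -/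
theorem setLIntegral_le_of_integral_mul_eq (hΦ : MeasurePreserving Φ ν μ) {h : X → ℂ}
    (hh : MemLp h 2 ν) {g : Lp ℂ 2 μ}
    (hg : ∀ ψ : Y → ℂ, MemLp ψ 2 μ → ∫ y, g y * ψ y ∂μ = ∫ x, h x * ψ (Φ x) ∂ν)
    {S : Set Y} (hS : MeasurableSet S) :
    ∫⁻ y in S, ‖g y‖ₑ ^ 2 ∂μ ≤ ∫⁻ x in Φ ⁻¹' S, ‖h x‖ₑ ^ 2 ∂ν := by
  have hgi : Integrable (fun y => ‖g y‖ ^ 2) μ :=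
    (memLp_two_iff_integrable_sq_norm (Lp.aestronglyMeasurable g)).1 (Lp.memLp g)
  have hhi : Integrable (fun x => ‖h x‖ ^ 2) ν := (memLp_two_iff_integrable_sq_norm hh.1).1 hh
  have hgΦ : Integrable (fun x => ‖g (Φ x)‖ ^ 2) ν := hΦ.integrable_comp_of_integrable hgi
  have hS' := hΦ.measurable hS
  have e1 : ∫⁻ y in S, ‖g y‖ₑ ^ 2 ∂μ = ENNReal.ofReal (∫ y in S, ‖g y‖ ^ 2 ∂μ) := by
    rw [ofReal_integral_eq_lintegral_ofReal hgi.integrableOn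
      (Eventually.of_forall fun y => by positivity)]
    simp [ENNReal.ofReal_pow, ofReal_norm]
  have e2 : ∫⁻ x in Φ ⁻¹' S, ‖h x‖ₑ ^ 2 ∂ν = ENNReal.ofReal (∫ x in Φ ⁻¹' S, ‖h x‖ ^ 2 ∂ν) := by
    rw [ofReal_integral_eq_lintegral_ofReal hhi.integrableOn
      (Eventually.of_forall fun y => by positivity)]
    simp [ENNReal.ofReal_pow, ofReal_norm]
  rw [e1, e2]
  refine ENNReal.ofReal_le_ofReal ?_
  have key := hg (S.indicator fun y => star (g y)) ((Lp.memLp g).star.indicator hS)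
  have k1 : ∫ y, g y * S.indicator (fun y => star (g y)) y ∂μ =
      ((∫ y in S, ‖g y‖ ^ 2 ∂μ : ℝ) : ℂ) := by
    rw [← integral_indicator hS, ← integral_complex_ofReal]
    refine integral_congr_ae (Eventually.of_forall fun y => ?_)
    by_cases hy : y ∈ S
    · simp only [Set.indicator_of_mem hy]
      rw [Complex.star_def, Complex.mul_conj, Complex.normSq_eq_norm_sq]
    · simp [Set.indicator_of_notMem hy]
  have k2 : ‖∫ x, h x * S.indicator (fun y => star (g y)) (Φ x) ∂ν‖ ≤
      ∫ x in Φ ⁻¹' S, (‖h x‖ ^ 2 + ‖g (Φ x)‖ ^ 2) / 2 ∂ν := by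
    rw [← integral_indicator hS']
    refine norm_integral_le_of_norm_le (((hhi.add hgΦ).div_const 2).indicator hS')
      (Eventually.of_forall fun x => ?_)
    by_cases hx : Φ x ∈ S
    · rw [Set.indicator_of_mem hx, Set.indicator_of_mem (show x ∈ Φ ⁻¹' S from hx), norm_mul,
        norm_star]
      nlinarith [sq_nonneg (‖h x‖ - ‖g (Φ x)‖)]
    · rw [Set.indicator_of_notMem hx, Set.indicator_of_notMem (show x ∉ Φ ⁻¹' S from hx)]
      simp
  have k3 : ∫ x in Φ ⁻¹' S, ‖g (Φ x)‖ ^ 2 ∂ν = ∫ y in S, ‖g y‖ ^ 2 ∂μ := by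
    have gen : ∀ u : Y → ℝ, AEStronglyMeasurable u μ →
        ∫ x in Φ ⁻¹' S, u (Φ x) ∂ν = ∫ y in S, u y ∂μ := by
      intro u hu
      rw [← hΦ.map_eq] at hu ⊢
      rw [setIntegral_map hS hu hΦ.measurable.aemeasurable]
    exact gen _ hgi.1
  rw [← key, k1, Complex.norm_real, integral_div, integral_add hhi.integrableOn hgΦ.integrableOn,
    k3] at k2
  have := (Real.le_norm_self _).trans k2
  linarith

/-- The bound on every measurable set is an inequality between the measures |g|²μ and the image of
|h|²ν, so it may be integrated against any nonnegative weight. -/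
theorem lintegral_le_of_integral_mul_eq (hΦ : MeasurePreserving Φ ν μ) {h : X → ℂ}
    (hh : MemLp h 2 ν) {g : Lp ℂ 2 μ}
    (hg : ∀ ψ : Y → ℂ, MemLp ψ 2 μ → ∫ y, g y * ψ y ∂μ = ∫ x, h x * ψ (Φ x) ∂ν)
    {k : Y → ℝ≥0∞} (hk : Measurable k) :
    ∫⁻ y, ‖g y‖ₑ ^ 2 * k y ∂μ ≤ ∫⁻ x, ‖h x‖ₑ ^ 2 * k (Φ x) ∂ν := by
  have hgm : AEMeasurable (fun y => ‖g y‖ₑ ^ 2) μ :=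
    (Lp.aestronglyMeasurable g).enorm.pow_const 2
  have hhm : AEMeasurable (fun x => ‖h x‖ₑ ^ 2) ν := hh.1.enorm.pow_const 2
  have hle : μ.withDensity (fun y => ‖g y‖ₑ ^ 2) ≤
      (ν.withDensity fun x => ‖h x‖ₑ ^ 2).map Φ := by
    refine Measure.le_intro fun S hS _ => ?_
    rw [withDensity_apply _ hS, Measure.map_apply hΦ.measurable hS,
      withDensity_apply _ (hΦ.measurable hS)]
    exact setLIntegral_le_of_integral_mul_eq hΦ hh hg hS
  have := lintegral_mono' hle (le_refl k)
  rw [lintegral_map hk hΦ.measurable, lintegral_withDensity_eq_lintegral_mul₀ hgm hk.aemeasurable,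
    lintegral_withDensity_eq_lintegral_mul₀ hhm (g := fun x => k (Φ x))
      (hk.comp hΦ.measurable).aemeasurable] at this
  exact this

end Pushforward

/-! ### The null form norm as a weighted integral -/

section NullForm

variable {d : ℕ}

theorem phaseDensity_le {σ : ℝ} (hσ : 0 < σ) (z : SpaceTime d) :
    phaseDensity σ z ≤ sphereArea d / (2 * σ) * (1 + ‖z‖) ^ (d - 2) := by
  have hA : 0 ≤ sphereArea d := measureReal_nonneg
  rw [phaseDensity]
  split_ifs with h
  · have h1 : Real.sqrt (massSq z - 4 * σ ^ 2) / 2 ≤ 1 + ‖z‖ := by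
      have a : Real.sqrt (massSq z - 4 * σ ^ 2) ≤ ‖z‖ := by
        refine Real.sqrt_le_iff.2 ⟨norm_nonneg z, ?_⟩
        have b := norm_fst_le z
        have c : z.fst ^ 2 ≤ ‖z‖ ^ 2 := by
          rw [← sq_abs, ← Real.norm_eq_abs]; gcongr
        unfold massSq
        nlinarith [sq_nonneg ‖z.snd‖, sq_nonneg σ]
      linarith [norm_nonneg z]
    have h2 : 2 * σ ≤ Real.sqrt (massSq z) := Real.le_sqrt_of_sq_le (by nlinarith [h.2])
    rw [mul_div_right_comm]
    gcongr
  · positivity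

/-- The phase space density grows at most polynomially. Schwartz functions are therefore legitimate
test functions for a conditional expectation taken in L² of this measure. -/
theorem memLp_schwartz_phaseMeasure {σ : ℝ} (hσ : 0 < σ) (ψ : 𝓢(SpaceTime d, ℂ)) :
    MemLp ψ 2 (phaseMeasure d σ) := by
  obtain ⟨C, hC, hψ⟩ := exists_schwartz_decay ψ (d + 1)
  have hA : 0 ≤ sphereArea d := measureReal_nonneg
  refine ⟨ψ.continuous.aestronglyMeasurable, ?_⟩
  have hm : Measurable fun z => ‖ψ z‖ₑ ^ 2 := ψ.continuous.measurable.enorm.pow_const 2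
  have hρ : Integrable fun z : SpaceTime d => (1 + ‖z‖) ^ (-((d + 2 : ℕ) : ℝ)) :=
    integrable_one_add_norm (E := SpaceTime d) (μ := volume) (by
      have : Module.finrank ℝ (SpaceTime d) = d + 1 := by
        rw [(WithLp.linearEquiv 2 ℝ (ℝ × Space d)).finrank_eq]
        simp [add_comm]
      rw [this]; push_cast; linarith)
  have h2 : eLpNorm ψ 2 (phaseMeasure d σ) ^ 2 < ∞ := by
    rw [eLpNorm_two_sq, phaseMeasure,
      lintegral_withDensity_eq_lintegral_mul _ (measurable_phaseDensity d σ).ennreal_ofReal hm]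
    refine lt_of_le_of_lt (lintegral_mono fun z => ?_)
      (hρ.const_mul (sphereArea d / (2 * σ) * C ^ 2)).lintegral_lt_top
    rw [Pi.mul_apply, ← ofReal_norm, ← ENNReal.ofReal_pow (norm_nonneg _),
      ← ENNReal.ofReal_mul (phaseDensity_nonneg σ z)]
    refine ENNReal.ofReal_le_ofReal ?_
    rw [Real.rpow_neg (by positivity), Real.rpow_natCast]
    have hz : 0 < 1 + ‖z‖ := by positivity
    calc _ ≤ (sphereArea d / (2 * σ) * (1 + ‖z‖) ^ (d - 2)) * (C * ((1 + ‖z‖) ^ (d + 1))⁻¹) ^ 2 := by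
          gcongr
          · exact phaseDensity_le hσ z
          · exact hψ z
      _ = sphereArea d / (2 * σ) * C ^ 2 * ((1 + ‖z‖) ^ (d - 2) * ((1 + ‖z‖) ^ (2 * d + 2))⁻¹) := by
          rw [mul_pow, inv_pow, ← pow_mul]; ring
      _ ≤ _ := by
          refine mul_le_mul_of_nonneg_left ?_ (by positivity)
          rw [← div_eq_mul_inv, div_le_iff₀ (by positivity), inv_mul_eq_div,
            le_div_iff₀ (by positivity), ← pow_add]
          exact pow_le_pow_right₀ (by linarith [norm_nonneg z]) (by omega)
  by_contra hcon
  rw [not_lt, top_le_iff] at hcon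
  simp [hcon] at h2

/-- Integrability against a bump function equal to 1 near a point is integrability near that point.
This permits the uniqueness argument of `IsFourierOfSquare.ae_eq`. -/
theorem IsFourierOfSquare.locallyIntegrable {s : ℝ} {f : L2Space d} {G : SpaceTime d → ℂ}
    (hG : IsFourierOfSquare s f G) : LocallyIntegrable G := by
  intro x
  let b : ContDiffBump x := ⟨1, 2, one_pos, one_lt_two⟩
  have hb : HasCompactSupport (Complex.ofRealCLM ∘ b) := b.hasCompactSupport.comp_left rfl
  have hc : ContDiff ℝ (⊤ : ℕ∞) (Complex.ofRealCLM ∘ b) :=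
    Complex.ofRealCLM.contDiff.comp b.contDiff
  have hi := (hG (hb.toSchwartzMap hc)).1
  refine ⟨Metric.closedBall x 1, Metric.closedBall_mem_nhds x one_pos, ?_⟩
  refine (hi.integrableOn (s := Metric.closedBall x 1)).congr_fun (fun z hz => ?_)
    measurableSet_closedBall
  have : b z = 1 := b.one_of_mem_closedBall hz
  simp [this]

theorem IsFourierOfSquare.ae_eq {s : ℝ} {f : L2Space d} {G G' : SpaceTime d → ℂ}
    (hG : IsFourierOfSquare s f G) (hG' : IsFourierOfSquare s f G') : G =ᵐ[volume] G' := by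
  refine ae_eq_of_integral_contDiff_smul_eq hG.locallyIntegrable hG'.locallyIntegrable ?_
  intro g g_smooth g_cpt
  have hg₁ : HasCompactSupport (Complex.ofRealCLM ∘ g) := g_cpt.comp_left rfl
  have hg₂ : ContDiff ℝ (⊤ : ℕ∞) (Complex.ofRealCLM ∘ g) := by fun_prop
  have := (hG (hg₁.toSchwartzMap hg₂)).2.trans (hG' (hg₁.toSchwartzMap hg₂)).2.symm
  simpa [mul_comm] using this

theorem measurable_nullSymbol (s : ℝ) : Measurable (nullSymbol s : SpaceTime d → ℝ) := by
  unfold nullSymbol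
  refine Continuous.measurable ?_
  fun_prop

theorem nullSymbol_nonneg (s : ℝ) (z : SpaceTime d) : 0 ≤ nullSymbol s z := abs_nonneg _

theorem enorm_nullSymbol_mul_sq (s β : ℝ) (z : SpaceTime d) (c : ℂ) :
    ‖((nullSymbol s z ^ β : ℝ) : ℂ) * c‖ₑ ^ 2 =
      ‖c‖ₑ ^ 2 * ENNReal.ofReal ((nullSymbol s z ^ β) ^ 2) := by
  have h : 0 ≤ nullSymbol s z ^ β := Real.rpow_nonneg (nullSymbol_nonneg s z) β
  rw [enorm_mul, mul_pow, mul_comm, ENNReal.ofReal_pow h, ← ofReal_norm (((nullSymbol s z ^ β : ℝ) : ℂ)),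
    Complex.norm_real, Real.norm_of_nonneg h]

theorem enorm_sq_of_isNullForm {s β : ℝ} {f : L2Space d} {G : SpaceTime d → ℂ}
    (hG : IsFourierOfSquare s f G) {w : L2SpaceTime d} (hw : IsNullForm s β f w) :
    ‖w‖ₑ ^ 2 = ∫⁻ z, ‖G z‖ₑ ^ 2 * ENNReal.ofReal ((nullSymbol s z ^ β) ^ 2) := by
  obtain ⟨G', hG', hw'⟩ := hw
  have h1 : ‖w‖ₑ = ‖(𝓕 w : L2SpaceTime d)‖ₑ := by
    rw [← ofReal_norm, ← ofReal_norm, Lp.norm_fourier_eq]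
  rw [h1, Lp.enorm_def, eLpNorm_two_sq]
  refine lintegral_congr_ae ?_
  filter_upwards [hw', hG'.ae_eq hG] with z hz hz'
  rw [hz, hz', enorm_nullSymbol_mul_sq]

/-- If the integral is finite, the inverse transform of the symbol times G is a competitor in the
infimum, and Plancherel computes its norm. -/
theorem nullFormENorm_sq_le {s β : ℝ} {f : L2Space d} {G : SpaceTime d → ℂ}
    (hG : IsFourierOfSquare s f G) :
    nullFormENorm s β f ^ 2 ≤
      ∫⁻ z, ‖G z‖ₑ ^ 2 * ENNReal.ofReal ((nullSymbol s z ^ β) ^ 2) := by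
  by_cases hfin : ∫⁻ z, ‖G z‖ₑ ^ 2 * ENNReal.ofReal ((nullSymbol s z ^ β) ^ 2) = ∞
  · rw [hfin]; exact le_top
  have hmem : MemLp (fun z => ((nullSymbol s z ^ β : ℝ) : ℂ) * G z) 2
      (volume : Measure (SpaceTime d)) := by
    refine ⟨?_, ?_⟩
    · refine AEStronglyMeasurable.mul ?_ hG.locallyIntegrable.aestronglyMeasurable
      have := (measurable_nullSymbol (d := d) s).pow_const β
      exact (Complex.measurable_ofReal.comp this).aestronglyMeasurable
    · have h2 : eLpNorm (fun z => ((nullSymbol s z ^ β : ℝ) : ℂ) * G z) 2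
          (volume : Measure (SpaceTime d)) ^ 2 < ∞ := by
        rw [eLpNorm_two_sq]
        simp only [enorm_nullSymbol_mul_sq]
        exact lt_top_iff_ne_top.2 hfin
      by_contra hcon
      rw [not_lt, top_le_iff] at hcon
      simp [hcon] at h2
  let w : L2SpaceTime d := 𝓕⁻ (hmem.toLp _)
  have hw : IsNullForm s β f w := by
    refine ⟨G, hG, ?_⟩
    rw [show (𝓕 w : L2SpaceTime d) = hmem.toLp _ from fourier_fourierInv_eq _]
    exact hmem.coeFn_toLp
  rw [← enorm_sq_of_isNullForm hG hw]
  gcongr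
  exact iInf₂_le w hw

/-- Since G is unique almost everywhere, every competitor has exactly this norm. With no competitor
the infimum is ∞ and the bound is trivial. -/
theorem le_nullFormENorm_sq {s β : ℝ} {f : L2Space d} {G : SpaceTime d → ℂ}
    (hG : IsFourierOfSquare s f G) :
    ∫⁻ z, ‖G z‖ₑ ^ 2 * ENNReal.ofReal ((nullSymbol s z ^ β) ^ 2) ≤ nullFormENorm s β f ^ 2 := by
  set I := ∫⁻ z, ‖G z‖ₑ ^ 2 * ENNReal.ofReal ((nullSymbol s z ^ β) ^ 2)
  have h1 : I ^ (1 / 2 : ℝ) ≤ nullFormENorm s β f := by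
    refine le_iInf₂ fun w hw => ?_
    have := enorm_sq_of_isNullForm hG hw
    rw [← show _ = I from this, ← ENNReal.rpow_natCast, ← ENNReal.rpow_mul]
    norm_num
  calc I = (I ^ (1 / 2 : ℝ)) ^ 2 := by
        rw [← ENNReal.rpow_natCast, ← ENNReal.rpow_mul]; norm_num
    _ ≤ _ := by gcongr

end NullForm

/-! ### The bilinear bound and its equality case -/

section PairDensity

variable {d : ℕ}

theorem sobolevENorm_sq {s : ℝ} (hs : 0 < s) (α : ℝ) (f : L2Space d) :
    sobolevENorm s α f ^ 2 = ∫⁻ ξ, ENNReal.ofReal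
      (‖(𝓕 f : L2Space d) ξ‖ ^ 2 * (2 * Real.pi * energy (s / (2 * Real.pi)) ξ) ^ (2 * α)) := by
  rw [sobolevENorm, eLpNorm_two_sq]
  refine lintegral_congr fun ξ => ?_
  have hE : 0 < energy (s / (2 * Real.pi)) ξ := energy_pos (by positivity) ξ
  have hpi := Real.pi_pos
  rw [phi_eq_energy, ← ofReal_norm, ← ENNReal.ofReal_pow (norm_nonneg _), norm_mul,
    Complex.norm_real, Real.norm_of_nonneg (by positivity), mul_pow, ← Real.rpow_natCast,
    ← Real.rpow_mul (by positivity), mul_comm, mul_comm α]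
  norm_num

/-- The density `E(ξ) |𝓕 f(ξ)|²`. -/
noncomputable def energyDensity (s : ℝ) (f : L2Space d) (ξ : Space d) : ℝ :=
  ‖(𝓕 f : L2Space d) ξ‖ ^ 2 * energy (s / (2 * Real.pi)) ξ

theorem energyDensity_nonneg (s : ℝ) (f : L2Space d) (ξ : Space d) : 0 ≤ energyDensity s f ξ :=
  mul_nonneg (by positivity) (Real.sqrt_nonneg _)

theorem aestronglyMeasurable_energyDensity (s : ℝ) (f : L2Space d) :
    AEStronglyMeasurable (energyDensity s f) := by
  unfold energyDensity
  exact ((Lp.aestronglyMeasurable _).norm.pow 2).mul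
    (continuous_energy _).aestronglyMeasurable

theorem integrable_energyDensity {s : ℝ} (hs : 0 < s) {f : L2Space d}
    (hf : f ∈ sobolevSpace d s (1 / 2)) : Integrable (energyDensity s f) := by
  refine ⟨aestronglyMeasurable_energyDensity s f, ?_⟩
  rw [hasFiniteIntegral_iff_ofReal (Eventually.of_forall (energyDensity_nonneg s f))]
  have h1 : sobolevENorm s (1 / 2) f ^ 2 < ∞ := ENNReal.pow_lt_top hf
  rw [sobolevENorm_sq hs] at h1
  refine lt_of_le_of_lt (lintegral_mono fun ξ => ENNReal.ofReal_le_ofReal ?_) h1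
  have hE : 0 < energy (s / (2 * Real.pi)) ξ := energy_pos (by positivity) ξ
  have hpi := Real.pi_gt_three
  rw [energyDensity, mul_one_div_cancel two_ne_zero, Real.rpow_one]
  refine mul_le_mul_of_nonneg_left ?_ (by positivity)
  nlinarith

/-- The function of the space-time frequency which multiplies `E(ξ)|𝓕 f(ξ)|² E(η)|𝓕 f(η)|²` in the
bound for `‖|□ - (2s)²|^β (e^{itφ_s(D)} f)²‖²`. -/
noncomputable def nullKernel (s β : ℝ) (z : SpaceTime d) : ℝ :=
  phaseDensity (s / (2 * Real.pi)) z * (nullSymbol s z ^ β) ^ 2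

theorem nullKernel_nonneg (s β : ℝ) (z : SpaceTime d) : 0 ≤ nullKernel s β z :=
  mul_nonneg (phaseDensity_nonneg _ z) (sq_nonneg _)

theorem measurable_nullKernel (s β : ℝ) : Measurable (nullKernel s β : SpaceTime d → ℝ) :=
  (measurable_phaseDensity d _).mul (((measurable_nullSymbol s).pow_const β).pow_const 2)

theorem pairMeasure_absolutelyContinuous (d : ℕ) (σ : ℝ) : pairMeasure d σ ≪ volume :=
  withDensity_absolutelyContinuous _ _

theorem lintegral_pairMeasure {σ : ℝ} {H : Space d × Space d → ℝ≥0∞} (hH : AEMeasurable H) :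
    ∫⁻ p, H p ∂pairMeasure d σ =
      ∫⁻ p : Space d × Space d, ENNReal.ofReal (1 / (energy σ p.1 * energy σ p.2)) * H p := by
  have hE := measurable_energy (V := Space d) σ
  have hw : Measurable fun p : Space d × Space d =>
      ENNReal.ofReal (1 / (energy σ p.1 * energy σ p.2)) := by fun_prop
  rw [pairMeasure, lintegral_withDensity_eq_lintegral_mul₀ hw.aemeasurable hH]
  rfl

theorem integral_pairMeasure {σ : ℝ} (hσ : 0 < σ) (H : Space d × Space d → ℂ) :
    ∫ p, H p ∂pairMeasure d σ =
      ∫ p : Space d × Space d, ((1 / (energy σ p.1 * energy σ p.2) : ℝ) : ℂ) * H p := by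
  have hE := measurable_energy (V := Space d) σ
  have hw : Measurable fun p : Space d × Space d =>
      ENNReal.ofReal (1 / (energy σ p.1 * energy σ p.2)) := by fun_prop
  rw [pairMeasure, integral_withDensity_eq_integral_toReal_smul hw
    (Eventually.of_forall fun _ => ENNReal.ofReal_lt_top)]
  refine integral_congr_ae (Eventually.of_forall fun p => ?_)
  have h1 := energy_pos hσ p.1
  have h2 := energy_pos hσ p.2
  simp only
  rw [ENNReal.toReal_ofReal (by positivity), Complex.real_smul]

theorem integral_phaseMeasure (σ : ℝ) (H : SpaceTime d → ℂ) :
    ∫ z, H z ∂phaseMeasure d σ = ∫ z, ((phaseDensity σ z : ℝ) : ℂ) * H z := by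
  rw [phaseMeasure, integral_withDensity_eq_integral_toReal_smul
    (measurable_phaseDensity d σ).ennreal_ofReal
    (Eventually.of_forall fun _ => ENNReal.ofReal_lt_top)]
  refine integral_congr_ae (Eventually.of_forall fun z => ?_)
  simp only
  rw [ENNReal.toReal_ofReal (phaseDensity_nonneg σ z), Complex.real_smul]

theorem integrable_phaseMeasure_iff (σ : ℝ) (H : SpaceTime d → ℂ) :
    Integrable H (phaseMeasure d σ) ↔ Integrable fun z => ((phaseDensity σ z : ℝ) : ℂ) * H z := by
  rw [phaseMeasure, integrable_withDensity_iff_integrable_smul'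
    (measurable_phaseDensity d σ).ennreal_ofReal
    (Eventually.of_forall fun _ => ENNReal.ofReal_lt_top)]
  refine integrable_congr (Eventually.of_forall fun z => ?_)
  simp only
  rw [ENNReal.toReal_ofReal (phaseDensity_nonneg σ z), Complex.real_smul]

theorem ofReal_enorm_sq_mul (c : ℂ) {a : ℝ} (ha : 0 ≤ a) :
    ‖((a : ℝ) : ℂ) * c‖ₑ ^ 2 = ENNReal.ofReal (‖c‖ ^ 2 * a ^ 2) := by
  rw [← ofReal_norm, ← ENNReal.ofReal_pow (norm_nonneg _), norm_mul, Complex.norm_real,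
    Real.norm_of_nonneg ha, mul_pow, mul_comm]

theorem aemeasurable_energyDensity_mul {s : ℝ} {f : L2Space d} {k : SpaceTime d → ℝ}
    (hk : Measurable k) : AEStronglyMeasurable (fun p : Space d × Space d =>
      energyDensity s f p.1 * energyDensity s f p.2 * k (pairMap (s / (2 * Real.pi)) p)) := by
  have h := aestronglyMeasurable_energyDensity s f
  exact (h.comp_fst.mul h.comp_snd).mul
    (hk.comp (continuous_pairMap _).measurable).aestronglyMeasurable

/-- The amplitude `E(ξ) 𝓕 f(ξ) E(η) 𝓕 f(η)` of `f ⊗ f` with respect to the Lorentz invariant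
measure. -/
noncomputable def pairAmplitude (s : ℝ) (f : L2Space d) (p : Space d × Space d) : ℂ :=
  ((energy (s / (2 * Real.pi)) p.1 * energy (s / (2 * Real.pi)) p.2 : ℝ) : ℂ) *
    ((𝓕 f : L2Space d) p.1 * (𝓕 f : L2Space d) p.2)

theorem aestronglyMeasurable_pairAmplitude (s : ℝ) (f : L2Space d) :
    AEStronglyMeasurable (pairAmplitude s f) := by
  have hE := continuous_energy (V := Space d) (s / (2 * Real.pi))
  have hF := Lp.aestronglyMeasurable (𝓕 f : L2Space d)
  unfold pairAmplitude
  refine AEStronglyMeasurable.mul (Continuous.aestronglyMeasurable ?_)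
    (hF.comp_fst.mul hF.comp_snd)
  fun_prop

theorem lintegral_pairAmplitude {s : ℝ} (hs : 0 < s) (f : L2Space d) {k : SpaceTime d → ℝ}
    (hk : Measurable k) :
    ∫⁻ p, ‖pairAmplitude s f p‖ₑ ^ 2 * ENNReal.ofReal (k (pairMap (s / (2 * Real.pi)) p))
        ∂pairMeasure d (s / (2 * Real.pi)) =
      ∫⁻ p : Space d × Space d, ENNReal.ofReal (energyDensity s f p.1 * energyDensity s f p.2 *
        k (pairMap (s / (2 * Real.pi)) p)) := by
  have hσ : 0 < s / (2 * Real.pi) := by positivity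
  rw [lintegral_pairMeasure]
  · refine lintegral_congr fun p => ?_
    have h1 := energy_pos hσ p.1
    have h2 := energy_pos hσ p.2
    rw [pairAmplitude, ofReal_enorm_sq_mul _ (by positivity), ← ENNReal.ofReal_mul (by positivity),
      ← ENNReal.ofReal_mul (by positivity), energyDensity, energyDensity, norm_mul]
    congr 1
    field_simp
  · have hE := measurable_energy (V := Space d) (s / (2 * Real.pi))
    exact ((aestronglyMeasurable_pairAmplitude s f).enorm.pow_const 2).mul
      (hk.comp (continuous_pairMap _).measurable).ennreal_ofReal.aemeasurable

theorem memLp_pairAmplitude {s : ℝ} (hs : 0 < s) {f : L2Space d}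
    (hf : f ∈ sobolevSpace d s (1 / 2)) :
    MemLp (pairAmplitude s f) 2 (pairMeasure d (s / (2 * Real.pi))) := by
  refine ⟨(aestronglyMeasurable_pairAmplitude s f).mono_ac (pairMeasure_absolutelyContinuous _ _), ?_⟩
  have h0 := lintegral_pairAmplitude hs f (k := fun _ => 1) measurable_const
  simp only [ENNReal.ofReal_one, mul_one] at h0
  have hi := integrable_energyDensity hs hf
  have h2 : eLpNorm (pairAmplitude s f) 2 (pairMeasure d (s / (2 * Real.pi))) ^ 2 < ∞ := by
    rw [eLpNorm_two_sq, h0]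
    exact (hi.mul_prod hi).lintegral_lt_top
  by_contra hcon
  rw [not_lt, top_le_iff] at hcon
  simp [hcon] at h2

theorem integral_pairAmplitude_mul {s : ℝ} (hs : 0 < s) (f : L2Space d) (ψ : 𝓢(SpaceTime d, ℂ)) :
    ∫ p, pairAmplitude s f p * ψ (pairMap (s / (2 * Real.pi)) p)
        ∂pairMeasure d (s / (2 * Real.pi)) =
      ∫ p : Space d × Space d, (𝓕 f : L2Space d) p.1 * (𝓕 f : L2Space d) p.2 *
        ψ (pairMap (s / (2 * Real.pi)) p) := by
  have hσ : 0 < s / (2 * Real.pi) := by positivity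
  rw [integral_pairMeasure hσ]
  refine integral_congr_ae (Eventually.of_forall fun p => ?_)
  have h1 := Complex.ofReal_ne_zero.2 (energy_pos hσ p.1).ne'
  have h2 := Complex.ofReal_ne_zero.2 (energy_pos hσ p.2).ne'
  simp only [pairAmplitude]
  push_cast
  field_simp

/-- The transform is J g, with J the phase space density and g the conditional expectation of
`pairAmplitude` along `pairMap`. In |Jg|² k dz one factor J turns dz into the phase measure, and the
other joins the weight k before Cauchy-Schwarz on the fibres. -/
theorem exists_isFourierOfSquare (hd : 2 ≤ d) {s : ℝ} (hs : 0 < s) {f : L2Space d}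
    (hf : f ∈ sobolevSpace d s (1 / 2)) :
    ∃ G : SpaceTime d → ℂ, IsFourierOfSquare s f G ∧ ∀ k : SpaceTime d → ℝ, Measurable k →
      (∀ z, 0 ≤ k z) → ∫⁻ z, ‖G z‖ₑ ^ 2 * ENNReal.ofReal (k z) ≤
        ∫⁻ p : Space d × Space d, ENNReal.ofReal (energyDensity s f p.1 * energyDensity s f p.2 *
          (phaseDensity (s / (2 * Real.pi)) (pairMap (s / (2 * Real.pi)) p) *
            k (pairMap (s / (2 * Real.pi)) p))) := by
  have hσ : 0 < s / (2 * Real.pi) := by positivity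
  have hΦ := measurePreserving_pairMap hd hσ
  have hh := memLp_pairAmplitude hs hf
  obtain ⟨g, hg⟩ := exists_integral_mul_eq_integral_mul_comp hΦ hh
  refine ⟨fun z => ((phaseDensity (s / (2 * Real.pi)) z : ℝ) : ℂ) * g z, fun ψ => ⟨?_, ?_⟩, ?_⟩
  · have h1 : Integrable (fun z => g z * ψ z) (phaseMeasure d (s / (2 * Real.pi))) :=
      (Lp.memLp g).integrable_mul (memLp_schwartz_phaseMeasure hσ ψ)
    rw [integrable_phaseMeasure_iff] at h1
    simpa only [mul_assoc] using h1
  · simp only [mul_assoc]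
    rw [← integral_phaseMeasure _ (fun z => g z * ψ z), hg ψ (memLp_schwartz_phaseMeasure hσ ψ),
      integral_pairAmplitude_mul hs, integral_propagator_sq]
  · intro k hk hk0
    have hJ := measurable_phaseDensity d (s / (2 * Real.pi))
    have hJk : Measurable fun z : SpaceTime d => phaseDensity (s / (2 * Real.pi)) z * k z :=
      hJ.mul hk
    rw [← lintegral_pairAmplitude hs f hJk]
    refine le_trans (le_of_eq ?_) (lintegral_le_of_integral_mul_eq hΦ hh hg hJk.ennreal_ofReal)
    have hm : AEMeasurable (fun z => ‖g z‖ₑ ^ 2 *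
        ENNReal.ofReal (phaseDensity (s / (2 * Real.pi)) z * k z))
        (phaseMeasure d (s / (2 * Real.pi))) :=
      ((Lp.aestronglyMeasurable g).enorm.pow_const 2).mul hJk.ennreal_ofReal.aemeasurable
    have hw := lintegral_withDensity_eq_lintegral_mul₀' hJ.ennreal_ofReal.aemeasurable hm
    rw [← phaseMeasure] at hw
    rw [hw]
    refine lintegral_congr fun z => ?_
    have h0 := phaseDensity_nonneg (s / (2 * Real.pi)) z
    rw [Pi.mul_apply, ofReal_enorm_sq_mul _ h0, ENNReal.ofReal_mul (by positivity),
      ENNReal.ofReal_pow (norm_nonneg _), ofReal_norm, ENNReal.ofReal_pow h0,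
      ENNReal.ofReal_mul h0]
    ring

theorem nullFormENorm_sq_le_lintegral (hd : 2 ≤ d) {s : ℝ} (hs : 0 < s) (β : ℝ) {f : L2Space d}
    (hf : f ∈ sobolevSpace d s (1 / 2)) :
    nullFormENorm s β f ^ 2 ≤ ∫⁻ p : Space d × Space d, ENNReal.ofReal
      (energyDensity s f p.1 * energyDensity s f p.2 *
        nullKernel s β (pairMap (s / (2 * Real.pi)) p)) := by
  obtain ⟨G, hG, hb⟩ := exists_isFourierOfSquare hd hs hf
  refine (nullFormENorm_sq_le hG).trans ?_
  exact hb (fun z => (nullSymbol s z ^ β) ^ 2)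
    (((measurable_nullSymbol s).pow_const β).pow_const 2) fun z => sq_nonneg _

/-- If `𝓕 f = e^{-aE} / E`, then the Cauchy-Schwarz inequality is an equality. -/
theorem lintegral_le_nullFormENorm_sq (hd : 2 ≤ d) {s : ℝ} (hs : 0 < s) (β a : ℝ) {f : L2Space d}
    (hf : (𝓕 f : L2Space d) =ᵐ[volume] fun ξ : Space d =>
      ((Real.exp (-a * energy (s / (2 * Real.pi)) ξ) / energy (s / (2 * Real.pi)) ξ : ℝ) : ℂ)) :
    ∫⁻ p : Space d × Space d, ENNReal.ofReal
      (energyDensity s f p.1 * energyDensity s f p.2 *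
        nullKernel s β (pairMap (s / (2 * Real.pi)) p)) ≤ nullFormENorm s β f ^ 2 := by
  have hσ : 0 < s / (2 * Real.pi) := by positivity
  set σ := s / (2 * Real.pi) with hσdef
  have hΦ := measurePreserving_pairMap hd hσ
  -- The amplitude is a function of the total energy alone, hence of the image point: it is its own
  -- conditional expectation, which is why equality holds.
  have hamp : ∀ᵐ p : Space d × Space d, pairAmplitude s f p =
      ((Real.exp (-a * (pairMap σ p).fst) : ℝ) : ℂ) := by
    have h1 := Measure.quasiMeasurePreserving_fst (μ := (volume : Measure (Space d)))
      (ν := (volume : Measure (Space d))) |>.ae_eq_comp hf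
    have h2 := Measure.quasiMeasurePreserving_snd (μ := (volume : Measure (Space d)))
      (ν := (volume : Measure (Space d))) |>.ae_eq_comp hf
    filter_upwards [h1, h2] with p hp1 hp2
    simp only [Function.comp_apply] at hp1 hp2
    have e1 := (energy_pos hσ p.1).ne'
    have e2 := (energy_pos hσ p.2).ne'
    rw [pairAmplitude, hp1, hp2, ← hσdef, ← Complex.ofReal_mul, ← Complex.ofReal_mul]
    congr 1
    have : (pairMap σ p).fst = energy σ p.1 + energy σ p.2 := rfl
    rw [this, mul_add, Real.exp_add]
    field_simp
  have hcont : Continuous fun z : SpaceTime d => ((Real.exp (-a * z.fst) : ℝ) : ℂ) := by fun_prop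
  have hG : IsFourierOfSquare s f fun z =>
      ((phaseDensity σ z : ℝ) : ℂ) * ((Real.exp (-a * z.fst) : ℝ) : ℂ) := by
    intro ψ
    have hm : AEStronglyMeasurable (fun z : SpaceTime d => ((Real.exp (-a * z.fst) : ℝ) : ℂ) * ψ z)
        (Measure.map (pairMap σ) (pairMeasure d σ)) :=
      (hcont.mul ψ.continuous).aestronglyMeasurable
    have hamp' : (fun p => pairAmplitude s f p * ψ (pairMap σ p)) =ᵐ[pairMeasure d σ]
        fun p => ((Real.exp (-a * (pairMap σ p).fst) : ℝ) : ℂ) * ψ (pairMap σ p) := by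
      filter_upwards [(pairMeasure_absolutelyContinuous d σ).ae_le hamp] with p hp
      rw [hp]
    have hint : Integrable (fun p => pairAmplitude s f p * ψ (pairMap σ p)) (pairMeasure d σ) := by
      have hE := measurable_energy (V := Space d) σ
      have hw : Measurable fun p : Space d × Space d =>
          ENNReal.ofReal (1 / (energy σ p.1 * energy σ p.2)) := by fun_prop
      rw [pairMeasure, integrable_withDensity_iff_integrable_smul' hw
        (Eventually.of_forall fun _ => ENNReal.ofReal_lt_top)]
      refine (integrable_mul_schwartz_pairMap σ (Lp.memLp (𝓕 f : L2Space d)) ψ).congr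
        (Eventually.of_forall fun p => ?_)
      have h1 := energy_pos hσ p.1
      have h2 := energy_pos hσ p.2
      simp only [pairAmplitude, ← hσdef]
      rw [ENNReal.toReal_ofReal (by positivity), Complex.real_smul]
      have h1' := Complex.ofReal_ne_zero.2 h1.ne'
      have h2' := Complex.ofReal_ne_zero.2 h2.ne'
      push_cast
      field_simp
    constructor
    · simp only [mul_assoc]
      rw [← integrable_phaseMeasure_iff σ (fun z => ((Real.exp (-a * z.fst) : ℝ) : ℂ) * ψ z),
        ← hΦ.map_eq, integrable_map_measure hm hΦ.measurable.aemeasurable]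
      exact hint.congr hamp'
    · simp only [mul_assoc]
      rw [← integral_phaseMeasure σ (fun z => ((Real.exp (-a * z.fst) : ℝ) : ℂ) * ψ z),
        integral_propagator_sq, ← hΦ.map_eq, integral_map hΦ.measurable.aemeasurable hm,
        ← integral_pairAmplitude_mul hs]
      exact integral_congr_ae hamp'.symm
  refine le_trans (le_of_eq ?_) (le_nullFormENorm_sq hG)
  rw [← lintegral_pairAmplitude hs f (measurable_nullKernel s β)]
  have hk := (measurable_nullKernel (d := d) s β).ennreal_ofReal
  have hexp : Measurable fun z : SpaceTime d =>
      ‖((Real.exp (-a * z.fst) : ℝ) : ℂ)‖ₑ ^ 2 * ENNReal.ofReal (nullKernel s β z) :=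
    (hcont.measurable.enorm.pow_const 2).mul hk
  have h1 : ∫⁻ p, ‖pairAmplitude s f p‖ₑ ^ 2 * ENNReal.ofReal (nullKernel s β (pairMap σ p))
      ∂pairMeasure d σ = ∫⁻ z, ‖((Real.exp (-a * z.fst) : ℝ) : ℂ)‖ₑ ^ 2 *
        ENNReal.ofReal (nullKernel s β z) ∂phaseMeasure d σ := by
    rw [← hΦ.lintegral_comp hexp]
    refine lintegral_congr_ae ?_
    filter_upwards [(pairMeasure_absolutelyContinuous d σ).ae_le hamp] with p hp
    rw [hp]
  rw [h1, phaseMeasure, lintegral_withDensity_eq_lintegral_mul _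
    (measurable_phaseDensity d σ).ennreal_ofReal hexp]
  refine lintegral_congr fun z => ?_
  have h0 := phaseDensity_nonneg σ z
  rw [Pi.mul_apply, ofReal_enorm_sq_mul _ h0, nullKernel, ENNReal.ofReal_mul h0,
    ENNReal.ofReal_mul (by positivity), ENNReal.ofReal_pow (norm_nonneg _), ofReal_norm,
    ENNReal.ofReal_pow h0]
  ring

end PairDensity

/-! ### Explicit kernel and constants -/

section Kernel

variable {d : ℕ}

theorem massSq_pairMap (σ : ℝ) (p : Space d × Space d) :
    massSq (pairMap σ p) = 2 * (σ ^ 2 + energy σ p.1 * energy σ p.2 - inner ℝ p.1 p.2) := by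
  have h1 := energy_sq σ p.1
  have h2 := energy_sq σ p.2
  have h3 := norm_add_sq_real p.1 p.2
  change (energy σ p.1 + energy σ p.2) ^ 2 - ‖p.1 + p.2‖ ^ 2 = _
  rw [h3]
  linear_combination h1 + h2

/-- Reversed Cauchy-Schwarz on the mass shell: (EE')² - (σ² + ξ·η)² = σ²|ξ - η|² + (|ξ|²|η|² -
(ξ·η)²), whose first term is positive off the diagonal. -/
theorem lt_massSq_pairMap {σ : ℝ} (hσ : 0 < σ) {p : Space d × Space d} (hp : p.1 ≠ p.2) :
    4 * σ ^ 2 < massSq (pairMap σ p) := by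
  rw [massSq_pairMap]
  have h1 := energy_sq σ p.1
  have h2 := energy_sq σ p.2
  have h3 := norm_sub_sq_real p.1 p.2
  have h4 : 0 < ‖p.1 - p.2‖ := norm_pos_iff.2 (sub_ne_zero.2 hp)
  have h5 := abs_real_inner_le_norm p.1 p.2
  have h6 : inner ℝ p.1 p.2 ^ 2 ≤ (‖p.1‖ * ‖p.2‖) ^ 2 := by
    rw [← sq_abs]; gcongr
  have h7 : (σ ^ 2 + inner ℝ p.1 p.2) ^ 2 < (energy σ p.1 * energy σ p.2) ^ 2 := by
    rw [mul_pow, h1, h2]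
    nlinarith [mul_pos (pow_pos hσ 2) (pow_pos h4 2)]
  have h8 := abs_lt_of_sq_lt_sq h7 (mul_pos (energy_pos hσ _) (energy_pos hσ _)).le
  linarith [(abs_lt.1 h8).2]

theorem le_massSq_pairMap {σ : ℝ} (hσ : 0 < σ) (p : Space d × Space d) :
    4 * σ ^ 2 ≤ massSq (pairMap σ p) := by
  by_cases hp : p.1 = p.2
  · rw [massSq_pairMap, hp, real_inner_self_eq_norm_sq, ← sq, energy_sq]
    linarith
  · exact (lt_massSq_pairMap hσ hp).le

/-- The constant in front of the explicit form of `nullKernel`. -/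
noncomputable def kernelConst (d : ℕ) (β : ℝ) : ℝ :=
  sphereArea d * (2 : ℝ) ^ (2 - (d : ℝ)) * (2 * Real.pi) ^ (4 * β)

theorem kernelConst_pos (hd : 2 ≤ d) (β : ℝ) : 0 < kernelConst d β := by
  have := sphereArea_pos hd
  have := Real.pi_pos
  unfold kernelConst
  positivity

theorem nullKernel_pairMap (hd : 2 ≤ d) {s : ℝ} (hs : 0 < s) (β : ℝ) {p : Space d × Space d}
    (hp : p.1 ≠ p.2) :
    nullKernel s β (pairMap (s / (2 * Real.pi)) p) = kernelConst d β *
      (massSq (pairMap (s / (2 * Real.pi)) p) - 4 * (s / (2 * Real.pi)) ^ 2) ^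
        (((d : ℝ) - 2) / 2 + 2 * β) / Real.sqrt (massSq (pairMap (s / (2 * Real.pi)) p)) := by
  have hpi := Real.pi_pos
  have hσ : 0 < s / (2 * Real.pi) := by positivity
  have hM := lt_massSq_pairMap hσ hp
  set σ := s / (2 * Real.pi) with hσdef
  have hsσ : s = 2 * Real.pi * σ := by rw [hσdef]; field_simp
  have hτ : 0 < (pairMap σ p).fst := add_pos (energy_pos hσ p.1) (energy_pos hσ p.2)
  have hN : nullSymbol s (pairMap σ p) =
      (2 * Real.pi) ^ 2 * (massSq (pairMap σ p) - 4 * σ ^ 2) := by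
    rw [nullSymbol, ← abs_of_pos (show 0 < (2 * Real.pi) ^ 2 * (massSq (pairMap σ p) - 4 * σ ^ 2) from
      mul_pos (by positivity) (by linarith)), massSq, hsσ]
    congr 1
    ring
  set M := massSq (pairMap σ p)
  have hD : 0 < M - 4 * σ ^ 2 := by linarith
  rw [nullKernel, phaseDensity, if_pos ⟨hτ, hM⟩, hN, kernelConst]
  have e1 : (Real.sqrt (M - 4 * σ ^ 2) / 2) ^ (d - 2) =
      (M - 4 * σ ^ 2) ^ (((d : ℝ) - 2) / 2) * 2 ^ (2 - (d : ℝ)) := by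
    rw [← Real.rpow_natCast, Nat.cast_sub hd, Nat.cast_ofNat, Real.div_rpow (Real.sqrt_nonneg _)
      zero_le_two, Real.sqrt_eq_rpow, ← Real.rpow_mul hD.le, div_eq_mul_inv, ← Real.rpow_neg
      zero_le_two, neg_sub]
    congr 2
    ring
  have e2 : (((2 * Real.pi) ^ 2 * (M - 4 * σ ^ 2)) ^ β) ^ 2 =
      (2 * Real.pi) ^ (4 * β) * (M - 4 * σ ^ 2) ^ (2 * β) := by
    rw [← Real.rpow_natCast, ← Real.rpow_mul (by positivity), Real.mul_rpow (by positivity) hD.le,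
      ← Real.rpow_natCast, ← Real.rpow_mul (by positivity)]
    congr 2 <;> · push_cast; ring
  rw [e1, e2, Real.rpow_add hD]
  ring

theorem sphereArea_eq (hd : 2 ≤ d) :
    sphereArea d = 2 * Real.pi ^ ((d : ℝ) / 2) / Real.Gamma ((d : ℝ) / 2) := by
  have hne : Nonempty (Fin d) := ⟨⟨0, by omega⟩⟩
  have hd0 : (0 : ℝ) < (d : ℝ) / 2 := by positivity
  rw [sphereArea, Measure.toSphere_real_apply_univ, finrank_euclideanSpace, Fintype.card_fin,
    measureReal_def, EuclideanSpace.volume_ball]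
  simp only [ENNReal.ofReal_one, one_pow, one_mul, Fintype.card_fin]
  rw [ENNReal.toReal_ofReal (by positivity), Real.Gamma_add_one hd0.ne', Real.sqrt_eq_rpow,
    ← Real.rpow_natCast, ← Real.rpow_mul Real.pi_pos.le]
  have : Real.Gamma ((d : ℝ) / 2) ≠ 0 := (Real.Gamma_pos_of_pos hd0).ne'
  have hd1 : (d : ℝ) ≠ 0 := by positivity
  rw [show 1 / 2 * (d : ℝ) = d / 2 by ring]
  field_simp

/-- Legendre's duplication formula turns Γ(d/2) from the sphere area into the quotient of Gamma
values in the stated constants. -/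
theorem sphereArea_mul_rpow (hd : 2 ≤ d) :
    sphereArea d * (2 * Real.pi) ^ (1 - (d : ℝ)) =
      Real.pi ^ ((1 - (d : ℝ)) / 2) *
        (Real.Gamma (((d : ℝ) - 1) / 2) / Real.Gamma ((d : ℝ) - 1)) := by
  have hd' : (2 : ℝ) ≤ d := by exact_mod_cast hd
  have hpi := Real.pi_pos
  have hleg := Real.Gamma_mul_Gamma_add_half (((d : ℝ) - 1) / 2)
  rw [show ((d : ℝ) - 1) / 2 + 1 / 2 = d / 2 by ring,
    show 2 * (((d : ℝ) - 1) / 2) = d - 1 by ring, show 1 - ((d : ℝ) - 1) = 2 - d by ring] at hleg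
  have g1 : 0 < Real.Gamma ((d : ℝ) / 2) := Real.Gamma_pos_of_pos (by linarith)
  have g2 : 0 < Real.Gamma ((d : ℝ) - 1) := Real.Gamma_pos_of_pos (by linarith)
  have e : Real.Gamma (((d : ℝ) - 1) / 2) / Real.Gamma ((d : ℝ) - 1) =
      2 ^ (2 - (d : ℝ)) * Real.sqrt Real.pi / Real.Gamma ((d : ℝ) / 2) := by
    rw [div_eq_div_iff g2.ne' g1.ne', hleg]
    ring
  rw [e, sphereArea_eq hd, Real.mul_rpow zero_le_two hpi.le, Real.sqrt_eq_rpow,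
    show (2 : ℝ) - d = 1 + (1 - d) by ring, Real.rpow_add two_pos, Real.rpow_one]
  have h3 : Real.pi ^ ((d : ℝ) / 2) * Real.pi ^ (1 - (d : ℝ)) =
      Real.pi ^ ((1 - (d : ℝ)) / 2) * Real.pi ^ (1 / 2 : ℝ) := by
    rw [← Real.rpow_add hpi, ← Real.rpow_add hpi]
    congr 1
    ring
  field_simp
  linear_combination h3

/-- The factor (2π)² is the one relating (∫ e)² to the fourth power of the Sobolev norm of order
1/2. -/
theorem kernelConst_wave_half (hd : 2 ≤ d) :
    kernelConst d ((3 - (d : ℝ)) / 4) = waveConst ((3 - (d : ℝ)) / 4) d * (2 * Real.pi) ^ 2 := by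
  have hpi := Real.pi_pos
  rw [kernelConst, waveConst, show 4 * ((3 - (d : ℝ)) / 4) = (1 - d) + 2 by ring,
    Real.rpow_add (by positivity), show (d : ℝ) - 2 + 2 * ((3 - d) / 4) = (d - 1) / 2 by ring,
    show (3 * (d : ℝ) - 5) / 2 + 2 * ((3 - d) / 4) = d - 1 by ring,
    show (-1 : ℝ) + (1 - d + 2) = 2 - d by ring]
  rw [Real.rpow_two]
  linear_combination (2 : ℝ) ^ (2 - (d : ℝ)) * (2 * Real.pi) ^ 2 * sphereArea_mul_rpow hd

/-- Raising β by 1/2 multiplies the power of two by 4, while Γ(x+1) = xΓ(x) changes the Gamma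
quotient by ((d-1)/2)/(d-1) = 1/2. -/
theorem waveConst_one (hd : 2 ≤ d) :
    waveConst ((5 - (d : ℝ)) / 4) d = 2 * waveConst ((3 - (d : ℝ)) / 4) d := by
  have hd' : (2 : ℝ) ≤ d := by exact_mod_cast hd
  rw [waveConst, waveConst, show (-1 : ℝ) + 4 * ((5 - d) / 4) = 2 + (2 - d) by ring,
    show (-1 : ℝ) + 4 * ((3 - d) / 4) = 2 - d by ring, Real.rpow_add two_pos,
    show (d : ℝ) - 2 + 2 * ((5 - d) / 4) = (d - 1) / 2 + 1 by ring,
    show (3 * (d : ℝ) - 5) / 2 + 2 * ((5 - d) / 4) = (d - 1) + 1 by ring,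
    show (d : ℝ) - 2 + 2 * ((3 - d) / 4) = (d - 1) / 2 by ring,
    show (3 * (d : ℝ) - 5) / 2 + 2 * ((3 - d) / 4) = d - 1 by ring,
    Real.Gamma_add_one (by linarith), Real.Gamma_add_one (by linarith)]
  have h2 : (2 : ℝ) ^ (2 : ℝ) = 4 := by
    rw [Real.rpow_two]; norm_num
  have h3 : (d : ℝ) - 1 ≠ 0 := by linarith
  have g2 : 0 < Real.Gamma ((d : ℝ) - 1) := Real.Gamma_pos_of_pos (by linarith)
  rw [h2]
  field_simp
  ring

theorem kernelConst_add (d : ℕ) (β c : ℝ) :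
    kernelConst d (β + c / 4) = kernelConst d β * (2 * Real.pi) ^ c := by
  have hpi := Real.pi_pos
  rw [kernelConst, kernelConst, show 4 * (β + c / 4) = 4 * β + c by ring,
    Real.rpow_add (by positivity)]
  ring

/-- The 2 on the left comes from M - 4σ² = 2(EE' - σ² - ξ·η), and (2π)⁴ is the scaling of the
refined norm squared. -/
theorem kernelConst_wave_one (hd : 2 ≤ d) :
    2 * kernelConst d ((5 - (d : ℝ)) / 4) = waveConst ((5 - (d : ℝ)) / 4) d * (2 * Real.pi) ^ 4 := by
  rw [show (5 - (d : ℝ)) / 4 = (3 - d) / 4 + 2 / 4 by ring, kernelConst_add,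
    kernelConst_wave_half hd, show (3 - (d : ℝ)) / 4 + 2 / 4 = (5 - d) / 4 by ring, waveConst_one hd]
  rw [Real.rpow_two]
  ring

theorem waveConst_half (d : ℕ) : waveConst ((3 - (d : ℝ)) / 4) d =
    2 ^ (2 - (d : ℝ)) * Real.pi ^ ((1 - (d : ℝ)) / 2) *
      (Real.Gamma (((d : ℝ) - 1) / 2) / Real.Gamma ((d : ℝ) - 1)) := by
  rw [waveConst, show (-1 : ℝ) + 4 * ((3 - d) / 4) = 2 - d by ring,
    show (d : ℝ) - 2 + 2 * ((3 - d) / 4) = (d - 1) / 2 by ring,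
    show (3 * (d : ℝ) - 5) / 2 + 2 * ((3 - d) / 4) = d - 1 by ring]

/-- The division by 2σ is the value of 1/√M at the threshold M = 4σ², where the supremum of the
kernel is approached. -/
theorem kernelConst_nonwave_half (hd : 2 ≤ d) {s : ℝ} (hs : 0 < s) :
    kernelConst d ((2 - (d : ℝ)) / 4) / (2 * (s / (2 * Real.pi))) =
      (2 : ℝ) ^ (1 - (d : ℝ)) * Real.pi ^ ((1 - (d : ℝ)) / 2) *
          (Real.Gamma (((d : ℝ) - 1) / 2) / Real.Gamma ((d : ℝ) - 1)) * s⁻¹ * (2 * Real.pi) ^ 2 := by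
  have hpi := Real.pi_pos
  rw [show (2 - (d : ℝ)) / 4 = (3 - d) / 4 + (-1) / 4 by ring, kernelConst_add,
    kernelConst_wave_half hd, waveConst_half, Real.rpow_neg_one,
    show (2 : ℝ) - d = 1 + (1 - d) by ring, Real.rpow_add two_pos, Real.rpow_one]
  field_simp

theorem kernelConst_nonwave_one (hd : 2 ≤ d) {s : ℝ} (hs : 0 < s) :
    2 * (kernelConst d ((4 - (d : ℝ)) / 4) / (2 * (s / (2 * Real.pi)))) =
      (2 : ℝ) ^ (2 - (d : ℝ)) * Real.pi ^ ((1 - (d : ℝ)) / 2) *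
          (Real.Gamma (((d : ℝ) - 1) / 2) / Real.Gamma ((d : ℝ) - 1)) * s⁻¹ * (2 * Real.pi) ^ 4 := by
  have hpi := Real.pi_pos
  rw [show (4 - (d : ℝ)) / 4 = (3 - d) / 4 + 1 / 4 by ring, kernelConst_add,
    kernelConst_wave_half hd, waveConst_half, Real.rpow_one]
  field_simp

end Kernel

/-! ### From kernel bounds to strict inequalities -/

section UpperBound

variable {d : ℕ}

/-- A strict squared inequality yields the estimate and excludes extremisers together; only
optimality needs nearly extremal functions. Everything is squared because both sides are computed as
integrals. -/
theorem sharpWithoutExtremisers_of {X : Set (L2Space d)} {N : L2Space d → ℝ≥0∞}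
    {R : L2Space d → ℝ} {C : ℝ} (hC : 0 ≤ C) (h0 : N 0 = 0) (hR : ∀ f ∈ X, 0 ≤ R f)
    (hlt : ∀ f ∈ X, f ≠ 0 → N f ^ 2 < ENNReal.ofReal (C ^ 2 * R f ^ 2))
    (hopt : ∀ ε > 0, ε < 1 → ∃ f ∈ X, 0 < R f ∧
      ENNReal.ofReal ((1 - ε) * (C ^ 2 * R f ^ 2)) ≤ N f ^ 2) :
    SharpWithoutExtremisers X N R C := by
  have hlt' : ∀ f ∈ X, f ≠ 0 → N f < ENNReal.ofReal (C * R f) := by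
    intro f hf hf0
    have h := hlt f hf hf0
    rw [← mul_pow, ENNReal.ofReal_pow (mul_nonneg hC (hR f hf))] at h
    exact lt_of_not_ge fun hcon => h.not_ge (pow_le_pow_left' hcon 2)
  refine ⟨⟨⟨hC, fun f hf => ?_⟩, ?_⟩, fun f hf hf0 => (hlt' f hf hf0).ne⟩
  · by_cases hf0 : f = 0
    · rw [hf0, h0]; exact zero_le
    · exact (hlt' f hf hf0).le
  · rintro A ⟨hA, hAf⟩
    have hsq : C ^ 2 ≤ A ^ 2 := by
      by_contra hcon
      push Not at hcon
      have hC2 : 0 < C ^ 2 := lt_of_le_of_lt (sq_nonneg A) hcon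
      -- This ε makes (1 - ε)C² the midpoint of A² and C², still larger than A².
      set ε := (C ^ 2 - A ^ 2) / (2 * C ^ 2) with hε
      have hε0 : 0 < ε := div_pos (by linarith) (by positivity)
      have hε1 : ε < 1 := by rw [hε, div_lt_one (by positivity)]; nlinarith [sq_nonneg A]
      obtain ⟨f, hf, hRf, hN⟩ := hopt ε hε0 hε1
      have h1 : ENNReal.ofReal ((1 - ε) * (C ^ 2 * R f ^ 2)) ≤ ENNReal.ofReal ((A * R f) ^ 2) := by
        refine hN.trans ?_
        rw [ENNReal.ofReal_pow (by positivity)]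
        gcongr
        exact hAf f hf
      rw [ENNReal.ofReal_le_ofReal_iff (by positivity)] at h1
      have h2 : (1 - ε) * C ^ 2 ≤ A ^ 2 := by
        have : 0 < R f ^ 2 := by positivity
        refine le_of_mul_le_mul_right ?_ this
        linarith [mul_pow A (R f) 2]
      have h3 : ε * C ^ 2 = (C ^ 2 - A ^ 2) / 2 := by
        have hC0 : C ≠ 0 := by rintro rfl; simp at hC2
        rw [hε]; field_simp
      linarith
    exact le_of_sq_le_sq hsq hA

theorem sobolevSpace_one_subset {s : ℝ} (hs : 0 < s) :
    sobolevSpace d s 1 ⊆ sobolevSpace d s (1 / 2) := by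
  intro f hf
  have hpi := Real.pi_pos
  have h1 : sobolevENorm s 1 f ^ 2 < ∞ := ENNReal.pow_lt_top hf
  have h2 : sobolevENorm s (1 / 2) f ^ 2 < ∞ := by
    rw [sobolevENorm_sq hs] at h1 ⊢
    refine lt_of_le_of_lt ?_ (ENNReal.mul_lt_top (ENNReal.ofReal_lt_top (r := 1 / s)) h1)
    rw [← lintegral_const_mul' _ _ ENNReal.ofReal_ne_top]
    refine lintegral_mono fun ξ => ?_
    rw [← ENNReal.ofReal_mul (by positivity)]
    refine ENNReal.ofReal_le_ofReal ?_
    have hE := le_energy (s / (2 * Real.pi)) ξ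
    have hE' : s ≤ 2 * Real.pi * energy (s / (2 * Real.pi)) ξ := by
      rw [div_le_iff₀ (by positivity)] at hE; linarith
    rw [mul_one_div_cancel two_ne_zero, Real.rpow_one, mul_one, Real.rpow_two, mul_left_comm (1 / s)]
    refine mul_le_mul_of_nonneg_left ?_ (sq_nonneg _)
    generalize 2 * Real.pi * energy (s / (2 * Real.pi)) ξ = x at hE'
    rw [one_div, inv_mul_eq_div, le_div_iff₀ hs, sq]
    exact mul_le_mul_of_nonneg_left hE' (hs.le.trans hE')
  change sobolevENorm s (1 / 2) f < ∞
  by_contra hcon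
  rw [not_lt, top_le_iff] at hcon
  rw [hcon] at h2
  simp at h2

theorem sobolevNorm_half_sq {s : ℝ} (hs : 0 < s) (f : L2Space d) :
    sobolevNorm s (1 / 2) f ^ 2 = 2 * Real.pi * ∫ ξ, energyDensity s f ξ := by
  have hpi := Real.pi_pos
  have hσ : 0 < s / (2 * Real.pi) := by positivity
  rw [sobolevNorm, ← ENNReal.toReal_pow, sobolevENorm_sq hs, ← integral_const_mul,
    integral_eq_lintegral_of_nonneg_ae]
  · congr 1
    refine lintegral_congr fun ξ => ?_
    rw [mul_one_div_cancel two_ne_zero, Real.rpow_one, energyDensity]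
    congr 1
    ring
  · exact Eventually.of_forall fun ξ => mul_nonneg (by positivity) (energyDensity_nonneg s f ξ)
  · exact (aestronglyMeasurable_energyDensity s f).const_mul _

theorem sobolevNorm_one_sq {s : ℝ} (hs : 0 < s) (f : L2Space d) :
    sobolevNorm s 1 f ^ 2 =
      (2 * Real.pi) ^ 2 * ∫ ξ, energy (s / (2 * Real.pi)) ξ * energyDensity s f ξ := by
  have hpi := Real.pi_pos
  have hσ : 0 < s / (2 * Real.pi) := by positivity
  rw [sobolevNorm, ← ENNReal.toReal_pow, sobolevENorm_sq hs, ← integral_const_mul,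
    integral_eq_lintegral_of_nonneg_ae]
  · congr 1
    refine lintegral_congr fun ξ => ?_
    rw [mul_one, Real.rpow_two, energyDensity]
    congr 1
    ring
  · exact Eventually.of_forall fun ξ => mul_nonneg (by positivity)
      (mul_nonneg (energy_pos hσ ξ).le (energyDensity_nonneg s f ξ))
  · exact ((continuous_energy _).aestronglyMeasurable.mul
      (aestronglyMeasurable_energyDensity s f)).const_mul _

theorem integrable_energy_mul_energyDensity {s : ℝ} (hs : 0 < s) {f : L2Space d}
    (hf : f ∈ sobolevSpace d s 1) :
    Integrable fun ξ => energy (s / (2 * Real.pi)) ξ * energyDensity s f ξ := by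
  have hpi := Real.pi_gt_three
  have hσ : 0 < s / (2 * Real.pi) := by positivity
  refine ⟨(continuous_energy _).aestronglyMeasurable.mul
    (aestronglyMeasurable_energyDensity s f), ?_⟩
  rw [hasFiniteIntegral_iff_ofReal (Eventually.of_forall fun ξ =>
    mul_nonneg (energy_pos hσ ξ).le (energyDensity_nonneg s f ξ))]
  have h1 : sobolevENorm s 1 f ^ 2 < ∞ := ENNReal.pow_lt_top hf
  rw [sobolevENorm_sq hs] at h1
  refine lt_of_le_of_lt (lintegral_mono fun ξ => ENNReal.ofReal_le_ofReal ?_) h1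
  have hE := energy_pos hσ ξ
  rw [energyDensity, mul_one, Real.rpow_two, mul_left_comm]
  refine mul_le_mul_of_nonneg_left ?_ (by positivity)
  rw [mul_pow, ← sq]
  exact le_mul_of_one_le_left (by positivity) (by nlinarith)

theorem integrable_energyDensity_mul {s : ℝ} (hs : 0 < s) {f : L2Space d}
    (hf : f ∈ sobolevSpace d s (1 / 2)) :
    Integrable fun p : Space d × Space d => energyDensity s f p.1 * energyDensity s f p.2 :=
  (integrable_energyDensity hs hf).mul_prod (integrable_energyDensity hs hf)

theorem integral_energyDensity_mul (s : ℝ) (f : L2Space d) :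
    ∫ p : Space d × Space d, energyDensity s f p.1 * energyDensity s f p.2 =
      (∫ ξ, energyDensity s f ξ) ^ 2 := by
  rw [sq, Measure.volume_eq_prod]
  exact integral_prod_mul (energyDensity s f) (energyDensity s f)

theorem integrable_energyDensity_smul {s : ℝ} (hs : 0 < s) {f : L2Space d}
    (hf : f ∈ sobolevSpace d s 1) : Integrable fun ξ => energyDensity s f ξ • ξ := by
  have hσ : 0 < s / (2 * Real.pi) := by positivity
  refine (integrable_energy_mul_energyDensity hs hf).mono'
    ((aestronglyMeasurable_energyDensity s f).smul continuous_id.aestronglyMeasurable)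
    (Eventually.of_forall fun ξ => ?_)
  rw [norm_smul, Real.norm_of_nonneg (energyDensity_nonneg s f ξ), mul_comm]
  exact mul_le_mul_of_nonneg_right (norm_lt_energy hσ ξ).le (energyDensity_nonneg s f ξ)

/-- Applied to the momentum density, this exhibits the cross term ξ·η as a perfect square, which
gives it a sign. -/
theorem integrable_inner_and_integral_inner {u : Space d → Space d} (hu : Integrable u) :
    Integrable (fun p : Space d × Space d => inner ℝ (u p.1) (u p.2)) ∧
      ∫ p : Space d × Space d, inner ℝ (u p.1) (u p.2) = ‖∫ ξ, u ξ‖ ^ 2 := by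
  have hi : Integrable (fun p : Space d × Space d => inner ℝ (u p.1) (u p.2)) := by
    refine (hu.norm.mul_prod hu.norm).mono' (hu.1.comp_fst.inner hu.1.comp_snd)
      (Eventually.of_forall fun p => ?_)
    exact norm_inner_le_norm _ _
  refine ⟨hi, ?_⟩
  rw [Measure.volume_eq_prod] at hi ⊢
  rw [integral_prod _ hi]
  simp only [integral_inner hu]
  simp only [real_inner_comm (∫ ξ, u ξ)]
  rw [integral_inner hu, real_inner_self_eq_norm_sq]

/-- Every term of M - 4σ² = 2(EE' - σ² - ξ·η) splits as a product over the two particles. The double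
integral therefore reduces to the energy, mass and momentum moments of the density. -/
theorem integrable_massSq_mul {s : ℝ} (hs : 0 < s) {f : L2Space d} (hf : f ∈ sobolevSpace d s 1) :
    Integrable (fun p : Space d × Space d => energyDensity s f p.1 * energyDensity s f p.2 *
        (massSq (pairMap (s / (2 * Real.pi)) p) - 4 * (s / (2 * Real.pi)) ^ 2)) ∧
      ∫ p : Space d × Space d, energyDensity s f p.1 * energyDensity s f p.2 *
        (massSq (pairMap (s / (2 * Real.pi)) p) - 4 * (s / (2 * Real.pi)) ^ 2) =
      2 * ((∫ ξ, energy (s / (2 * Real.pi)) ξ * energyDensity s f ξ) ^ 2 -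
        (s / (2 * Real.pi)) ^ 2 * (∫ ξ, energyDensity s f ξ) ^ 2 -
          ‖∫ ξ, energyDensity s f ξ • ξ‖ ^ 2) := by
  set σ := s / (2 * Real.pi)
  set e := energyDensity s f with he
  have h1 := integrable_energy_mul_energyDensity hs hf
  have h2 := integrable_energyDensity_mul hs (sobolevSpace_one_subset hs hf)
  obtain ⟨h3, h3'⟩ := integrable_inner_and_integral_inner (integrable_energyDensity_smul hs hf)
  have h4 : Integrable fun p : Space d × Space d =>
      (energy σ p.1 * e p.1) * (energy σ p.2 * e p.2) := h1.mul_prod h1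
  have h4' : ∫ p : Space d × Space d, (energy σ p.1 * e p.1) * (energy σ p.2 * e p.2) =
      (∫ ξ, energy σ ξ * e ξ) ^ 2 := by
    rw [sq, Measure.volume_eq_prod]
    exact integral_prod_mul (fun ξ => energy σ ξ * e ξ) (fun ξ => energy σ ξ * e ξ)
  have hfun : (fun p : Space d × Space d => e p.1 * e p.2 * (massSq (pairMap σ p) - 4 * σ ^ 2)) =
      fun p => 2 * ((energy σ p.1 * e p.1) * (energy σ p.2 * e p.2) - σ ^ 2 * (e p.1 * e p.2) -
        inner ℝ (e p.1 • p.1) (e p.2 • p.2)) := by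
    ext p
    rw [massSq_pairMap, real_inner_smul_left, real_inner_smul_right]
    ring
  rw [hfun]
  have h5 : Integrable fun p : Space d × Space d =>
      (energy σ p.1 * e p.1) * (energy σ p.2 * e p.2) - σ ^ 2 * (e p.1 * e p.2) :=
    h4.sub (h2.const_mul _)
  refine ⟨(h5.sub h3).const_mul 2, ?_⟩
  rw [integral_const_mul, integral_sub h5 h3,
    integral_sub h4 (h2.const_mul _), integral_const_mul, h3', h4', integral_energyDensity_mul]

theorem ae_fst_ne_snd (hd : 2 ≤ d) : ∀ᵐ p : Space d × Space d, p.1 ≠ p.2 := by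
  have : Nontrivial (Space d) := by
    have : Nonempty (Fin d) := ⟨⟨0, by omega⟩⟩
    infer_instance
  have hm : MeasurableSet {p : Space d × Space d | p.1 = p.2} :=
    measurableSet_eq_fun measurable_fst measurable_snd
  rw [ae_iff]
  simp only [ne_eq, not_not]
  rw [Measure.volume_eq_prod, Measure.measure_prod_null hm]
  refine Eventually.of_forall fun x => ?_
  have : Prod.mk x ⁻¹' {p : Space d × Space d | p.1 = p.2} = {x} := by
    ext y; simp [eq_comm]
  change volume (Prod.mk x ⁻¹' {p : Space d × Space d | p.1 = p.2}) = 0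
  rw [this]
  simp

theorem eq_zero_of_integral_energyDensity {s : ℝ} (hs : 0 < s) {f : L2Space d}
    (hf : f ∈ sobolevSpace d s (1 / 2)) (h : ∫ ξ, energyDensity s f ξ = 0) : f = 0 := by
  have hσ : 0 < s / (2 * Real.pi) := by positivity
  rw [integral_eq_zero_iff_of_nonneg (energyDensity_nonneg s f) (integrable_energyDensity hs hf)] at h
  have h1 : (𝓕 f : L2Space d) = 0 := by
    rw [Lp.eq_zero_iff_ae_eq_zero]
    filter_upwards [h] with ξ hξ
    have h2 : ‖(𝓕 f : L2Space d) ξ‖ ^ 2 * energy (s / (2 * Real.pi)) ξ = 0 := hξ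
    rw [mul_eq_zero, or_iff_left (energy_pos hσ ξ).ne'] at h2
    simpa using h2
  rw [← norm_eq_zero, ← Lp.norm_fourier_eq, h1, norm_zero]

theorem energyDensity_zero (s : ℝ) : energyDensity s (0 : L2Space d) =ᵐ[volume] 0 := by
  have h : (𝓕 (0 : L2Space d) : L2Space d) = 0 := by
    rw [← norm_eq_zero, Lp.norm_fourier_eq, norm_zero]
  have h2 := Lp.coeFn_zero ℂ 2 (volume : Measure (Space d))
  filter_upwards [h2] with ξ hξ
  rw [energyDensity, h, hξ]
  simp

theorem zero_mem_sobolevSpace (s α : ℝ) : (0 : L2Space d) ∈ sobolevSpace d s α := by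
  have h : (𝓕 (0 : L2Space d) : L2Space d) = 0 := by
    rw [← norm_eq_zero, Lp.norm_fourier_eq, norm_zero]
  have h2 := Lp.coeFn_zero ℂ 2 (volume : Measure (Space d))
  have h3 : sobolevENorm s α (0 : L2Space d) = 0 := by
    rw [sobolevENorm, h]
    rw [← eLpNorm_zero' (ε := ℂ) (p := 2) (μ := (volume : Measure (Space d)))]
    refine eLpNorm_congr_ae ?_
    filter_upwards [h2] with ξ hξ
    rw [hξ]
    simp
  change sobolevENorm s α (0 : L2Space d) < ∞
  rw [h3]
  exact ENNReal.zero_lt_top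

theorem nullFormENorm_zero (hd : 2 ≤ d) {s : ℝ} (hs : 0 < s) (β : ℝ) :
    nullFormENorm s β (0 : L2Space d) = 0 := by
  have h := nullFormENorm_sq_le_lintegral hd hs β (zero_mem_sobolevSpace (d := d) s (1 / 2))
  have h0 : ∫⁻ p : Space d × Space d, ENNReal.ofReal
      (energyDensity s (0 : L2Space d) p.1 * energyDensity s (0 : L2Space d) p.2 *
        nullKernel s β (pairMap (s / (2 * Real.pi)) p)) = 0 := by
    rw [lintegral_congr_ae (g := fun _ => 0) ?_, lintegral_zero]
    have h1 := Measure.quasiMeasurePreserving_fst (μ := (volume : Measure (Space d)))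
      (ν := (volume : Measure (Space d))) |>.ae_eq_comp (energyDensity_zero s)
    filter_upwards [h1] with p hp
    simp only [Function.comp_apply, Pi.zero_apply] at hp
    rw [hp]
    simp
  rw [h0] at h
  simpa using h

/-- The diagonal is null, so the kernel inequality is strict almost everywhere. Equal integrals
would force e(ξ)e(η) = 0 almost everywhere, hence ∫ e = 0 and f = 0. -/
theorem nullFormENorm_sq_lt (hd : 2 ≤ d) {s : ℝ} (hs : 0 < s) {β : ℝ} {f : L2Space d}
    (hf : f ∈ sobolevSpace d s (1 / 2)) (hf0 : f ≠ 0) {b : Space d × Space d → ℝ}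
    (hb : ∀ p : Space d × Space d, p.1 ≠ p.2 → nullKernel s β (pairMap (s / (2 * Real.pi)) p) < b p)
    (hi : Integrable fun p : Space d × Space d =>
      energyDensity s f p.1 * energyDensity s f p.2 * b p) :
    nullFormENorm s β f ^ 2 < ENNReal.ofReal
      (∫ p : Space d × Space d, energyDensity s f p.1 * energyDensity s f p.2 * b p) := by
  have he := energyDensity_nonneg s f
  have hκi : Integrable fun p : Space d × Space d => energyDensity s f p.1 * energyDensity s f p.2 *
      nullKernel s β (pairMap (s / (2 * Real.pi)) p) := by
    refine hi.mono' (aemeasurable_energyDensity_mul (measurable_nullKernel s β)) ?_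
    filter_upwards [ae_fst_ne_snd hd] with p hp
    rw [Real.norm_of_nonneg (mul_nonneg (mul_nonneg (he _) (he _)) (nullKernel_nonneg s β _))]
    exact mul_le_mul_of_nonneg_left (hb p hp).le (mul_nonneg (he _) (he _))
  refine (nullFormENorm_sq_le_lintegral hd hs β hf).trans_lt ?_
  rw [← ofReal_integral_eq_lintegral_ofReal hκi (Eventually.of_forall fun p =>
    mul_nonneg (mul_nonneg (he _) (he _)) (nullKernel_nonneg s β _))]
  have hle : ∀ᵐ p : Space d × Space d, 0 ≤ energyDensity s f p.1 * energyDensity s f p.2 * b p -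
      energyDensity s f p.1 * energyDensity s f p.2 *
        nullKernel s β (pairMap (s / (2 * Real.pi)) p) := by
    filter_upwards [ae_fst_ne_snd hd] with p hp
    rw [← mul_sub]
    exact mul_nonneg (mul_nonneg (he _) (he _)) (sub_nonneg.2 (hb p hp).le)
  have hstrict : ∫ p : Space d × Space d, energyDensity s f p.1 * energyDensity s f p.2 *
      nullKernel s β (pairMap (s / (2 * Real.pi)) p) <
      ∫ p : Space d × Space d, energyDensity s f p.1 * energyDensity s f p.2 * b p := by
    rw [← sub_pos, ← integral_sub hi hκi]
    refine lt_of_le_of_ne (integral_nonneg_of_ae hle) fun h0 => hf0 ?_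
    rw [eq_comm, integral_eq_zero_iff_of_nonneg_ae hle (hi.sub hκi)] at h0
    have h1 : ∫ p : Space d × Space d, energyDensity s f p.1 * energyDensity s f p.2 = 0 := by
      refine integral_eq_zero_of_ae ?_
      filter_upwards [h0, ae_fst_ne_snd hd] with p hp hp'
      simp only [Pi.zero_apply] at hp ⊢
      rw [← mul_sub, mul_eq_zero, or_iff_left (sub_pos.2 (hb p hp')).ne'] at hp
      exact hp
    rw [integral_energyDensity_mul, sq_eq_zero_iff] at h1
    exact eq_zero_of_integral_energyDensity hs hf h1
  refine (ENNReal.ofReal_lt_ofReal_iff_of_nonneg ?_).2 hstrict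
  exact integral_nonneg fun p => mul_nonneg (mul_nonneg (he _) (he _)) (nullKernel_nonneg s β _)

/-- Since E ≥ σ pointwise. This keeps the radicand of the refined norm nonnegative. -/
theorem energy_integral_le {s : ℝ} (hs : 0 < s) {f : L2Space d} (hf : f ∈ sobolevSpace d s 1) :
    s / (2 * Real.pi) * ∫ ξ, energyDensity s f ξ ≤
      ∫ ξ, energy (s / (2 * Real.pi)) ξ * energyDensity s f ξ := by
  rw [← integral_const_mul]
  refine integral_mono ((integrable_energyDensity hs (sobolevSpace_one_subset hs hf)).const_mul _)
    (integrable_energy_mul_energyDensity hs hf) fun ξ => ?_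
  exact mul_le_mul_of_nonneg_right (le_energy _ ξ) (energyDensity_nonneg s f ξ)

theorem refinedNorm_sq {s : ℝ} (hs : 0 < s) {f : L2Space d} (hf : f ∈ sobolevSpace d s 1) :
    refinedNorm s f ^ 2 = (2 * Real.pi) ^ 4 *
      ((∫ ξ, energy (s / (2 * Real.pi)) ξ * energyDensity s f ξ) ^ 2 -
        (s / (2 * Real.pi)) ^ 2 * (∫ ξ, energyDensity s f ξ) ^ 2) := by
  have hpi := Real.pi_pos
  have h0 : 0 ≤ ∫ ξ, energyDensity s f ξ := integral_nonneg (energyDensity_nonneg s f)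
  have h1 := energy_integral_le hs hf
  have h2 : sobolevNorm s 1 f ^ 4 - s ^ 2 * sobolevNorm s (1 / 2) f ^ 4 = (2 * Real.pi) ^ 4 *
      ((∫ ξ, energy (s / (2 * Real.pi)) ξ * energyDensity s f ξ) ^ 2 -
        (s / (2 * Real.pi)) ^ 2 * (∫ ξ, energyDensity s f ξ) ^ 2) := by
    rw [show sobolevNorm s 1 f ^ 4 = (sobolevNorm s 1 f ^ 2) ^ 2 by ring,
      show sobolevNorm s (1 / 2) f ^ 4 = (sobolevNorm s (1 / 2) f ^ 2) ^ 2 by ring,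
      sobolevNorm_one_sq hs, sobolevNorm_half_sq hs]
    field_simp
  rw [refinedNorm, h2, Real.sq_sqrt]
  refine mul_nonneg (by positivity) (sub_nonneg.2 ?_)
  rw [← mul_pow]
  gcongr

end UpperBound

/-! ### The four kernels and the five strict estimates -/

section KernelBounds

variable {d : ℕ}

/-- The squared relative mass `M - 4σ²` of a pair of frequencies, where `M` is the squared mass. -/
noncomputable def excess (σ : ℝ) (p : Space d × Space d) : ℝ :=
  massSq (pairMap σ p) - 4 * σ ^ 2

theorem excess_pos {σ : ℝ} (hσ : 0 < σ) {p : Space d × Space d} (hp : p.1 ≠ p.2) :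
    0 < excess σ p := sub_pos.2 (lt_massSq_pairMap hσ hp)

theorem excess_nonneg {σ : ℝ} (hσ : 0 < σ) (p : Space d × Space d) : 0 ≤ excess σ p :=
  sub_nonneg.2 (le_massSq_pairMap hσ p)

/-- The exponent of M - 4σ² is 1/2, so the kernel is a constant times √(1 - 4σ²/M): it increases
with the mass, and its supremum is approached only as M → ∞. -/
theorem nullKernel_wave_half (hd : 2 ≤ d) {s : ℝ} (hs : 0 < s) {p : Space d × Space d}
    (hp : p.1 ≠ p.2) :
    nullKernel s ((3 - (d : ℝ)) / 4) (pairMap (s / (2 * Real.pi)) p) =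
      kernelConst d ((3 - (d : ℝ)) / 4) * Real.sqrt (excess (s / (2 * Real.pi)) p /
        massSq (pairMap (s / (2 * Real.pi)) p)) := by
  have hpi := Real.pi_pos
  rw [nullKernel_pairMap hd hs _ hp, Real.sqrt_div (excess_nonneg (by positivity) p), mul_div_assoc,
    show ((d : ℝ) - 2) / 2 + 2 * ((3 - d) / 4) = 1 / 2 by ring, ← Real.sqrt_eq_rpow]
  rfl

theorem nullKernel_wave_one (hd : 2 ≤ d) {s : ℝ} (hs : 0 < s) {p : Space d × Space d}
    (hp : p.1 ≠ p.2) :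
    nullKernel s ((5 - (d : ℝ)) / 4) (pairMap (s / (2 * Real.pi)) p) =
      kernelConst d ((5 - (d : ℝ)) / 4) * (excess (s / (2 * Real.pi)) p *
        Real.sqrt (excess (s / (2 * Real.pi)) p / massSq (pairMap (s / (2 * Real.pi)) p))) := by
  have hpi := Real.pi_pos
  have hx := excess_pos (σ := s / (2 * Real.pi)) (by positivity) hp
  rw [nullKernel_pairMap hd hs _ hp, Real.sqrt_div hx.le, mul_div_assoc,
    show ((d : ℝ) - 2) / 2 + 2 * ((5 - d) / 4) = 1 + 1 / 2 by ring]
  change _ * (excess (s / (2 * Real.pi)) p ^ _ / _) = _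
  rw [Real.rpow_add hx, Real.rpow_one, ← Real.sqrt_eq_rpow, mul_div_assoc]

/-- The power of M - 4σ² cancels completely. The kernel decreases with the mass, and its supremum is
approached at the threshold M = 4σ². -/
theorem nullKernel_nonwave_half (hd : 2 ≤ d) {s : ℝ} (hs : 0 < s) {p : Space d × Space d}
    (hp : p.1 ≠ p.2) :
    nullKernel s ((2 - (d : ℝ)) / 4) (pairMap (s / (2 * Real.pi)) p) =
      kernelConst d ((2 - (d : ℝ)) / 4) *
        (1 / Real.sqrt (massSq (pairMap (s / (2 * Real.pi)) p))) := by
  rw [nullKernel_pairMap hd hs _ hp, mul_div_assoc,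
    show ((d : ℝ) - 2) / 2 + 2 * ((2 - d) / 4) = 0 by ring, Real.rpow_zero]

theorem nullKernel_nonwave_one (hd : 2 ≤ d) {s : ℝ} (hs : 0 < s) {p : Space d × Space d}
    (hp : p.1 ≠ p.2) :
    nullKernel s ((4 - (d : ℝ)) / 4) (pairMap (s / (2 * Real.pi)) p) =
      kernelConst d ((4 - (d : ℝ)) / 4) * (excess (s / (2 * Real.pi)) p /
        Real.sqrt (massSq (pairMap (s / (2 * Real.pi)) p))) := by
  rw [nullKernel_pairMap hd hs _ hp, mul_div_assoc,
    show ((d : ℝ) - 2) / 2 + 2 * ((4 - d) / 4) = 1 by ring, Real.rpow_one]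
  rfl

theorem sqrt_excess_div_lt_one {σ : ℝ} (hσ : 0 < σ) (p : Space d × Space d) :
    Real.sqrt (excess σ p / massSq (pairMap σ p)) < 1 := by
  have h := le_massSq_pairMap hσ p
  have hσ2 : 0 < σ ^ 2 := by positivity
  rw [Real.sqrt_lt' one_pos, one_pow, div_lt_one (by linarith), excess]
  linarith

theorem two_mul_lt_sqrt_massSq {σ : ℝ} (hσ : 0 < σ) {p : Space d × Space d} (hp : p.1 ≠ p.2) :
    2 * σ < Real.sqrt (massSq (pairMap σ p)) := by
  refine Real.lt_sqrt_of_sq_lt ?_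
  rw [mul_pow]
  linarith [lt_massSq_pairMap hσ hp]

theorem nullFormENorm_sq_lt_wave_half (hd : 2 ≤ d) {s : ℝ} (hs : 0 < s) {f : L2Space d}
    (hf : f ∈ sobolevSpace d s (1 / 2)) (hf0 : f ≠ 0) :
    nullFormENorm s ((3 - (d : ℝ)) / 4) f ^ 2 < ENNReal.ofReal
      (waveConst ((3 - (d : ℝ)) / 4) d * (sobolevNorm s (1 / 2) f ^ 2) ^ 2) := by
  have hpi := Real.pi_pos
  have hσ : 0 < s / (2 * Real.pi) := by positivity
  have h := nullFormENorm_sq_lt hd hs (β := (3 - (d : ℝ)) / 4) hf hf0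
    (b := fun _ => kernelConst d ((3 - (d : ℝ)) / 4)) (fun p hp => by
      rw [nullKernel_wave_half hd hs hp]
      exact mul_lt_of_lt_one_right (kernelConst_pos hd _) (sqrt_excess_div_lt_one hσ p))
    ((integrable_energyDensity_mul hs hf).mul_const _)
  rw [integral_mul_const, integral_energyDensity_mul, kernelConst_wave_half hd] at h
  rw [sobolevNorm_half_sq hs]
  convert h using 2
  ring

theorem nullFormENorm_sq_lt_nonwave_half (hd : 2 ≤ d) {s : ℝ} (hs : 0 < s) {f : L2Space d}
    (hf : f ∈ sobolevSpace d s (1 / 2)) (hf0 : f ≠ 0) :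
    nullFormENorm s ((2 - (d : ℝ)) / 4) f ^ 2 < ENNReal.ofReal
      ((2 : ℝ) ^ (1 - (d : ℝ)) * Real.pi ^ ((1 - (d : ℝ)) / 2) *
          (Real.Gamma (((d : ℝ) - 1) / 2) / Real.Gamma ((d : ℝ) - 1)) * s⁻¹ *
        (sobolevNorm s (1 / 2) f ^ 2) ^ 2) := by
  have hpi := Real.pi_pos
  have hσ : 0 < s / (2 * Real.pi) := by positivity
  have h := nullFormENorm_sq_lt hd hs (β := (2 - (d : ℝ)) / 4) hf hf0
    (b := fun _ => kernelConst d ((2 - (d : ℝ)) / 4) / (2 * (s / (2 * Real.pi)))) (fun p hp => by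
      rw [nullKernel_nonwave_half hd hs hp, mul_one_div]
      exact div_lt_div_of_pos_left (kernelConst_pos hd _) (by positivity)
        (two_mul_lt_sqrt_massSq hσ hp))
    ((integrable_energyDensity_mul hs hf).mul_const _)
  rw [integral_mul_const, integral_energyDensity_mul, kernelConst_nonwave_half hd hs] at h
  rw [sobolevNorm_half_sq hs]
  convert h using 2
  ring

theorem integrable_excess_mul {s : ℝ} (hs : 0 < s) {f : L2Space d} (hf : f ∈ sobolevSpace d s 1) :
    Integrable (fun p : Space d × Space d => energyDensity s f p.1 * energyDensity s f p.2 *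
      excess (s / (2 * Real.pi)) p) := (integrable_massSq_mul hs hf).1

/-- The only loss is the square of the total momentum, which vanishes for even densities. -/
theorem integral_excess_mul_le {s : ℝ} (hs : 0 < s) {f : L2Space d} (hf : f ∈ sobolevSpace d s 1) :
    (2 * Real.pi) ^ 4 * ∫ p : Space d × Space d, energyDensity s f p.1 * energyDensity s f p.2 *
      excess (s / (2 * Real.pi)) p ≤ 2 * refinedNorm s f ^ 2 := by
  have hpi := Real.pi_pos
  rw [refinedNorm_sq hs hf, mul_left_comm]
  refine mul_le_mul_of_nonneg_left ((integrable_massSq_mul hs hf).2.trans_le ?_) (by positivity)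
  have := sq_nonneg ‖∫ ξ, energyDensity s f ξ • ξ‖
  linarith

theorem nullFormENorm_sq_lt_excess (hd : 2 ≤ d) {s : ℝ} (hs : 0 < s) {β c : ℝ} (hc : 0 < c)
    (hb : ∀ p : Space d × Space d, p.1 ≠ p.2 → nullKernel s β (pairMap (s / (2 * Real.pi)) p) <
      c * (2 * Real.pi) ^ 4 / 2 * excess (s / (2 * Real.pi)) p)
    {f : L2Space d} (hf : f ∈ sobolevSpace d s 1) (hf0 : f ≠ 0) :
    nullFormENorm s β f ^ 2 < ENNReal.ofReal (c * refinedNorm s f ^ 2) := by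
  have h1 : ∀ p : Space d × Space d, energyDensity s f p.1 * energyDensity s f p.2 *
      (c * (2 * Real.pi) ^ 4 / 2 * excess (s / (2 * Real.pi)) p) = c * (2 * Real.pi) ^ 4 / 2 *
      (energyDensity s f p.1 * energyDensity s f p.2 * excess (s / (2 * Real.pi)) p) :=
    fun p => by ring
  have h := nullFormENorm_sq_lt hd hs (sobolevSpace_one_subset hs hf) hf0 hb (by
    simp only [h1]
    exact (integrable_excess_mul hs hf).const_mul _)
  simp only [h1] at h
  refine h.trans_le (ENNReal.ofReal_le_ofReal ?_)
  rw [integral_const_mul]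
  have := mul_le_mul_of_nonneg_left (integral_excess_mul_le hs hf) hc.le
  linarith

theorem waveConst_one_pos (hd : 2 ≤ d) : 0 < waveConst ((5 - (d : ℝ)) / 4) d := by
  have hpi := Real.pi_pos
  have h := kernelConst_wave_one hd
  have h1 := kernelConst_pos hd ((5 - (d : ℝ)) / 4)
  refine pos_of_mul_pos_left (b := (2 * Real.pi) ^ 4) ?_ (by positivity)
  rw [← h]
  positivity

theorem nullFormENorm_sq_lt_wave_refined (hd : 2 ≤ d) {s : ℝ} (hs : 0 < s) {f : L2Space d}
    (hf : f ∈ sobolevSpace d s 1) (hf0 : f ≠ 0) :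
    nullFormENorm s ((5 - (d : ℝ)) / 4) f ^ 2 < ENNReal.ofReal
      (waveConst ((5 - (d : ℝ)) / 4) d * refinedNorm s f ^ 2) := by
  have hpi := Real.pi_pos
  have hσ : 0 < s / (2 * Real.pi) := by positivity
  refine nullFormENorm_sq_lt_excess hd hs (waveConst_one_pos hd) (fun p hp => ?_) hf hf0
  rw [← kernelConst_wave_one hd, mul_div_cancel_left₀ _ two_ne_zero, nullKernel_wave_one hd hs hp]
  exact mul_lt_mul_of_pos_left (mul_lt_of_lt_one_right (excess_pos hσ hp)
    (sqrt_excess_div_lt_one hσ p)) (kernelConst_pos hd _)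

theorem refinedNorm_sq_le {s : ℝ} (hs : 0 < s) {f : L2Space d} (hf : f ∈ sobolevSpace d s 1) :
    refinedNorm s f ^ 2 ≤ (sobolevNorm s 1 f ^ 2) ^ 2 := by
  rw [refinedNorm_sq hs hf, sobolevNorm_one_sq hs, mul_pow ((2 * Real.pi) ^ 2), ← pow_mul]
  refine mul_le_mul_of_nonneg_left (sub_le_self _ ?_) (by positivity)
  positivity

theorem nullFormENorm_sq_lt_wave_one (hd : 2 ≤ d) {s : ℝ} (hs : 0 < s) {f : L2Space d}
    (hf : f ∈ sobolevSpace d s 1) (hf0 : f ≠ 0) :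
    nullFormENorm s ((5 - (d : ℝ)) / 4) f ^ 2 < ENNReal.ofReal
      (waveConst ((5 - (d : ℝ)) / 4) d * (sobolevNorm s 1 f ^ 2) ^ 2) :=
  (nullFormENorm_sq_lt_wave_refined hd hs hf hf0).trans_le (ENNReal.ofReal_le_ofReal
    (mul_le_mul_of_nonneg_left (refinedNorm_sq_le hs hf) (waveConst_one_pos hd).le))

theorem nonwaveConst_pos (hd : 2 ≤ d) {s : ℝ} (hs : 0 < s) (b : ℝ) :
    0 < (2 : ℝ) ^ b * Real.pi ^ ((1 - (d : ℝ)) / 2) *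
      (Real.Gamma (((d : ℝ) - 1) / 2) / Real.Gamma ((d : ℝ) - 1)) * s⁻¹ := by
  have hpi := Real.pi_pos
  have hd' : (0 : ℝ) < d - 1 := by
    have : (2 : ℝ) ≤ d := by exact_mod_cast hd
    linarith
  have h1 := Real.Gamma_pos_of_pos hd'
  have h2 := Real.Gamma_pos_of_pos (half_pos hd')
  positivity

theorem nullFormENorm_sq_lt_nonwave_refined (hd : 2 ≤ d) {s : ℝ} (hs : 0 < s) {f : L2Space d}
    (hf : f ∈ sobolevSpace d s 1) (hf0 : f ≠ 0) :
    nullFormENorm s ((4 - (d : ℝ)) / 4) f ^ 2 < ENNReal.ofReal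
      ((2 : ℝ) ^ (2 - (d : ℝ)) * Real.pi ^ ((1 - (d : ℝ)) / 2) *
          (Real.Gamma (((d : ℝ) - 1) / 2) / Real.Gamma ((d : ℝ) - 1)) * s⁻¹ *
        refinedNorm s f ^ 2) := by
  have hpi := Real.pi_pos
  have hσ : 0 < s / (2 * Real.pi) := by positivity
  refine nullFormENorm_sq_lt_excess hd hs (nonwaveConst_pos hd hs _) (fun p hp => ?_) hf hf0
  rw [← kernelConst_nonwave_one hd hs, mul_div_cancel_left₀ _ two_ne_zero,
    nullKernel_nonwave_one hd hs hp, div_mul_eq_mul_div, ← mul_div_assoc]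
  exact div_lt_div_of_pos_left (mul_pos (kernelConst_pos hd _) (excess_pos hσ hp)) (by positivity)
    (two_mul_lt_sqrt_massSq hσ hp)

end KernelBounds

/-! ### The profiles e^{-aE}/E -/

section ExponentialProfile

variable {d : ℕ}

/-- The density `e^{-2aE(ξ)} / E(ξ)` of the profile `e^{-aE(ξ)} / E(ξ)`. -/
noncomputable def expDensity (σ a : ℝ) (ξ : Space d) : ℝ :=
  Real.exp (-2 * a * energy σ ξ) / energy σ ξ

theorem expDensity_pos {σ : ℝ} (hσ : 0 < σ) (a : ℝ) (ξ : Space d) : 0 < expDensity σ a ξ :=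
  div_pos (Real.exp_pos _) (energy_pos hσ ξ)

theorem energy_mul_expDensity {σ : ℝ} (hσ : 0 < σ) (a : ℝ) (ξ : Space d) :
    energy σ ξ * expDensity σ a ξ = Real.exp (-2 * a * energy σ ξ) :=
  mul_div_cancel₀ _ (energy_pos hσ ξ).ne'

theorem continuous_expDensity {σ : ℝ} (hσ : 0 < σ) (a : ℝ) :
    Continuous (expDensity σ a : Space d → ℝ) := by
  have h := continuous_energy (V := Space d) σ
  exact (by fun_prop : Continuous fun ξ : Space d => Real.exp (-2 * a * energy σ ξ)).div h
    fun ξ => (energy_pos hσ ξ).ne'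

/-- As E exceeds |ξ|, the exponential is at most e^c e^{-c(1+|ξ|)}, and one term of the exponential
series bounds this by a multiple of (1 + |ξ|)^{-(d+1)}. -/
theorem integrable_exp_energy {σ : ℝ} (hσ : 0 < σ) {c : ℝ} (hc : 0 < c) :
    Integrable fun ξ : Space d => Real.exp (-c * energy σ ξ) := by
  have hE := continuous_energy (V := Space d) σ
  have h1 := integrable_one_add_norm (E := Space d) (μ := volume) (r := (d + 1 : ℕ))
    (by rw [finrank_euclideanSpace_fin]; push_cast; linarith)
  refine (h1.const_mul (Real.exp c * (d + 1).factorial / c ^ (d + 1))).mono'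
    (by fun_prop : Continuous fun ξ : Space d => Real.exp (-c * energy σ ξ)).aestronglyMeasurable
    (Eventually.of_forall fun ξ => ?_)
  rw [Real.norm_of_nonneg (Real.exp_pos _).le]
  have hn : 0 < 1 + ‖ξ‖ := by positivity
  have h2 := Real.pow_div_factorial_le_exp (c * (1 + ‖ξ‖)) (by positivity) (d + 1)
  have h3 := norm_lt_energy hσ ξ
  have h4 : Real.exp (-c * energy σ ξ) ≤ Real.exp c * (Real.exp (c * (1 + ‖ξ‖)))⁻¹ := by
    rw [← Real.exp_neg, ← Real.exp_add]
    exact Real.exp_le_exp.2 (by nlinarith)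
  refine h4.trans ?_
  rw [Real.rpow_neg hn.le, Real.rpow_natCast, mul_div_assoc, mul_assoc]
  refine mul_le_mul_of_nonneg_left ?_ (Real.exp_pos _).le
  rw [← inv_div, ← mul_inv]
  refine inv_anti₀ (by positivity) ?_
  rwa [mul_pow, mul_div_right_comm] at h2

theorem integrable_expDensity {σ : ℝ} (hσ : 0 < σ) {a : ℝ} (ha : 0 < a) :
    Integrable (expDensity σ a : Space d → ℝ) := by
  refine ((integrable_exp_energy hσ (c := 2 * a) (by positivity)).mul_const σ⁻¹).mono'
    (continuous_expDensity hσ a).aestronglyMeasurable (Eventually.of_forall fun ξ => ?_)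
  rw [Real.norm_of_nonneg (expDensity_pos hσ a ξ).le, expDensity, div_eq_mul_inv, neg_mul]
  exact mul_le_mul_of_nonneg_left (inv_anti₀ hσ (le_energy σ ξ)) (Real.exp_pos _).le

/-- `f` has the Fourier transform `e^{-aE} / E`. -/
def IsExpProfile (s a : ℝ) (f : L2Space d) : Prop :=
  (𝓕 f : L2Space d) =ᵐ[volume] fun ξ : Space d =>
    ((Real.exp (-a * energy (s / (2 * Real.pi)) ξ) / energy (s / (2 * Real.pi)) ξ : ℝ) : ℂ)

theorem exists_isExpProfile (d : ℕ) {s : ℝ} (hs : 0 < s) {a : ℝ} (ha : 0 < a) :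
    ∃ f : L2Space d, IsExpProfile s a f := by
  have hpi := Real.pi_pos
  have hσ : 0 < s / (2 * Real.pi) := by positivity
  have hE := continuous_energy (V := Space d) (s / (2 * Real.pi))
  have hc : Continuous fun ξ : Space d => ((Real.exp (-a * energy (s / (2 * Real.pi)) ξ) /
      energy (s / (2 * Real.pi)) ξ : ℝ) : ℂ) :=
    Complex.continuous_ofReal.comp ((by fun_prop : Continuous fun ξ : Space d =>
      Real.exp (-a * energy (s / (2 * Real.pi)) ξ)).div hE fun ξ => (energy_pos hσ ξ).ne')
  have hu : MemLp (fun ξ : Space d => ((Real.exp (-a * energy (s / (2 * Real.pi)) ξ) /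
      energy (s / (2 * Real.pi)) ξ : ℝ) : ℂ)) 2 := by
    rw [memLp_two_iff_integrable_sq_norm hc.aestronglyMeasurable]
    refine ((integrable_expDensity hσ ha).mul_const (s / (2 * Real.pi))⁻¹).mono'
      (hc.norm.pow 2).aestronglyMeasurable (Eventually.of_forall fun ξ => ?_)
    have hpos := energy_pos hσ ξ
    rw [Complex.norm_real, Real.norm_of_nonneg (by positivity), Real.norm_of_nonneg (by positivity),
      div_pow, ← Real.exp_nat_mul, sq (energy _ ξ), ← div_div, div_eq_mul_inv _ (energy _ ξ)]
    rw [← div_eq_mul_inv, expDensity]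
    push_cast
    rw [show 2 * (-a * energy (s / (2 * Real.pi)) ξ) = -2 * a * energy (s / (2 * Real.pi)) ξ by ring,
      div_eq_mul_inv _ (energy _ ξ)]
    exact mul_le_mul_of_nonneg_left (inv_anti₀ hσ (le_energy _ ξ)) (by positivity)
  refine ⟨𝓕⁻ hu.toLp, ?_⟩
  rw [IsExpProfile, FourierTransform.fourier_fourierInv_eq]
  exact hu.coeFn_toLp

theorem energyDensity_expProfile {s : ℝ} (hs : 0 < s) {a : ℝ} {f : L2Space d}
    (hf : IsExpProfile s a f) :
    energyDensity s f =ᵐ[volume] expDensity (s / (2 * Real.pi)) a := by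
  have hpi := Real.pi_pos
  have hσ : 0 < s / (2 * Real.pi) := by positivity
  filter_upwards [hf] with ξ hξ
  have hpos := energy_pos hσ ξ
  rw [energyDensity, hξ, Complex.norm_real, Real.norm_of_nonneg (by positivity), div_pow,
    ← Real.exp_nat_mul, expDensity]
  push_cast
  rw [show 2 * (-a * energy (s / (2 * Real.pi)) ξ) = -2 * a * energy (s / (2 * Real.pi)) ξ by ring]
  field_simp

theorem expProfile_mem {s : ℝ} (hs : 0 < s) {a : ℝ} {f : L2Space d}
    (hf : IsExpProfile s a f) (ha : 0 < a) : f ∈ sobolevSpace d s 1 := by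
  have hpi := Real.pi_pos
  have hσ : 0 < s / (2 * Real.pi) := by positivity
  have h : sobolevENorm s 1 f ^ 2 < ∞ := by
    have hi := ((integrable_exp_energy (d := d) hσ (c := 2 * a) (by positivity)).const_mul
      ((2 * Real.pi) ^ 2)).2
    rw [hasFiniteIntegral_iff_ofReal (Eventually.of_forall fun ξ => by positivity)] at hi
    rw [sobolevENorm_sq hs]
    refine (lintegral_congr_ae ?_).trans_lt hi
    filter_upwards [energyDensity_expProfile hs hf] with ξ hξ
    have h2 := energy_mul_expDensity hσ a ξ
    rw [← hξ, energyDensity] at h2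
    rw [mul_one, Real.rpow_two, show -(2 * a) = -2 * a by ring, ← h2]
    congr 1
    ring
  change sobolevENorm s 1 f < ∞
  by_contra hcon
  rw [not_lt, top_le_iff] at hcon
  rw [hcon] at h
  simp at h

theorem integral_energyDensity_expProfile {s : ℝ} (hs : 0 < s) {a : ℝ} {f : L2Space d}
    (hf : IsExpProfile s a f) :
    ∫ ξ, energyDensity s f ξ = ∫ ξ : Space d, expDensity (s / (2 * Real.pi)) a ξ :=
  integral_congr_ae (energyDensity_expProfile hs hf)

theorem integral_energy_mul_expProfile {s : ℝ} (hs : 0 < s) {a : ℝ} {f : L2Space d}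
    (hf : IsExpProfile s a f) :
    ∫ ξ, energy (s / (2 * Real.pi)) ξ * energyDensity s f ξ =
      ∫ ξ : Space d, Real.exp (-2 * a * energy (s / (2 * Real.pi)) ξ) := by
  have hpi := Real.pi_pos
  have hσ : 0 < s / (2 * Real.pi) := by positivity
  refine integral_congr_ae ?_
  filter_upwards [energyDensity_expProfile hs hf] with ξ hξ
  rw [hξ, energy_mul_expDensity hσ]

theorem integral_energyDensity_smul_expProfile {s : ℝ} (hs : 0 < s) {a : ℝ} {f : L2Space d}
    (hf : IsExpProfile s a f) : ∫ ξ, energyDensity s f ξ • ξ = 0 := by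
  have h1 : ∫ ξ, energyDensity s f ξ • ξ = ∫ ξ : Space d, expDensity (s / (2 * Real.pi)) a ξ • ξ := by
    refine integral_congr_ae ?_
    filter_upwards [energyDensity_expProfile hs hf] with ξ hξ
    rw [hξ]
  have h2 := integral_neg_eq_self
    (fun ξ : Space d => expDensity (s / (2 * Real.pi)) a ξ • ξ) volume
  have h3 : ∀ ξ : Space d, expDensity (s / (2 * Real.pi)) a (-ξ) • (-ξ) =
      -(expDensity (s / (2 * Real.pi)) a ξ • ξ) := by
    intro ξ
    rw [smul_neg, expDensity, expDensity, energy, energy, norm_neg]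
  simp only [h3, integral_neg] at h2
  rw [h1]
  have h4 := add_eq_zero_iff_eq_neg.2 h2.symm
  rw [← two_smul ℝ, smul_eq_zero] at h4
  exact h4.resolve_left two_ne_zero

theorem ae_energyDensity_mul_expProfile {s : ℝ} (hs : 0 < s) {a : ℝ} {f : L2Space d}
    (hf : IsExpProfile s a f) : ∀ᵐ p : Space d × Space d,
    energyDensity s f p.1 * energyDensity s f p.2 =
      expDensity (s / (2 * Real.pi)) a p.1 * expDensity (s / (2 * Real.pi)) a p.2 := by
  have h := energyDensity_expProfile hs hf
  have h1 := Measure.quasiMeasurePreserving_fst (μ := (volume : Measure (Space d)))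
    (ν := (volume : Measure (Space d))) |>.ae_eq_comp h
  have h2 := Measure.quasiMeasurePreserving_snd (μ := (volume : Measure (Space d)))
    (ν := (volume : Measure (Space d))) |>.ae_eq_comp h
  filter_upwards [h1, h2] with p hp1 hp2
  simp only [Function.comp_apply] at hp1 hp2
  rw [hp1, hp2]

/-- The density is even, so the momentum term dropped in the upper bound is zero and the refined
norm appears exactly. -/
theorem integral_excess_mul_expProfile {s : ℝ} (hs : 0 < s) {a : ℝ} {f : L2Space d}
    (hf : IsExpProfile s a f) (ha : 0 < a) :
    ∫ p : Space d × Space d, energyDensity s f p.1 * energyDensity s f p.2 *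
        excess (s / (2 * Real.pi)) p =
      2 * ((∫ ξ, energy (s / (2 * Real.pi)) ξ * energyDensity s f ξ) ^ 2 -
        (s / (2 * Real.pi)) ^ 2 * (∫ ξ, energyDensity s f ξ) ^ 2) := by
  have h := (integrable_massSq_mul hs (expProfile_mem hs hf ha)).2
  rw [integral_energyDensity_smul_expProfile hs hf, norm_zero] at h
  refine h.trans ?_
  ring

/-- Reduces optimality to finding a convenient minorant of the kernel. The minorant may be negative,
so its positive part is compared with the nonnegative kernel. -/
theorem ofReal_integral_le_nullFormENorm_sq {s : ℝ} (hs : 0 < s) {a : ℝ} {f : L2Space d}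
    (hf : IsExpProfile s a f) (hd : 2 ≤ d) {β : ℝ} {k : Space d × Space d → ℝ}
    (hk : ∀ p : Space d × Space d, p.1 ≠ p.2 → k p ≤ nullKernel s β (pairMap (s / (2 * Real.pi)) p))
    (hi : Integrable fun p : Space d × Space d =>
      energyDensity s f p.1 * energyDensity s f p.2 * k p) :
    ENNReal.ofReal (∫ p : Space d × Space d, energyDensity s f p.1 * energyDensity s f p.2 * k p) ≤
      nullFormENorm s β f ^ 2 := by
  refine le_trans ?_ (lintegral_le_nullFormENorm_sq hd hs β a hf)
  have h1 := hi.pos_part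
  refine (ENNReal.ofReal_le_ofReal (integral_mono hi h1 fun p => le_max_left _ _)).trans ?_
  rw [ofReal_integral_eq_lintegral_ofReal h1 (Eventually.of_forall fun p => le_max_right _ _)]
  refine lintegral_mono_ae ?_
  filter_upwards [ae_fst_ne_snd hd] with p hp
  have he := mul_nonneg (energyDensity_nonneg s f p.1) (energyDensity_nonneg s f p.2)
  exact ENNReal.ofReal_le_ofReal (max_le (mul_le_mul_of_nonneg_left (hk p hp) he)
    (mul_nonneg he (nullKernel_nonneg _ _ _)))

end ExponentialProfile

/-! ### Optimality in the wave regime: a → 0 -/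

section WaveOptimality

variable {d : ℕ}

theorem energy_le_add {σ : ℝ} (hσ : 0 < σ) (ξ : Space d) : energy σ ξ ≤ σ + ‖ξ‖ := by
  refine Real.sqrt_le_iff.2 ⟨by positivity, ?_⟩
  nlinarith [norm_nonneg ξ]

/-- With r = n + 1 and a = 1/r, the density is at least a constant over r on the ball of radius r,
whose volume is a constant times r^d ≥ r². The integral thus grows at least linearly in r. -/
theorem tendsto_integral_expDensity (hd : 2 ≤ d) {σ : ℝ} (hσ : 0 < σ) :
    Tendsto (fun n : ℕ => ∫ ξ : Space d, expDensity σ (1 / (n + 1 : ℝ)) ξ) atTop atTop := by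
  have : Nontrivial (Space d) := by
    have : Nonempty (Fin d) := ⟨⟨0, by omega⟩⟩
    infer_instance
  set V := (volume : Measure (Space d)).real (Metric.ball 0 1) with hV
  have hVpos : 0 < V :=
    ENNReal.toReal_pos (Metric.measure_ball_pos volume 0 one_pos).ne' measure_ball_lt_top.ne
  set c := V * (Real.exp (-2 * (σ + 1)) / (σ + 1)) with hc
  have hcpos : 0 < c := by positivity
  refine tendsto_atTop_mono (f := fun n : ℕ => c * (n + 1 : ℝ)) (fun n => ?_)
    ((tendsto_atTop_add_const_right _ 1 tendsto_natCast_atTop_atTop).const_mul_atTop hcpos)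
  set r : ℝ := n + 1 with hr
  have hr1 : 1 ≤ r := by rw [hr]; linarith [(Nat.cast_nonneg n : (0 : ℝ) ≤ n)]
  have hr0 : 0 < r := by linarith
  have hi := integrable_expDensity (d := d) hσ (a := 1 / r) (by positivity)
  have hball : (volume : Measure (Space d)).real (Metric.ball 0 r) = r ^ d * V := by
    rw [hV, Measure.real, Measure.real, Measure.addHaar_ball _ _ hr0.le, ENNReal.toReal_mul,
      ENNReal.toReal_ofReal (by positivity), finrank_euclideanSpace_fin]
  have hlow : ∀ ξ ∈ Metric.ball (0 : Space d) r,
      Real.exp (-2 * (σ + 1)) / ((σ + 1) * r) ≤ expDensity σ (1 / r) ξ := by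
    intro ξ hξ
    rw [mem_ball_zero_iff] at hξ
    have h1 := energy_le_add hσ ξ
    have h2 : energy σ ξ ≤ (σ + 1) * r := by nlinarith
    refine div_le_div₀ (Real.exp_pos _).le (Real.exp_le_exp.2 ?_) (energy_pos hσ ξ) h2
    rw [mul_one_div, div_mul_eq_mul_div, le_div_iff₀ hr0]
    linarith
  calc c * r = r ^ 2 * V * (Real.exp (-2 * (σ + 1)) / ((σ + 1) * r)) := by rw [hc]; field_simp
    _ ≤ r ^ d * V * (Real.exp (-2 * (σ + 1)) / ((σ + 1) * r)) := by
      gcongr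
    _ = ∫ _ in Metric.ball (0 : Space d) r, Real.exp (-2 * (σ + 1)) / ((σ + 1) * r) := by
      rw [setIntegral_const, hball, smul_eq_mul]
    _ ≤ ∫ ξ in Metric.ball (0 : Space d) r, expDensity σ (1 / r) ξ :=
      setIntegral_mono_on (integrableOn_const (C := _) (hs := measure_ball_lt_top.ne)) hi.integrableOn
        measurableSet_ball hlow
    _ ≤ ∫ ξ, expDensity σ (1 / r) ξ :=
      setIntegral_le_integral hi (Eventually.of_forall fun ξ => (expDensity_pos hσ _ ξ).le)

/-- The bounded part of the profiles is negligible: `∫ e^{-2aE} / E ≤ η ∫ e^{-2aE} + O(1)`. -/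
theorem integral_expDensity_le {σ : ℝ} (hσ : 0 < σ) {η : ℝ} (hη : 0 < η) {a : ℝ} (ha : 0 < a) :
    ∫ ξ : Space d, expDensity σ a ξ ≤ η * (∫ ξ : Space d, Real.exp (-2 * a * energy σ ξ)) +
      (volume : Measure (Space d)).real (Metric.ball 0 (1 / η)) * σ⁻¹ := by
  have hi : Integrable fun ξ : Space d => Real.exp (-2 * a * energy σ ξ) := by
    simpa using integrable_exp_energy (d := d) hσ (c := 2 * a) (by positivity)
  have hj : Integrable ((Metric.ball (0 : Space d) (1 / η)).indicator fun _ => σ⁻¹) :=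
    (integrable_indicator_iff measurableSet_ball).2
      (integrableOn_const (C := σ⁻¹) (hs := measure_ball_lt_top.ne))
  have hsum : η * (∫ ξ : Space d, Real.exp (-2 * a * energy σ ξ)) +
      (volume : Measure (Space d)).real (Metric.ball 0 (1 / η)) * σ⁻¹ =
      ∫ ξ : Space d, (η * Real.exp (-2 * a * energy σ ξ) +
        (Metric.ball (0 : Space d) (1 / η)).indicator (fun _ => σ⁻¹) ξ) := by
    rw [integral_add (hi.const_mul η) hj, integral_const_mul, integral_indicator measurableSet_ball,
      setIntegral_const, smul_eq_mul]
  rw [hsum]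
  refine integral_mono (integrable_expDensity hσ ha) ((hi.const_mul η).add hj) fun ξ => ?_
  have hE := energy_pos hσ ξ
  have hexp := Real.exp_pos (-2 * a * energy σ ξ)
  rw [expDensity, div_eq_mul_inv]
  by_cases hξ : ξ ∈ Metric.ball (0 : Space d) (1 / η)
  · simp only [Set.indicator_of_mem hξ]
    have h1 : Real.exp (-2 * a * energy σ ξ) * (energy σ ξ)⁻¹ ≤ 1 * σ⁻¹ := by
      refine mul_le_mul ?_ (inv_anti₀ hσ (le_energy σ ξ)) (by positivity) zero_le_one
      exact Real.exp_le_one_iff.2 (by nlinarith [mul_pos ha hE])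
    have := mul_pos hη hexp
    linarith
  · simp only [Set.indicator_of_notMem hξ, add_zero]
    rw [mem_ball_zero_iff, not_lt, div_le_iff₀ hη] at hξ
    rw [mul_comm η]
    refine mul_le_mul_of_nonneg_left ?_ hexp.le
    rw [inv_le_iff_one_le_mul₀ hE]
    nlinarith [norm_lt_energy hσ ξ]

theorem expDensity_mul_eq (σ a : ℝ) (p : Space d × Space d) :
    expDensity σ a p.1 * expDensity σ a p.2 =
      Real.exp (-2 * a * (pairMap σ p).fst) * (1 / (energy σ p.1 * energy σ p.2)) := by
  rw [expDensity, expDensity, div_mul_div_comm, ← Real.exp_add, ← mul_add, mul_one_div]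
  rfl

/-- A bound of the density of states on the part `M ≤ K` of the fibre over `ζ`. -/
theorem lintegral_fiber_massSq_le (d : ℕ) {σ : ℝ} (hσ : 0 < σ) {K : ℝ} (hK : 4 * σ ^ 2 ≤ K) {a : ℝ}
    (ha : 0 < a) (ζ : Space d) :
    ∫⁻ τ : ℝ, ({z : SpaceTime d | massSq z ≤ K}.indicator
        (fun z => ENNReal.ofReal (Real.exp (-2 * a * z.fst))) (WithLp.toLp 2 (τ, ζ)) *
          ENNReal.ofReal (phaseDensity σ (WithLp.toLp 2 (τ, ζ)))) ≤
      ENNReal.ofReal (sphereArea d * (Real.sqrt (K - 4 * σ ^ 2) / 2) ^ (d - 2) / (2 * σ) * K *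
        expDensity σ a ζ) := by
  have hA : 0 ≤ sphereArea d := measureReal_nonneg
  set A := sphereArea d * (Real.sqrt (K - 4 * σ ^ 2) / 2) ^ (d - 2) / (2 * σ) with hAdef
  have hA0 : 0 ≤ A := by positivity
  have hE := energy_pos hσ ζ
  -- The energies l and u correspond to M = 4σ² and M = K. The interval between them has length at
  -- most K/E(ζ), and the exponential on it is at most e^{-2aE(ζ)}; together these reproduce
  -- `expDensity`.
  set l := Real.sqrt (4 * σ ^ 2 + ‖ζ‖ ^ 2) with hl
  set u := Real.sqrt (K + ‖ζ‖ ^ 2) with hu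
  have hK0 : 0 ≤ K := le_trans (by positivity) hK
  have hl2 : l ^ 2 = 4 * σ ^ 2 + ‖ζ‖ ^ 2 := Real.sq_sqrt (by positivity)
  have hu2 : u ^ 2 = K + ‖ζ‖ ^ 2 := Real.sq_sqrt (by positivity)
  have hlE : energy σ ζ ≤ l := Real.sqrt_le_sqrt (by nlinarith)
  have hu0 : 0 ≤ u := Real.sqrt_nonneg _
  have hul : u - l ≤ K / energy σ ζ := by
    rw [le_div_iff₀ hE]
    have hlu : l ≤ u := Real.sqrt_le_sqrt (by linarith)
    nlinarith [mul_nonneg (sub_nonneg.2 hlu) (sub_nonneg.2 hlE), sq_nonneg σ]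
  calc _ ≤ ∫⁻ τ : ℝ, (Set.Ioc l u).indicator
        (fun _ => ENNReal.ofReal (A * Real.exp (-2 * a * energy σ ζ))) τ := by
        refine lintegral_mono fun τ => ?_
        by_cases hM : massSq (WithLp.toLp 2 (τ, ζ) : SpaceTime d) ≤ K
        swap
        · rw [Set.indicator_of_notMem (by exact hM), zero_mul]
          exact zero_le
        by_cases hz : 0 < τ ∧ 4 * σ ^ 2 < massSq (WithLp.toLp 2 (τ, ζ) : SpaceTime d)
        swap
        · rw [phaseDensity, if_neg (by exact hz), ENNReal.ofReal_zero, mul_zero]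
          exact zero_le
        rw [Set.indicator_of_mem (by exact hM), phaseDensity, if_pos (by exact hz)]
        obtain ⟨hτ, hM2⟩ := hz
        have hMτ : massSq (WithLp.toLp 2 (τ, ζ) : SpaceTime d) = τ ^ 2 - ‖ζ‖ ^ 2 := rfl
        have hlτ : l < τ := (Real.sqrt_lt' hτ).2 (by linarith)
        have hτu : τ ≤ u := Real.le_sqrt_of_sq_le (by linarith)
        rw [Set.indicator_of_mem (by exact ⟨hlτ, hτu⟩), ← ENNReal.ofReal_mul (Real.exp_pos _).le,
          mul_comm A]
        refine ENNReal.ofReal_le_ofReal (mul_le_mul (Real.exp_le_exp.2 ?_) ?_ (by positivity)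
          (Real.exp_pos _).le)
        · change -2 * a * τ ≤ _
          nlinarith [mul_le_mul_of_nonneg_left (hlE.trans hlτ.le) ha.le]
        · rw [hAdef]
          have h2 : 2 * σ ≤ Real.sqrt (massSq (WithLp.toLp 2 (τ, ζ) : SpaceTime d)) := by
            refine Real.le_sqrt_of_sq_le ?_
            rw [mul_pow]
            linarith
          gcongr
    _ = ENNReal.ofReal (A * Real.exp (-2 * a * energy σ ζ)) * ENNReal.ofReal (u - l) := by
        rw [lintegral_indicator measurableSet_Ioc, setLIntegral_const, Real.volume_Ioc]
    _ ≤ _ := by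
        rw [← ENNReal.ofReal_mul (by positivity)]
        refine ENNReal.ofReal_le_ofReal ?_
        refine (mul_le_mul_of_nonneg_left hul (by positivity)).trans_eq ?_
        rw [expDensity]
        ring

/-- The pairs of bounded mass contribute only linearly in ∫ e, against the total (∫ e)². As a → 0
this makes them negligible. -/
theorem setIntegral_expDensity_mul_le (hd : 2 ≤ d) {σ : ℝ} (hσ : 0 < σ) {K : ℝ}
    (hK : 4 * σ ^ 2 ≤ K) {a : ℝ} (ha : 0 < a) :
    ∫ p in {p : Space d × Space d | massSq (pairMap σ p) ≤ K},
        expDensity σ a p.1 * expDensity σ a p.2 ≤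
      sphereArea d * (Real.sqrt (K - 4 * σ ^ 2) / 2) ^ (d - 2) / (2 * σ) * K *
        ∫ ξ : Space d, expDensity σ a ξ := by
  have hA : 0 ≤ sphereArea d := measureReal_nonneg
  have hK0 : 0 ≤ K := le_trans (by positivity) hK
  set A := sphereArea d * (Real.sqrt (K - 4 * σ ^ 2) / 2) ^ (d - 2) / (2 * σ) * K with hAdef
  have hA0 : 0 ≤ A := by positivity
  have hS : MeasurableSet {z : SpaceTime d | massSq z ≤ K} :=
    measurableSet_le (measurable_massSq d) measurable_const
  have hS' : MeasurableSet {p : Space d × Space d | massSq (pairMap σ p) ≤ K} :=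
    (continuous_pairMap σ).measurable hS
  have he := integrable_expDensity (d := d) hσ ha
  have hee : Integrable fun p : Space d × Space d => expDensity σ a p.1 * expDensity σ a p.2 :=
    he.mul_prod he
  have hnn : ∀ p : Space d × Space d, 0 ≤ expDensity σ a p.1 * expDensity σ a p.2 := fun p =>
    mul_nonneg (expDensity_pos hσ a _).le (expDensity_pos hσ a _).le
  have hfst : Continuous fun z : SpaceTime d => z.fst :=
    continuous_fst.comp (WithLp.prod_continuous_ofLp 2 ℝ (Space d))
  have hH : Measurable ({z : SpaceTime d | massSq z ≤ K}.indicator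
      (fun z => ENNReal.ofReal (Real.exp (-2 * a * z.fst)))) :=
    (ENNReal.continuous_ofReal.comp (by fun_prop : Continuous fun z : SpaceTime d =>
      Real.exp (-2 * a * z.fst))).measurable.indicator hS
  have hHJ : Measurable fun z : SpaceTime d => {z : SpaceTime d | massSq z ≤ K}.indicator
      (fun z => ENNReal.ofReal (Real.exp (-2 * a * z.fst))) z *
        ENNReal.ofReal (phaseDensity σ z) := hH.mul (measurable_phaseDensity d σ).ennreal_ofReal
  have hint : 0 ≤ ∫ ξ : Space d, expDensity σ a ξ :=
    integral_nonneg fun ξ => (expDensity_pos hσ a ξ).le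
  rw [← ENNReal.ofReal_le_ofReal_iff (mul_nonneg hA0 hint),
    ofReal_integral_eq_lintegral_ofReal hee.integrableOn (Eventually.of_forall hnn),
    ← integral_const_mul, ofReal_integral_eq_lintegral_ofReal (he.const_mul _)
      (Eventually.of_forall fun ξ => mul_nonneg hA0 (expDensity_pos hσ a ξ).le),
    ← lintegral_indicator hS']
  have h1 : ∀ p : Space d × Space d, {p : Space d × Space d | massSq (pairMap σ p) ≤ K}.indicator
      (fun p => ENNReal.ofReal (expDensity σ a p.1 * expDensity σ a p.2)) p =
      {z : SpaceTime d | massSq z ≤ K}.indicator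
      (fun z => ENNReal.ofReal (Real.exp (-2 * a * z.fst))) (pairMap σ p) *
        ENNReal.ofReal (1 / (energy σ p.1 * energy σ p.2)) := by
    intro p
    by_cases hp : massSq (pairMap σ p) ≤ K
    · rw [Set.indicator_of_mem (by exact hp), Set.indicator_of_mem (by exact hp),
        ← ENNReal.ofReal_mul (Real.exp_pos _).le, expDensity_mul_eq]
    · rw [Set.indicator_of_notMem (by exact hp), Set.indicator_of_notMem (by exact hp), zero_mul]
  simp only [h1]
  rw [lintegral_pairMap hd hσ hH, lintegral_spaceTime hHJ]
  exact lintegral_mono fun ζ => lintegral_fiber_massSq_le d hσ hK ha ζ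

theorem exists_nearly_optimal_wave_half (hd : 2 ≤ d) {s : ℝ} (hs : 0 < s) {ε : ℝ} (hε : 0 < ε)
    (hε1 : ε < 1) : ∃ f ∈ sobolevSpace d s (1 / 2), 0 < sobolevNorm s (1 / 2) f ^ 2 ∧
      ENNReal.ofReal ((1 - ε) * (waveConst ((3 - (d : ℝ)) / 4) d *
        (sobolevNorm s (1 / 2) f ^ 2) ^ 2)) ≤ nullFormENorm s ((3 - (d : ℝ)) / 4) f ^ 2 := by
  have hpi := Real.pi_pos
  have hσ : 0 < s / (2 * Real.pi) := by positivity
  set σ := s / (2 * Real.pi) with hσdef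
  have hA : 0 ≤ sphereArea d := measureReal_nonneg
  set c := kernelConst d ((3 - (d : ℝ)) / 4) with hc
  have hc0 : 0 < c := kernelConst_pos hd _
  set q := 1 - ε / 2 with hq
  have hq0 : 0 < q := by rw [hq]; linarith
  have hq1 : q < 1 := by rw [hq]; linarith
  have hqq : 0 < 1 - q ^ 2 := by nlinarith
  -- K solves (K - 4σ²)/K = q², so for M > K the kernel exceeds q = 1 - ε/2 times its supremum.
  set K := 4 * σ ^ 2 / (1 - q ^ 2) with hK
  have hKq : K * (1 - q ^ 2) = 4 * σ ^ 2 := div_mul_cancel₀ _ hqq.ne'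
  have hK4 : 4 * σ ^ 2 ≤ K := by
    rw [hK, le_div_iff₀ hqq]
    nlinarith [mul_nonneg (sq_nonneg σ) (sq_nonneg q)]
  have hK0 : 0 ≤ K := le_trans (by positivity) hK4
  set A := sphereArea d * (Real.sqrt (K - 4 * σ ^ 2) / 2) ^ (d - 2) / (2 * σ) * K with hAdef
  have hA0 : 0 ≤ A := by positivity
  -- Once ∫ e ≥ 2A/ε, the region M ≤ K costs at most another ε/2 of (∫ e)².
  obtain ⟨n, hn1, hn2⟩ := (((tendsto_integral_expDensity hd hσ).eventually_ge_atTop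
    (2 * A / ε)).and ((tendsto_integral_expDensity hd hσ).eventually_gt_atTop 0)).exists
  set a : ℝ := 1 / (n + 1) with ha
  have ha0 : 0 < a := by positivity
  obtain ⟨f, hf⟩ := exists_isExpProfile d hs ha0
  have hmem := sobolevSpace_one_subset hs (expProfile_mem hs hf ha0)
  have hI := integral_energyDensity_expProfile hs hf
  rw [← hσdef] at hI
  set I := ∫ ξ : Space d, expDensity σ a ξ with hIdef
  have hee := integrable_energyDensity_mul hs hmem
  have hS' : MeasurableSet {p : Space d × Space d | massSq (pairMap σ p) ≤ K} :=
    (continuous_pairMap σ).measurable (measurableSet_le (measurable_massSq d) measurable_const)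
  refine ⟨f, hmem, ?_, ?_⟩
  · rw [sobolevNorm_half_sq hs, hI]
    positivity
  have h1 : ∀ p : Space d × Space d, energyDensity s f p.1 * energyDensity s f p.2 *
      (c * q - {p : Space d × Space d | massSq (pairMap σ p) ≤ K}.indicator
        (fun _ => c * q) p) = c * q * (energyDensity s f p.1 * energyDensity s f p.2) -
      {p : Space d × Space d | massSq (pairMap σ p) ≤ K}.indicator
        (fun p => c * q * (energyDensity s f p.1 * energyDensity s f p.2)) p := by
    intro p
    by_cases hpK : p ∈ {p : Space d × Space d | massSq (pairMap σ p) ≤ K}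
    · simp only [Set.indicator_of_mem hpK]; ring
    · simp only [Set.indicator_of_notMem hpK]; ring
  have hkey := ofReal_integral_le_nullFormENorm_sq hs hf hd (β := (3 - (d : ℝ)) / 4)
    (k := fun p => c * q - {p : Space d × Space d | massSq (pairMap σ p) ≤ K}.indicator
      (fun _ => c * q) p) (fun p hp => by
      by_cases hpK : massSq (pairMap σ p) ≤ K
      · simp only [Set.indicator_of_mem (show p ∈ {p : Space d × Space d |
          massSq (pairMap σ p) ≤ K} from hpK), sub_self]
        exact nullKernel_nonneg _ _ _
      · simp only [Set.indicator_of_notMem (show p ∉ {p : Space d × Space d |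
          massSq (pairMap σ p) ≤ K} from hpK), sub_zero]
        rw [nullKernel_wave_half hd hs hp]
        refine mul_le_mul_of_nonneg_left (Real.le_sqrt_of_sq_le ?_) hc0.le
        rw [not_le] at hpK
        rw [← hσdef, le_div_iff₀ (hK0.trans_lt hpK), excess]
        nlinarith) (by
      simp only [h1]
      exact (hee.const_mul _).sub ((hee.const_mul _).indicator hS'))
  refine le_trans (ENNReal.ofReal_le_ofReal ?_) hkey
  simp only [h1]
  rw [integral_sub (hee.const_mul _) ((hee.const_mul _).indicator hS'), integral_indicator hS',
    integral_const_mul, integral_const_mul, integral_energyDensity_mul, hI]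
  have h2 : ∫ p in {p : Space d × Space d | massSq (pairMap σ p) ≤ K},
      energyDensity s f p.1 * energyDensity s f p.2 ≤ A * I := by
    refine (integral_congr_ae (ae_restrict_of_ae (ae_energyDensity_mul_expProfile hs hf))).trans_le ?_
    exact setIntegral_expDensity_mul_le hd hσ hK4 ha0
  have h3 : waveConst ((3 - (d : ℝ)) / 4) d * (sobolevNorm s (1 / 2) f ^ 2) ^ 2 = c * I ^ 2 := by
    rw [hc, kernelConst_wave_half hd, sobolevNorm_half_sq hs, hI]
    ring
  rw [h3]
  have h4 : A * I ≤ ε / 2 * I ^ 2 := by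
    rw [div_le_iff₀ hε] at hn1
    nlinarith
  have h5 : q * ∫ p in {p : Space d × Space d | massSq (pairMap σ p) ≤ K},
      energyDensity s f p.1 * energyDensity s f p.2 ≤ ε / 2 * I ^ 2 := by
    refine (mul_le_mul_of_nonneg_left (h2.trans h4) hq0.le).trans ?_
    exact mul_le_of_le_one_left (by positivity) hq1.le
  have h6 := mul_le_mul_of_nonneg_left h5 hc0.le
  have h7 : c * q * I ^ 2 = c * I ^ 2 - c * (ε / 2 * I ^ 2) := by rw [hq]; ring
  rw [h7]
  linarith

/-- As `a → 0`, the profiles concentrate at high frequencies. -/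
theorem exists_profile_concentration (hd : 2 ≤ d) {σ : ℝ} (hσ : 0 < σ) {ε : ℝ} (hε : 0 < ε) :
    ∃ a : ℝ, 0 < a ∧ 0 < (∫ ξ : Space d, Real.exp (-2 * a * energy σ ξ)) ∧
      σ ^ 2 * (∫ ξ : Space d, expDensity σ a ξ) ^ 2 ≤
        ε * (∫ ξ : Space d, Real.exp (-2 * a * energy σ ξ)) ^ 2 := by
  set η := Real.sqrt ε / (2 * σ) with hη
  have hη0 : 0 < η := by positivity
  set V := (volume : Measure (Space d)).real (Metric.ball 0 (1 / η)) with hV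
  -- The threshold makes the bounded remainder at most ησ∫e ≤ η∫Ee. Hence ∫e ≤ 2η∫Ee, and 2ησ = √ε.
  obtain ⟨n, hn1, hn2⟩ := (((tendsto_integral_expDensity hd hσ).eventually_ge_atTop
    (V * σ⁻¹ / (η * σ))).and ((tendsto_integral_expDensity hd hσ).eventually_gt_atTop 0)).exists
  set a : ℝ := 1 / (n + 1) with ha
  have ha0 : 0 < a := by positivity
  have h1 := integral_expDensity_le (d := d) hσ hη0 ha0
  have h2 : σ * (∫ ξ : Space d, expDensity σ a ξ) ≤
      ∫ ξ : Space d, Real.exp (-2 * a * energy σ ξ) := by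
    rw [← integral_const_mul]
    refine integral_mono ((integrable_expDensity hσ ha0).const_mul _)
      (by simpa using integrable_exp_energy (d := d) hσ (c := 2 * a) (by positivity)) fun ξ => ?_
    rw [← energy_mul_expDensity hσ]
    exact mul_le_mul_of_nonneg_right (le_energy σ ξ) (expDensity_pos hσ a ξ).le
  set I := ∫ ξ : Space d, expDensity σ a ξ
  set J := ∫ ξ : Space d, Real.exp (-2 * a * energy σ ξ)
  refine ⟨a, ha0, (mul_pos hσ hn2).trans_le h2, ?_⟩
  rw [div_le_iff₀ (by positivity)] at hn1
  have h3 : I ≤ 2 * η * J := by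
    have := mul_le_mul_of_nonneg_left h2 hη0.le
    linarith
  have h4 : σ * I ≤ Real.sqrt ε * J := by
    have h5 := mul_le_mul_of_nonneg_left h3 hσ.le
    have h6 : σ * (2 * η * J) = Real.sqrt ε * J := by rw [hη]; field_simp
    linarith
  rw [← mul_pow, ← Real.sq_sqrt hε.le, ← mul_pow]
  exact pow_le_pow_left₀ (by positivity) h4 2

theorem sub_le_mul_sqrt_div {x c : ℝ} (hx : 0 < x) (hc : 0 ≤ c) :
    x - c ≤ x * Real.sqrt (x / (x + c)) := by
  have hy : x / (x + c) ≤ Real.sqrt (x / (x + c)) := by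
    refine Real.le_sqrt_of_sq_le ?_
    rw [sq]
    refine mul_le_of_le_one_left (by positivity) ?_
    rw [div_le_one (by positivity)]
    linarith
  refine le_trans ?_ (mul_le_mul_of_nonneg_left hy hx.le)
  rw [mul_div_assoc', le_div_iff₀ (by positivity)]
  nlinarith

theorem exists_nearly_optimal_wave_one (hd : 2 ≤ d) {s : ℝ} (hs : 0 < s) {ε : ℝ} (hε : 0 < ε)
    (hε1 : ε < 1) : ∃ f ∈ sobolevSpace d s 1, 0 < refinedNorm s f ∧ 0 < sobolevNorm s 1 f ^ 2 ∧
      ENNReal.ofReal ((1 - ε) * (waveConst ((5 - (d : ℝ)) / 4) d *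
        (sobolevNorm s 1 f ^ 2) ^ 2)) ≤ nullFormENorm s ((5 - (d : ℝ)) / 4) f ^ 2 := by
  have hpi := Real.pi_pos
  have hσ : 0 < s / (2 * Real.pi) := by positivity
  -- The total loss will be 6cσ²(∫e)² against the main term 2c(∫Ee)²: 2c from the refined norm and
  -- 4c from the minorant M - 8σ². Hence ε/3.
  obtain ⟨a, ha, hJ, hIJ⟩ := exists_profile_concentration hd hσ (ε := ε / 3) (by positivity)
  obtain ⟨f, hf⟩ := exists_isExpProfile d hs ha
  have hmem := expProfile_mem hs hf ha
  have hmem' := sobolevSpace_one_subset hs hmem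
  rw [← integral_energyDensity_expProfile hs hf, ← integral_energy_mul_expProfile hs hf] at hIJ
  rw [← integral_energy_mul_expProfile hs hf] at hJ
  have hx := integral_excess_mul_expProfile hs hf ha
  have hxi := integrable_excess_mul hs hmem
  have hN := sobolevNorm_one_sq hs f
  have hR := refinedNorm_sq hs hmem
  set σ := s / (2 * Real.pi) with hσdef
  set I := ∫ ξ, energyDensity s f ξ with hI
  set J := ∫ ξ, energy σ ξ * energyDensity s f ξ with hJdef
  have hee := integrable_energyDensity_mul hs hmem'
  set c := kernelConst d ((5 - (d : ℝ)) / 4) with hc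
  have hc0 : 0 < c := kernelConst_pos hd _
  refine ⟨f, hmem, ?_, ?_, ?_⟩
  · refine lt_of_le_of_ne (Real.sqrt_nonneg _) fun h0 => ?_
    rw [← h0] at hR
    have : 0 < (2 * Real.pi) ^ 4 * (J ^ 2 - σ ^ 2 * I ^ 2) :=
      mul_pos (by positivity) (by nlinarith [sq_pos_of_pos hJ])
    linarith
  · rw [hN]
    positivity
  have hkey := ofReal_integral_le_nullFormENorm_sq hs hf hd (β := (5 - (d : ℝ)) / 4)
    (k := fun p => c * (excess σ p - 4 * σ ^ 2)) (fun p hp => by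
      rw [nullKernel_wave_one hd hs hp]
      refine mul_le_mul_of_nonneg_left ?_ hc0.le
      have h := sub_le_mul_sqrt_div (excess_pos hσ hp) (c := 4 * σ ^ 2) (by positivity)
      rwa [show excess σ p + 4 * σ ^ 2 = massSq (pairMap σ p) by rw [excess]; ring] at h) (by
      refine ((hxi.const_mul c).sub (hee.const_mul (c * (4 * σ ^ 2)))).congr
        (Eventually.of_forall fun p => ?_)
      simp only [Pi.sub_apply]
      ring)
  refine le_trans (ENNReal.ofReal_le_ofReal ?_) hkey
  have h1 : ∀ p : Space d × Space d, energyDensity s f p.1 * energyDensity s f p.2 *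
      (c * (excess σ p - 4 * σ ^ 2)) =
      c * (energyDensity s f p.1 * energyDensity s f p.2 * excess σ p) -
        c * (4 * σ ^ 2) * (energyDensity s f p.1 * energyDensity s f p.2) := fun p => by ring
  simp only [h1]
  rw [integral_sub (hxi.const_mul _) (hee.const_mul _), integral_const_mul, integral_const_mul, hx,
    integral_energyDensity_mul]
  have h3 : waveConst ((5 - (d : ℝ)) / 4) d * (sobolevNorm s 1 f ^ 2) ^ 2 = 2 * c * J ^ 2 := by
    rw [hc, kernelConst_wave_one hd, hN]
    ring
  rw [h3]
  have h4 := mul_le_mul_of_nonneg_left hIJ hc0.le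
  linarith

end WaveOptimality

/-! ### Optimality in the non-wave regime: a → ∞ -/

/-- The measures `e^{-bT} h μ` concentrate near the minimum of `T` as `b → ∞`. -/
theorem exists_exp_concentration {X : Type*} [MeasurableSpace X] {μ : Measure X} {h T : X → ℝ}
    (hh : Integrable h μ) (h0 : ∀ x, 0 ≤ h x) (hT : Measurable T) (hT0 : ∀ x, 0 ≤ T x) {m δ : ℝ}
    (hδ : 0 < δ) (hpos : 0 < ∫ x in {x | T x ≤ m + δ}, h x ∂μ) {η : ℝ} (hη : 0 < η) :
    ∃ b : ℝ, 0 ≤ b ∧ 0 < (∫ x, h x * Real.exp (-b * T x) ∂μ) ∧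
      (1 - η) * (∫ x, h x * Real.exp (-b * T x) ∂μ) ≤
        ∫ x in {x | T x ≤ m + 2 * δ}, h x * Real.exp (-b * T x) ∂μ := by
  set w := ∫ x in {x | T x ≤ m + δ}, h x ∂μ with hw
  set W := ∫ x, h x ∂μ with hW
  -- The total is at least e^{-b(m+δ)} w and the part with T > m + 2δ is at most e^{-b(m+2δ)} W, so
  -- their ratio is controlled by e^{-bδ} W/w.
  have htend : Tendsto (fun b : ℝ => Real.exp (-(b * δ)) * W) atTop (𝓝 (0 * W)) :=
    (Real.tendsto_exp_neg_atTop_nhds_zero.comp (tendsto_id.atTop_mul_const hδ)).mul_const W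
  rw [zero_mul] at htend
  obtain ⟨b, hb, hb0⟩ := ((htend.eventually_lt_const (mul_pos hη hpos)).and
    (eventually_ge_atTop 0)).exists
  have hS1 : MeasurableSet {x | T x ≤ m + δ} := measurableSet_le hT measurable_const
  have hS2 : MeasurableSet {x | T x ≤ m + 2 * δ} := measurableSet_le hT measurable_const
  have hnn : ∀ x, 0 ≤ h x * Real.exp (-b * T x) := fun x => mul_nonneg (h0 x) (Real.exp_pos _).le
  have hi : Integrable (fun x => h x * Real.exp (-b * T x)) μ := by
    refine hh.mono' (hh.1.mul (by fun_prop)) (Eventually.of_forall fun x => ?_)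
    rw [Real.norm_of_nonneg (hnn x)]
    refine mul_le_of_le_one_right (h0 x) (Real.exp_le_one_iff.2 ?_)
    nlinarith [mul_nonneg hb0 (hT0 x)]
  have hlow : Real.exp (-b * (m + δ)) * w ≤ ∫ x, h x * Real.exp (-b * T x) ∂μ := by
    rw [hw, ← integral_const_mul]
    refine (setIntegral_mono_on (hh.integrableOn.const_mul _) hi.integrableOn hS1 fun x hx => ?_).trans
      (setIntegral_le_integral hi (Eventually.of_forall hnn))
    rw [mul_comm]
    refine mul_le_mul_of_nonneg_left (Real.exp_le_exp.2 ?_) (h0 x)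
    have : T x ≤ m + δ := hx
    nlinarith
  have hup : ∫ x in {x | T x ≤ m + 2 * δ}ᶜ, h x * Real.exp (-b * T x) ∂μ ≤
      Real.exp (-b * (m + 2 * δ)) * W := by
    rw [hW, ← integral_const_mul]
    refine (setIntegral_mono_on hi.integrableOn (hh.const_mul _).integrableOn hS2.compl
      fun x hx => ?_).trans (setIntegral_le_integral (hh.const_mul _)
        (Eventually.of_forall fun x => mul_nonneg (Real.exp_pos _).le (h0 x)))
    rw [mul_comm]
    refine mul_le_mul_of_nonneg_right (Real.exp_le_exp.2 ?_) (h0 x)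
    have : m + 2 * δ < T x := not_le.1 hx
    nlinarith
  have hsplit := integral_add_compl hS2 hi
  have hcomp : Real.exp (-b * (m + 2 * δ)) * W ≤ η * ∫ x, h x * Real.exp (-b * T x) ∂μ := by
    refine le_trans ?_ (mul_le_mul_of_nonneg_left hlow hη.le)
    rw [show -b * (m + 2 * δ) = -b * (m + δ) + -(b * δ) by ring, Real.exp_add, mul_assoc,
      mul_left_comm η]
    exact mul_le_mul_of_nonneg_left hb.le (Real.exp_pos _).le
  exact ⟨b, hb0, (mul_pos (Real.exp_pos _) hpos).trans_le hlow, by linarith⟩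

section NonwaveOptimality

variable {d : ℕ}

theorem sqrt_massSq_pairMap_le {σ : ℝ} (hσ : 0 < σ) (p : Space d × Space d) :
    Real.sqrt (massSq (pairMap σ p)) ≤ energy σ p.1 + energy σ p.2 := by
  refine Real.sqrt_le_iff.2 ⟨(add_pos (energy_pos hσ _) (energy_pos hσ _)).le, ?_⟩
  exact sub_le_self _ (sq_nonneg _)

/-- The region contains an open neighbourhood of the pair at rest, and k is positive there except on
the null diagonal. -/
theorem setIntegral_pos_near_rest {σ : ℝ} (hd : 2 ≤ d) (hσ : 0 < σ) {k : Space d × Space d → ℝ}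
    (hk : ∀ p, 0 ≤ k p) (hk0 : ∀ p : Space d × Space d, p.1 ≠ p.2 → 0 < k p) (hi : Integrable k)
    {δ : ℝ} (hδ : 0 < δ) :
    0 < ∫ p in {p : Space d × Space d | energy σ p.1 + energy σ p.2 ≤ 2 * σ + δ}, k p := by
  have hE := continuous_energy (V := Space d) σ
  have hT : Continuous fun p : Space d × Space d => energy σ p.1 + energy σ p.2 := by fun_prop
  refine lt_of_le_of_ne (integral_nonneg hk) fun h0 => ?_
  have h1 := (setIntegral_eq_zero_iff_of_nonneg_ae (Eventually.of_forall hk) hi.integrableOn).1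
    h0.symm
  rw [EventuallyEq, ae_restrict_iff' (measurableSet_le hT.measurable measurable_const)] at h1
  have hopen : IsOpen {p : Space d × Space d | energy σ p.1 + energy σ p.2 < 2 * σ + δ} :=
    isOpen_lt hT continuous_const
  have hmem : (0 : Space d × Space d) ∈
      {p : Space d × Space d | energy σ p.1 + energy σ p.2 < 2 * σ + δ} := by
    have h2 : energy σ (0 : Space d) = σ := by
      rw [energy, norm_zero, zero_pow two_ne_zero, add_zero, Real.sqrt_sq hσ.le]
    change energy σ (0 : Space d) + energy σ (0 : Space d) < 2 * σ + δ
    rw [h2]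
    linarith
  refine (hopen.measure_pos volume ⟨_, hmem⟩).ne' (measure_mono_null (fun p hp => ?_)
    (ae_iff.1 (h1.and (ae_fst_ne_snd hd))))
  intro hcon
  have hp' : energy σ p.1 + energy σ p.2 < 2 * σ + δ := hp
  exact (hk0 p hcon.2).ne' (hcon.1 hp'.le)

/-- Raising the parameter from 1 to 1 + b/2 is an exponential tilt by the total energy, so the
concentration lemma stays within the family of profiles. -/
theorem expDensity_mul_shift (σ b : ℝ) (p : Space d × Space d) :
    expDensity σ (1 + b / 2) p.1 * expDensity σ (1 + b / 2) p.2 =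
      expDensity σ 1 p.1 * expDensity σ 1 p.2 *
        Real.exp (-b * (energy σ p.1 + energy σ p.2)) := by
  rw [expDensity_mul_eq, expDensity_mul_eq, mul_right_comm (Real.exp _), ← Real.exp_add]
  congr 2
  change -2 * (1 + b / 2) * (energy σ p.1 + energy σ p.2) =
    -2 * 1 * (energy σ p.1 + energy σ p.2) + -b * (energy σ p.1 + energy σ p.2)
  ring

/-- As `a → ∞`, the profiles concentrate at the zero frequency. -/
theorem exists_nearly_optimal_of_kernel (hd : 2 ≤ d) {s : ℝ} (hs : 0 < s) {β c : ℝ} (hc : 0 < c)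
    {k : Space d × Space d → ℝ} (hk : ∀ p, 0 ≤ k p)
    (hk0 : ∀ p : Space d × Space d, p.1 ≠ p.2 → 0 < k p)
    (hker : ∀ p : Space d × Space d, p.1 ≠ p.2 →
      nullKernel s β (pairMap (s / (2 * Real.pi)) p) =
        c * (k p / Real.sqrt (massSq (pairMap (s / (2 * Real.pi)) p))))
    (hi : ∀ f ∈ sobolevSpace d s 1, Integrable fun p : Space d × Space d =>
      energyDensity s f p.1 * energyDensity s f p.2 * k p) {ε : ℝ} (hε : 0 < ε) :
    ∃ (a : ℝ) (f : L2Space d), 0 < a ∧ IsExpProfile s a f ∧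
      0 < (∫ p : Space d × Space d, energyDensity s f p.1 * energyDensity s f p.2 * k p) ∧
      ENNReal.ofReal ((1 - ε) * (c / (2 * (s / (2 * Real.pi))) *
        ∫ p : Space d × Space d, energyDensity s f p.1 * energyDensity s f p.2 * k p)) ≤
          nullFormENorm s β f ^ 2 := by
  have hpi := Real.pi_pos
  have hσ : 0 < s / (2 * Real.pi) := by positivity
  set σ := s / (2 * Real.pi) with hσdef
  have hE := continuous_energy (V := Space d) σ
  have hT : Continuous fun p : Space d × Space d => energy σ p.1 + energy σ p.2 := by fun_prop
  have hT0 : ∀ p : Space d × Space d, 0 ≤ energy σ p.1 + energy σ p.2 := fun p =>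
    (add_pos (energy_pos hσ _) (energy_pos hσ _)).le
  have hae : ∀ (a : ℝ) (f : L2Space d), IsExpProfile s a f →
      (fun p : Space d × Space d => energyDensity s f p.1 * energyDensity s f p.2 * k p) =ᵐ[volume]
        fun p => expDensity σ a p.1 * expDensity σ a p.2 * k p := by
    intro a f hf
    filter_upwards [ae_energyDensity_mul_expProfile hs hf] with p hp
    rw [hp]
  have hnn : ∀ (a : ℝ) (p : Space d × Space d), 0 < expDensity σ a p.1 * expDensity σ a p.2 :=
    fun a p => mul_pos (expDensity_pos hσ a _) (expDensity_pos hσ a _)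
  have hi1 : Integrable fun p : Space d × Space d =>
      expDensity σ 1 p.1 * expDensity σ 1 p.2 * k p := by
    obtain ⟨f, hf⟩ := exists_isExpProfile d hs one_pos
    exact (hi f (expProfile_mem hs hf one_pos)).congr (hae 1 f hf)
  -- Near rest √M ≤ E + E' ≤ 2σ + 2δ = σ(2 + ε). Together with a mass loss of ε/2 this suffices,
  -- since (1 - ε)(2 + ε) ≤ 2(1 - ε/2).
  set δ := σ * ε / 2 with hδ
  have hδ0 : 0 < δ := by positivity
  obtain ⟨b, hb, hb1, hb2⟩ := exists_exp_concentration hi1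
    (fun p => mul_nonneg (hnn 1 p).le (hk p)) hT.measurable hT0 hδ0
    (setIntegral_pos_near_rest hd hσ (fun p => mul_nonneg (hnn 1 p).le (hk p))
      (fun p hp => mul_pos (hnn 1 p) (hk0 p hp)) hi1 hδ0) (half_pos hε)
  have ha : 0 < 1 + b / 2 := by positivity
  obtain ⟨f, hf⟩ := exists_isExpProfile d hs ha
  have hshift : ∀ p : Space d × Space d, expDensity σ 1 p.1 * expDensity σ 1 p.2 * k p *
      Real.exp (-b * (energy σ p.1 + energy σ p.2)) =
        expDensity σ (1 + b / 2) p.1 * expDensity σ (1 + b / 2) p.2 * k p := by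
    intro p
    rw [expDensity_mul_shift]
    ring
  simp only [hshift] at hb1 hb2
  rw [← integral_congr_ae (hae _ f hf)] at hb1 hb2
  rw [← integral_congr_ae (ae_restrict_of_ae (hae _ f hf))] at hb2
  have hif := hi f (expProfile_mem hs hf ha)
  set Q := ∫ p : Space d × Space d, energyDensity s f p.1 * energyDensity s f p.2 * k p with hQ
  refine ⟨1 + b / 2, f, ha, hf, hb1, ?_⟩
  set S := {p : Space d × Space d | energy σ p.1 + energy σ p.2 ≤ 2 * σ + 2 * δ} with hS
  have hSm : MeasurableSet S := measurableSet_le hT.measurable measurable_const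
  have hfun : ∀ p : Space d × Space d, energyDensity s f p.1 * energyDensity s f p.2 *
      S.indicator (fun p => c / (2 * σ + 2 * δ) * k p) p = S.indicator (fun p =>
        c / (2 * σ + 2 * δ) * (energyDensity s f p.1 * energyDensity s f p.2 * k p)) p := by
    intro p
    by_cases hp : p ∈ S
    · simp only [Set.indicator_of_mem hp]; ring
    · simp only [Set.indicator_of_notMem hp, mul_zero]
  have hkey := ofReal_integral_le_nullFormENorm_sq hs hf hd (β := β)
    (k := S.indicator fun p => c / (2 * σ + 2 * δ) * k p) (fun p hp => by
      by_cases hpS : p ∈ S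
      · rw [Set.indicator_of_mem hpS, hker p hp, div_mul_eq_mul_div, mul_div_assoc]
        refine mul_le_mul_of_nonneg_left (div_le_div_of_nonneg_left (hk p) ?_ ?_) hc.le
        · exact lt_trans (by positivity) (two_mul_lt_sqrt_massSq hσ hp)
        · exact (sqrt_massSq_pairMap_le hσ p).trans hpS
      · rw [Set.indicator_of_notMem hpS]
        exact nullKernel_nonneg _ _ _) (by
      simp only [hfun]
      exact (hif.const_mul _).indicator hSm)
  refine le_trans (ENNReal.ofReal_le_ofReal ?_) hkey
  simp only [hfun]
  rw [integral_indicator hSm, integral_const_mul]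
  refine le_trans ?_ (mul_le_mul_of_nonneg_left hb2 (by positivity))
  have h1 : (1 - ε) / (2 * σ) ≤ (1 - ε / 2) / (2 * σ + 2 * δ) := by
    rw [div_le_div_iff₀ (by positivity) (by positivity), hδ]
    nlinarith [mul_pos hσ (mul_pos hε hε)]
  have h2 := mul_le_mul_of_nonneg_right h1 (mul_pos hc hb1).le
  calc (1 - ε) * (c / (2 * σ) * Q) = (1 - ε) / (2 * σ) * (c * Q) := by ring
    _ ≤ (1 - ε / 2) / (2 * σ + 2 * δ) * (c * Q) := h2
    _ = _ := by ring

theorem exists_nearly_optimal_nonwave_half (hd : 2 ≤ d) {s : ℝ} (hs : 0 < s) {ε : ℝ} (hε : 0 < ε) :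
    ∃ f ∈ sobolevSpace d s (1 / 2), 0 < sobolevNorm s (1 / 2) f ^ 2 ∧
      ENNReal.ofReal ((1 - ε) * ((2 : ℝ) ^ (1 - (d : ℝ)) * Real.pi ^ ((1 - (d : ℝ)) / 2) *
          (Real.Gamma (((d : ℝ) - 1) / 2) / Real.Gamma ((d : ℝ) - 1)) * s⁻¹ *
        (sobolevNorm s (1 / 2) f ^ 2) ^ 2)) ≤ nullFormENorm s ((2 - (d : ℝ)) / 4) f ^ 2 := by
  have hpi := Real.pi_pos
  obtain ⟨a, f, ha, hf, hpos, hN⟩ := exists_nearly_optimal_of_kernel hd hs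
    (β := (2 - (d : ℝ)) / 4) (kernelConst_pos hd ((2 - (d : ℝ)) / 4)) (k := fun _ => 1)
    (fun _ => zero_le_one) (fun _ _ => one_pos) (fun p hp => nullKernel_nonwave_half hd hs hp)
    (fun f hf => by
      simpa using integrable_energyDensity_mul hs (sobolevSpace_one_subset hs hf)) hε
  simp only [mul_one] at hpos hN
  rw [integral_energyDensity_mul] at hpos hN
  have hI : 0 < ∫ ξ, energyDensity s f ξ :=
    lt_of_le_of_ne (integral_nonneg (energyDensity_nonneg s f)) fun h => by
      rw [← h] at hpos
      simp at hpos
  refine ⟨f, sobolevSpace_one_subset hs (expProfile_mem hs hf ha), ?_, ?_⟩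
  · rw [sobolevNorm_half_sq hs]
    positivity
  · rw [kernelConst_nonwave_half hd hs] at hN
    rw [sobolevNorm_half_sq hs]
    convert hN using 3
    ring

theorem exists_nearly_optimal_nonwave_one (hd : 2 ≤ d) {s : ℝ} (hs : 0 < s) {ε : ℝ} (hε : 0 < ε) :
    ∃ f ∈ sobolevSpace d s 1, 0 < refinedNorm s f ∧
      ENNReal.ofReal ((1 - ε) * ((2 : ℝ) ^ (2 - (d : ℝ)) * Real.pi ^ ((1 - (d : ℝ)) / 2) *
          (Real.Gamma (((d : ℝ) - 1) / 2) / Real.Gamma ((d : ℝ) - 1)) * s⁻¹ *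
        refinedNorm s f ^ 2)) ≤ nullFormENorm s ((4 - (d : ℝ)) / 4) f ^ 2 := by
  have hpi := Real.pi_pos
  have hσ : 0 < s / (2 * Real.pi) := by positivity
  obtain ⟨a, f, ha, hf, hpos, hN⟩ := exists_nearly_optimal_of_kernel hd hs
    (β := (4 - (d : ℝ)) / 4) (kernelConst_pos hd ((4 - (d : ℝ)) / 4))
    (k := excess (s / (2 * Real.pi))) (excess_nonneg hσ) (fun p hp => excess_pos hσ hp)
    (fun p hp => nullKernel_nonwave_one hd hs hp) (fun f hf => integrable_excess_mul hs hf) hε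
  have hmem := expProfile_mem hs hf ha
  rw [integral_excess_mul_expProfile hs hf ha] at hpos hN
  have hR := refinedNorm_sq hs hmem
  refine ⟨f, hmem, ?_, ?_⟩
  · refine lt_of_le_of_ne (Real.sqrt_nonneg _) fun h0 => ?_
    rw [← h0] at hR
    have h1 := mul_pos (by positivity : (0 : ℝ) < (2 * Real.pi) ^ 4) hpos
    linarith
  · have hC := kernelConst_nonwave_one hd hs
    refine le_trans (le_of_eq ?_) hN
    rw [hR, ← mul_assoc _ ((2 * Real.pi) ^ 4), ← hC]
    congr 2
    ring

end NonwaveOptimality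

end KleinGordon

/-! ### Assembly of the five sharp estimates -/

theorem mainTheorem6 (d : ℕ) (hd : 2 ≤ d) (s : ℝ) (hs : 0 < s) :
    -- wave regime
    (SharpWithoutExtremisers (sobolevSpace d s (1 / 2)) (nullFormENorm s ((3 - (d : ℝ)) / 4))
        (fun f => sobolevNorm s (1 / 2) f ^ 2)
        (Real.sqrt (waveConst ((3 - (d : ℝ)) / 4) d)) ∧
      SharpWithoutExtremisers (sobolevSpace d s 1) (nullFormENorm s ((5 - (d : ℝ)) / 4))
        (fun f => sobolevNorm s 1 f ^ 2)
        (Real.sqrt (waveConst ((5 - (d : ℝ)) / 4) d)) ∧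
      SharpWithoutExtremisers (sobolevSpace d s 1) (nullFormENorm s ((5 - (d : ℝ)) / 4))
        (refinedNorm s)
        (Real.sqrt (waveConst ((5 - (d : ℝ)) / 4) d))) ∧
    -- non-wave regime
    (SharpWithoutExtremisers (sobolevSpace d s (1 / 2)) (nullFormENorm s ((2 - (d : ℝ)) / 4))
        (fun f => sobolevNorm s (1 / 2) f ^ 2)
        (Real.sqrt ((2 : ℝ) ^ (1 - (d : ℝ)) * Real.pi ^ ((1 - (d : ℝ)) / 2) *
          (Real.Gamma (((d : ℝ) - 1) / 2) / Real.Gamma ((d : ℝ) - 1)) * s⁻¹)) ∧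
      SharpWithoutExtremisers (sobolevSpace d s 1) (nullFormENorm s ((4 - (d : ℝ)) / 4))
        (refinedNorm s)
        (Real.sqrt ((2 : ℝ) ^ (2 - (d : ℝ)) * Real.pi ^ ((1 - (d : ℝ)) / 2) *
          (Real.Gamma (((d : ℝ) - 1) / 2) / Real.Gamma ((d : ℝ) - 1)) * s⁻¹))) := by
  have hpi := Real.pi_pos
  have hsq : ∀ f ∈ sobolevSpace d s (1 / 2), 0 ≤ sobolevNorm s (1 / 2) f ^ 2 := fun f _ => sq_nonneg _
  have hsq' : ∀ f ∈ sobolevSpace d s 1, 0 ≤ sobolevNorm s 1 f ^ 2 := fun f _ => sq_nonneg _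
  have href : ∀ f ∈ sobolevSpace d s 1, 0 ≤ refinedNorm s f := fun f _ => Real.sqrt_nonneg _
  have hw1 : 0 ≤ waveConst ((3 - (d : ℝ)) / 4) d := by
    refine nonneg_of_mul_nonneg_left (b := (2 * Real.pi) ^ 2) ?_ (by positivity)
    rw [← kernelConst_wave_half hd]
    exact (kernelConst_pos hd _).le
  have hw2 := (waveConst_one_pos hd).le
  have hn1 := (nonwaveConst_pos hd hs (1 - (d : ℝ))).le
  have hn2 := (nonwaveConst_pos hd hs (2 - (d : ℝ))).le
  refine ⟨⟨?_, ?_, ?_⟩, ?_, ?_⟩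
  · refine sharpWithoutExtremisers_of (Real.sqrt_nonneg _) (nullFormENorm_zero hd hs _) hsq ?_ ?_
    · rw [Real.sq_sqrt hw1]
      exact fun f hf hf0 => nullFormENorm_sq_lt_wave_half hd hs hf hf0
    · rw [Real.sq_sqrt hw1]
      exact fun ε hε hε1 => exists_nearly_optimal_wave_half hd hs hε hε1
  · refine sharpWithoutExtremisers_of (Real.sqrt_nonneg _) (nullFormENorm_zero hd hs _) hsq' ?_ ?_
    · rw [Real.sq_sqrt hw2]
      exact fun f hf hf0 => nullFormENorm_sq_lt_wave_one hd hs hf hf0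
    · rw [Real.sq_sqrt hw2]
      intro ε hε hε1
      obtain ⟨f, hf, -, hf1, hf2⟩ := exists_nearly_optimal_wave_one hd hs hε hε1
      exact ⟨f, hf, hf1, hf2⟩
  · refine sharpWithoutExtremisers_of (Real.sqrt_nonneg _) (nullFormENorm_zero hd hs _) href ?_ ?_
    · rw [Real.sq_sqrt hw2]
      exact fun f hf hf0 => nullFormENorm_sq_lt_wave_refined hd hs hf hf0
    · rw [Real.sq_sqrt hw2]
      intro ε hε hε1
      -- The profile that nearly saturates the unrefined estimate also serves here, because the
      -- refined right-hand side is no larger.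
      obtain ⟨f, hf, hf1, -, hf2⟩ := exists_nearly_optimal_wave_one hd hs hε hε1
      refine ⟨f, hf, hf1, le_trans (ENNReal.ofReal_le_ofReal ?_) hf2⟩
      exact mul_le_mul_of_nonneg_left (mul_le_mul_of_nonneg_left (refinedNorm_sq_le hs hf) hw2)
        (by linarith)
  · refine sharpWithoutExtremisers_of (Real.sqrt_nonneg _) (nullFormENorm_zero hd hs _) hsq ?_ ?_
    · rw [Real.sq_sqrt hn1]
      exact fun f hf hf0 => nullFormENorm_sq_lt_nonwave_half hd hs hf hf0
    · rw [Real.sq_sqrt hn1]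
      exact fun ε hε _ => exists_nearly_optimal_nonwave_half hd hs hε
  · refine sharpWithoutExtremisers_of (Real.sqrt_nonneg _) (nullFormENorm_zero hd hs _) href ?_ ?_
    · rw [Real.sq_sqrt hn2]
      exact fun f hf hf0 => nullFormENorm_sq_lt_nonwave_refined hd hs hf hf0
    · rw [Real.sq_sqrt hn2]
      exact fun ε hε _ => exists_nearly_optimal_nonwave_one hd hs hε
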